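/- **Setting.** Let $K$ be an extension field of $\mathbb Q(q,s)$ with $q,s$ algebraically independent over $\mathbb Q$ (for instance $K=\mathbb C(q,s)$), let $N\ge 1$ and let $\lambda$ be a partition of $N$. Diagrams are drawn with the first row at the bottom. A *reverse standard tableau* (RST) of shape $\lambda$ is a filling $\mathbb T$ by $1,\dots,N$, each used once, strictly decreasing along rows (left to right) and columns (bottom to top). For an RST $\mathbb T$, $\mathrm{CT}_{\mathbb T}[i]$ (column minus row) is the content of $i$, and $\mathbb T^{(i,j)}$ is $\mathbb T$ with $i,j$ exchanged. Operators act on the right. Let $V_\lambda$ be the $K$-space with basis the RST of shape $\lambda$, with the Hecke action ($1\le i<N$, $m=\mathrm{CT}_{\mathbb T}[i+1]-\mathrm{CT}_{\mathbb T}[i]$): $\mathbb T T_i=s\mathbb T$ if $i,i+1$ are in the same row; $\mathbb T T_i=-\mathbb T$ if they are in the same column; $\mathbb T T_i=\mathbb T^{(i,i+1)}-\frac{1-s}{1-s^m}\mathbb T$ if the row of $i$ is below that of $i+1$ and the columns differ; $\mathbb T T_i=\frac{s-1}{1-s^m}\mathbb T+\frac{s(1-s^{m+1})(1-s^{m-1})}{(1-s^m)^2}\mathbb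 T^{(i,i+1)}$ if it is above and the columns differ. On $\mathcal M_\lambda=K[x_1,\dots,x_N]\otimes V_\lambda$ put $\mathbf T_i=\delta_i\otimes 1+s_i\otimes T_i$, where $s_i$ exchanges $x_i,x_{i+1}$ and $f\delta_i=(1-s)\,x_{i+1}\frac{f-fs_i}{x_i-x_{i+1}}$; put $\mathbf T_i^{-1}=\frac1s(\mathbf T_i+1-s)$ and $\boldsymbol\Phi=\mathbf T_1^{-1}\cdots\mathbf T_{N-1}^{-1}x_N$. **Yang–Baxter graph and Macdonald polynomials.** The vertices are 4-tuples $(\mathbb T,\zeta,v,\sigma)$ ($\mathbb T$ an RST, $\zeta\in K^N$, $v\in\mathbb N^N$, $\sigma\in\mathfrak S_N$), starting from the root $(\mathbb T_\lambda,(s^{\mathrm{CT}_{\mathbb T_\lambda}[i]})_i,0^N,\mathrm{id})$, where $\mathbb T_\lambda$ is filled with $N,N-1,\dots,1$ column by column (left to right, each from bottom to top), and adding arrows: * an arrow $s_i$ to $(\mathbb T,\zeta s_i,vs_i,\sigma s_i)$ if $v[i]<v[i+1]$, and to $(\mathbb T^{(\sigma[i],\sigma[i+1])},\zeta s_i,v,\sigma)$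 if $v[i]=v[i+1]$, $\mathbb T^{(\sigma[i],\sigma[i+1])}$ is an RST and $\mathrm{CT}_{\mathbb T}[\sigma[i]]\ge \mathrm{CT}_{\mathbb T}[\sigma[i+1]]+2$ (here $s_i$ exchanges the $i$-th and $(i+1)$-st entries of a vector); * an affine arrow $\Psi$ to $(\mathbb T,[\zeta[2],\dots,\zeta[N],q\zeta[1]],[v[2],\dots,v[N],v[1]+1],[\sigma[2],\dots,\sigma[N],\sigma[1]])$. A vertex is determined by its $\zeta$. The polynomial $P_\zeta\in\mathcal M_\lambda$ is obtained along any path from the root: it is $1\otimes\mathbb T_\lambda$ at the root, an arrow $s_i$ from $\zeta$ gives $P_{\zeta s_i}=P_\zeta\bigl(\mathbf T_i+\frac{1-s}{1-\zeta[i+1]/\zeta[i]}\bigr)$, and an arrow $\Psi$ multiplies on the right by $\boldsymbol\Phi$; the result does not depend on the path. For a vertex let $T(\mathbb T,v)$ be the filling obtained from $\mathbb T$ by replacing each $i$ by the $i$-th entry of the decreasing rearrangement of $v$. Removing the affine arrows, one obtains a graph whose connected components are indexed by these fillings: $H_T$ is the component of the vertices with $T(\mathbb T,v)=T$. Write $\zeta\in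 T$ if $\zeta$ is a vertex of $H_T$, and let $\zeta_{\mathrm{root}(T)}$ be the vertex of $H_T$ that is the target of no arrow of $H_T$. For integers put $q^{a}s^{b}\succ q^{a'}s^{b'}$ if $a>a'$, or $a=a'$ and $b\le b'-2$. **Theorem.** Let $T$ be a tableau of shape $\lambda$ with entries in $\mathbb N$ (weakly increasing along rows, left to right, and along columns, bottom to top). Let $\mathcal M_T=\mathrm{span}\{P_\zeta:\zeta\in T\}$ and $\mathcal M_T^{\mathrm{sym}}=\{\mathfrak f\in\mathcal M_T:\ \mathfrak f\,\mathbf T_i=s\,\mathfrak f\ \text{ for } 1\le i<N\}$. 1. If $T$ is column-strict (strictly increasing along columns), then $\dim\mathcal M_T^{\mathrm{sym}}=1$. Moreover there is a unique family $(b_\zeta)_{\zeta\in T}$ in $K$ with $b_{\zeta_{\mathrm{root}(T)}}=1$ and $$b_{\zeta s_i}=\frac{\zeta[i]-\zeta[i+1]}{s\,\zeta[i]-\zeta[i+1]}\,b_\zeta\qquad\text{whenever }\zeta[i+1]\succ\zeta[i],$$ and $\mathcal M_T^{\mathrm{sym}}$ is generated by $\mathfrak M_T=\sum_{\zeta\in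 T}b_\zeta P_\zeta$. 2. If $T$ is not column-strict, then $\mathcal M_T^{\mathrm{sym}}=0$. -/

import Mathlib

namespace VVMac

/-! ### Tableaux

Cells of a Young diagram are pairs `(row, column)`, both counted from `0`; row `0` is the bottom
row (French convention).  The integers `1, …, N` with `N = n + 1` are represented by `Fin (n + 1)`,
so that the integer `k` is the element of value `k - 1`. -/

/-- The cells of the diagram `lam`. -/
abbrev Cell (lam : YoungDiagram) : Type := {c : ℕ × ℕ // c ∈ lam.cells}

/-- `e k` is the cell that holds the entry `k`.  The filling is reverse standard if the entries
strictly decrease along each row and along each column. -/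
def IsRST {lam : YoungDiagram} {n : ℕ} (e : Fin (n + 1) ≃ Cell lam) : Prop :=
  ∀ a b : Fin (n + 1),
    ((e a).1.1 = (e b).1.1 → (e a).1.2 < (e b).1.2 → b < a) ∧
    ((e a).1.2 = (e b).1.2 → (e a).1.1 < (e b).1.1 → b < a)

/-- Reverse standard tableaux of shape `lam`, given by the position of each entry. -/
def RST (lam : YoungDiagram) (n : ℕ) : Type :=
  {e : Fin (n + 1) ≃ Cell lam // IsRST e}

namespace RST

variable {lam : YoungDiagram} {n : ℕ}

/-- The row of the entry `k`. -/
def row (t : RST lam n) (k : Fin (n + 1)) : ℕ := (t.1 k).1.1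

/-- The column of the entry `k`. -/
def col (t : RST lam n) (k : Fin (n + 1)) : ℕ := (t.1 k).1.2

/-- The content (column minus row) of the entry `k`. -/
def ct (t : RST lam n) (k : Fin (n + 1)) : ℤ := (t.col k : ℤ) - (t.row k : ℤ)

/-- The filling obtained by exchanging the entries `k` and `l`. -/
def exchange (t : RST lam n) (k l : Fin (n + 1)) : Fin (n + 1) ≃ Cell lam :=
  (Equiv.swap k l).trans t.1

end RST

/-- The diagram read column by column, each column from bottom to top, as an order isomorphism
with the cells ordered lexicographically by (column, row). -/
noncomputable def columnReading {lam : YoungDiagram} {n : ℕ} (hlam : lam.card = n + 1) :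
    Fin (n + 1) ≃o (lam.cells.image fun c : ℕ × ℕ => toLex (c.2, c.1)) :=
  (lam.cells.image fun c : ℕ × ℕ => toLex (c.2, c.1)).orderIsoOfFin (by
    rw [Finset.card_image_of_injective, ← hlam]
    intro a b h
    have h' : (a.2, a.1) = (b.2, b.1) := toLex.injective h
    simp only [Prod.mk.injEq] at h'
    exact Prod.ext h'.2 h'.1)

/-- A cell, seen as a pair (column, row). -/
def cellLex (lam : YoungDiagram) :
    (lam.cells.image fun c : ℕ × ℕ => toLex (c.2, c.1)) ≃ Cell lam where
  toFun p := ⟨((ofLex p.1).2, (ofLex p.1).1), by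
    obtain ⟨p, hp⟩ := p
    obtain ⟨c, hc, rfl⟩ := Finset.mem_image.mp hp
    simpa using hc⟩
  invFun c := ⟨toLex (c.1.2, c.1.1), Finset.mem_image.mpr ⟨c.1, c.2, rfl⟩⟩
  left_inv p := by simp
  right_inv c := by simp

/-- The tableau obtained by filling the columns from left to right, each one from bottom to top,
with `N, N - 1, …, 1`. -/
noncomputable def rootTab {lam : YoungDiagram} {n : ℕ} (hlam : lam.card = n + 1) : RST lam n :=
  ⟨Fin.revPerm.trans ((columnReading hlam).toEquiv.trans (cellLex lam)), by
    have key : ∀ a b : Fin (n + 1),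
        (columnReading hlam a.rev).1 < (columnReading hlam b.rev).1 → b < a := by
      intro a b h
      have h1 : columnReading hlam a.rev < columnReading hlam b.rev := h
      rw [(columnReading hlam).lt_iff_lt, Fin.rev_lt_rev] at h1
      exact h1
    intro a b
    refine ⟨fun h1 h2 => key a b ?_, fun h1 h2 => key a b ?_⟩
    · exact Prod.Lex.lt_iff.mpr (Or.inl h2)
    · exact Prod.Lex.lt_iff.mpr (Or.inr ⟨h1, h2⟩)⟩

/-- Fillings of the shape `lam` with nonnegative integers. -/
abbrev Filling (lam : YoungDiagram) : Type := Cell lam → ℕ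

/-- A tableau: weakly increasing along each row and along each column. -/
def IsTableau {lam : YoungDiagram} (T : Filling lam) : Prop :=
  ∀ c d : Cell lam,
    (c.1.1 = d.1.1 → c.1.2 < d.1.2 → T c ≤ T d) ∧
    (c.1.2 = d.1.2 → c.1.1 < d.1.1 → T c ≤ T d)

/-- Strictly increasing along each column. -/
def ColumnStrict {lam : YoungDiagram} (T : Filling lam) : Prop :=
  ∀ c d : Cell lam, c.1.2 = d.1.2 → c.1.1 < d.1.1 → T c < T d

/-- The decreasing rearrangement of `v`. -/
def decr {n : ℕ} (v : Fin (n + 1) → ℕ) : Fin (n + 1) → ℕ :=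
  fun i => v (Tuple.sort v i.rev)

/-- The filling `T(t, v)`: each entry `i` of `t` is replaced by the `i`-th entry of the decreasing
rearrangement of `v`. -/
def fill {lam : YoungDiagram} {n : ℕ} (t : RST lam n) (v : Fin (n + 1) → ℕ) : Filling lam :=
  fun c => decr v (t.1.symm c)

/-! ### The operators on vector valued polynomials

Operators act on the right in the literature, `f A B` meaning first `A`, then `B`; here they are
linear maps, applied in the same order. The index `i : Fin n` refers to the pair of consecutive
positions `i.castSucc`, `i.succ`. -/

section Operators

variable {K : Type*} [Field K]

/-- Exchange of the variables `x_i` and `x_{i+1}`. -/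
noncomputable def swapX {n : ℕ} (i : Fin n) :
    MvPolynomial (Fin (n + 1)) K →ₗ[K] MvPolynomial (Fin (n + 1)) K :=
  (MvPolynomial.rename (Equiv.swap i.castSucc i.succ)).toLinearMap

theorem sub_swapX_dvd {n : ℕ} (i : Fin n) (f : MvPolynomial (Fin (n + 1)) K) :
    (MvPolynomial.X i.castSucc - MvPolynomial.X i.succ) ∣ f - swapX i f := by
  set I : Ideal (MvPolynomial (Fin (n + 1)) K) :=
    Ideal.span {MvPolynomial.X i.castSucc - MvPolynomial.X i.succ} with hI
  have hX : Ideal.Quotient.mkₐ K I (MvPolynomial.X i.castSucc)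
      = Ideal.Quotient.mkₐ K I (MvPolynomial.X i.succ) :=
    Ideal.Quotient.eq.mpr (Ideal.subset_span rfl)
  have h : Ideal.Quotient.mkₐ K I = (Ideal.Quotient.mkₐ K I).comp
      (MvPolynomial.rename (Equiv.swap i.castSucc i.succ)) := by
    apply MvPolynomial.algHom_ext
    intro j
    rw [AlgHom.comp_apply, MvPolynomial.rename_X]
    rcases eq_or_ne j i.castSucc with rfl | h1
    · rw [Equiv.swap_apply_left]; exact hX
    rcases eq_or_ne j i.succ with rfl | h2
    · rw [Equiv.swap_apply_right]; exact hX.symm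
    · rw [Equiv.swap_apply_of_ne_of_ne h1 h2]
  rw [← Ideal.mem_span_singleton]
  exact Ideal.Quotient.eq.mp (DFunLike.congr_fun h f)

theorem X_sub_X_ne_zero {n : ℕ} (i : Fin n) :
    (MvPolynomial.X i.castSucc - MvPolynomial.X i.succ : MvPolynomial (Fin (n + 1)) K) ≠ 0 := by
  intro h
  have h1 := MvPolynomial.X_injective (R := K) (sub_eq_zero.mp h)
  exact absurd h1 (ne_of_lt (Fin.castSucc_lt_succ))

/-- The divided difference: `divDiff i f = (f - f s_i) / (x_i - x_{i+1})`. -/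
noncomputable def divDiff {n : ℕ} (i : Fin n) :
    MvPolynomial (Fin (n + 1)) K →ₗ[K] MvPolynomial (Fin (n + 1)) K where
  toFun f := Classical.choose (sub_swapX_dvd i f)
  map_add' f g := by
    apply mul_left_cancel₀ (X_sub_X_ne_zero (K := K) i)
    rw [mul_add, ← Classical.choose_spec (sub_swapX_dvd i (f + g)),
      ← Classical.choose_spec (sub_swapX_dvd i f), ← Classical.choose_spec (sub_swapX_dvd i g),
      map_add]
    ring
  map_smul' c f := by
    apply mul_left_cancel₀ (X_sub_X_ne_zero (K := K) i)
    rw [RingHom.id_apply, mul_smul_comm, ← Classical.choose_spec (sub_swapX_dvd i (c • f)),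
      ← Classical.choose_spec (sub_swapX_dvd i f), map_smul, smul_sub]

theorem divDiff_spec {n : ℕ} (i : Fin n) (f : MvPolynomial (Fin (n + 1)) K) :
    (MvPolynomial.X i.castSucc - MvPolynomial.X i.succ) * divDiff i f = f - swapX i f :=
  (Classical.choose_spec (sub_swapX_dvd i f)).symm

/-- `δ_i f = (1 - s) x_{i+1} (f ∂_i)`. -/
noncomputable def delta {n : ℕ} (s : K) (i : Fin n) :
    MvPolynomial (Fin (n + 1)) K →ₗ[K] MvPolynomial (Fin (n + 1)) K :=
  (1 - s) • (LinearMap.mulLeft K (MvPolynomial.X i.succ) ∘ₗ divDiff i)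

variable (K) in
/-- The vector space with basis the reverse standard tableaux of shape `lam`. -/
abbrev V (lam : YoungDiagram) (n : ℕ) : Type _ := RST lam n →₀ K

open Classical in
/-- The filling `t` with `k` and `l` exchanged, as a basis vector (only used when it is a reverse
standard tableau). -/
noncomputable def exchangeVec {lam : YoungDiagram} {n : ℕ} (t : RST lam n) (k l : Fin (n + 1)) :
    V K lam n :=
  if h : IsRST (t.exchange k l) then Finsupp.single ⟨t.exchange k l, h⟩ 1 else 0

/-- The image of the tableau `t` under the generator `T_i` of the Hecke algebra. -/
noncomputable def heckeVec {lam : YoungDiagram} {n : ℕ} (s : K) (i : Fin n) (t : RST lam n) :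
    V K lam n :=
  let m : ℤ := t.ct i.succ - t.ct i.castSucc
  if t.row i.castSucc = t.row i.succ then s • Finsupp.single t 1
  else if t.col i.castSucc = t.col i.succ then -Finsupp.single t 1
  else if t.row i.castSucc < t.row i.succ then
    exchangeVec t i.castSucc i.succ - ((1 - s) / (1 - s ^ m)) • Finsupp.single t 1
  else
    ((s - 1) / (1 - s ^ m)) • Finsupp.single t 1 +
      (s * (1 - s ^ (m + 1)) * (1 - s ^ (m - 1)) / (1 - s ^ m) ^ 2) •
        exchangeVec t i.castSucc i.succ

/-- The generator `T_i` of the Hecke algebra, acting on `V`. -/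
noncomputable def heckeV {lam : YoungDiagram} {n : ℕ} (s : K) (i : Fin n) :
    V K lam n →ₗ[K] V K lam n :=
  Finsupp.linearCombination K (heckeVec s i)

variable (K) in
/-- The space of vector valued polynomials. -/
abbrev VPoly (lam : YoungDiagram) (n : ℕ) : Type _ :=
  TensorProduct K (MvPolynomial (Fin (n + 1)) K) (V K lam n)

/-- The operator `𝐓_i = δ_i ⊗ 1 + s_i ⊗ T_i`. -/
noncomputable def bT {lam : YoungDiagram} {n : ℕ} (s : K) (i : Fin n) :
    VPoly K lam n →ₗ[K] VPoly K lam n :=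
  TensorProduct.map (delta s i) LinearMap.id + TensorProduct.map (swapX i) (heckeV s i)

/-- The inverse `𝐓_i⁻¹ = (𝐓_i + (1 - s)) / s`. -/
noncomputable def bTinv {lam : YoungDiagram} {n : ℕ} (s : K) (i : Fin n) :
    VPoly K lam n →ₗ[K] VPoly K lam n :=
  s⁻¹ • (bT s i + (1 - s) • LinearMap.id)

/-- The raising operator `𝐓_1⁻¹ ⋯ 𝐓_{N-1}⁻¹ x_N`: first `𝐓_1⁻¹`, …, then `𝐓_{N-1}⁻¹`, and finally
multiplication by `x_N`. -/
noncomputable def bPhi {lam : YoungDiagram} {n : ℕ} (s : K) :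
    VPoly K lam n →ₗ[K] VPoly K lam n :=
  TensorProduct.map (LinearMap.mulLeft K (MvPolynomial.X (Fin.last n))) LinearMap.id ∘ₗ
    (List.finRange n).foldl (fun A i => bTinv s i ∘ₗ A) LinearMap.id

end Operators

/-! ### The Yang-Baxter graph -/

section Graph

variable {K : Type*} [Field K]

variable (K) in
/-- The 4-tuples `(𝕋, ζ, v, σ)`. -/
structure Tuple4 (lam : YoungDiagram) (n : ℕ) where
  tab : RST lam n
  spec : Fin (n + 1) → K
  ind : Fin (n + 1) → ℕ
  perm : Equiv.Perm (Fin (n + 1))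

variable {lam : YoungDiagram} {n : ℕ}

open Classical in
/-- The action of the elementary transposition `s_i` on 4-tuples. -/
noncomputable def Tuple4.act (x : Tuple4 K lam n) (i : Fin n) : Tuple4 K lam n :=
  if x.ind i.succ ≠ x.ind i.castSucc then
    { tab := x.tab
      spec := x.spec ∘ Equiv.swap i.castSucc i.succ
      ind := x.ind ∘ Equiv.swap i.castSucc i.succ
      perm := x.perm * Equiv.swap i.castSucc i.succ }
  else if h : IsRST (x.tab.exchange (x.perm i.castSucc) (x.perm i.succ)) then
    { tab := ⟨x.tab.exchange (x.perm i.castSucc) (x.perm i.succ), h⟩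
      spec := x.spec ∘ Equiv.swap i.castSucc i.succ
      ind := x.ind
      perm := x.perm }
  else x

/-- The affine action `Ψ` on 4-tuples. -/
def Tuple4.psi (q : K) (x : Tuple4 K lam n) : Tuple4 K lam n where
  tab := x.tab
  spec := Fin.snoc (α := fun _ => K) (fun j : Fin n => x.spec j.succ) (q * x.spec 0)
  ind := Fin.snoc (α := fun _ => ℕ) (fun j : Fin n => x.ind j.succ) (x.ind 0 + 1)
  perm := x.perm * finRotate (n + 1)

/-- The root of the Yang-Baxter graph. -/
noncomputable def rootTuple (s : K) (hlam : lam.card = n + 1) : Tuple4 K lam n where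
  tab := rootTab hlam
  spec := fun i => s ^ (rootTab hlam).ct i
  ind := fun _ => 0
  perm := 1

/-- There is an arrow labelled `s_i`, other than a fall, from `x` to `x.act i`: either
`v[i] < v[i+1]`, or `v[i] = v[i+1]` and `σ[i]` is to the south-east of `σ[i+1]`. -/
def Tuple4.HasArrow (x : Tuple4 K lam n) (i : Fin n) : Prop :=
  x.ind i.castSucc < x.ind i.succ ∨
    (x.ind i.castSucc = x.ind i.succ ∧
      IsRST (x.tab.exchange (x.perm i.castSucc) (x.perm i.succ)) ∧
      x.tab.ct (x.perm i.succ) + 2 ≤ x.tab.ct (x.perm i.castSucc))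

/-- The paths without fall from the root of the Yang-Baxter graph to the vertex `x`. -/
inductive YBPath (q s : K) (hlam : lam.card = n + 1) : Tuple4 K lam n → Type _
  | nil : YBPath q s hlam (rootTuple s hlam)
  | step {x : Tuple4 K lam n} (p : YBPath q s hlam x) (i : Fin n) (h : x.HasArrow i) :
      YBPath q s hlam (x.act i)
  | affine {x : Tuple4 K lam n} (p : YBPath q s hlam x) : YBPath q s hlam (x.psi q)

/-- The polynomial attached to a path. -/
noncomputable def YBPath.poly {q s : K} {hlam : lam.card = n + 1} :
    {x : Tuple4 K lam n} → YBPath q s hlam x → VPoly K lam n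
  | _, .nil => 1 ⊗ₜ[K] Finsupp.single (rootTab hlam) 1
  | _, .step (x := x) p i _ =>
      bT s i p.poly + ((1 - s) / (1 - x.spec i.succ / x.spec i.castSucc)) • p.poly
  | _, .affine p => bPhi s p.poly

/-- The vertices (other than `∅`) of the Yang-Baxter graph. -/
def IsVertex (q s : K) (hlam : lam.card = n + 1) (x : Tuple4 K lam n) : Prop :=
  Nonempty (YBPath q s hlam x)

open Classical in
/-- The Macdonald polynomial of the vertex `x`: the polynomial of any path from the root to `x`
(they all give the same one). -/
noncomputable def macdonald (q s : K) (hlam : lam.card = n + 1) (x : Tuple4 K lam n) :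
    VPoly K lam n :=
  if h : IsVertex q s hlam x then (Classical.choice h).poly else 0

/-- The arrows of the graph obtained from the Yang-Baxter graph by removing the affine arrows, the
falls and the vertex `∅`. -/
def HArrow (q s : K) (hlam : lam.card = n + 1) (x y : Tuple4 K lam n) : Prop :=
  IsVertex q s hlam x ∧ IsVertex q s hlam y ∧ ∃ i : Fin n, x.HasArrow i ∧ y = x.act i

/-- The connected component attached to the filling `T`: the vertices that are connected, without
affine arrows and falls, to a vertex `(𝕋, ζ, v, σ)` with `T(𝕋, v) = T`. -/
def component (q s : K) (hlam : lam.card = n + 1) (T : Filling lam) : Set (Tuple4 K lam n) :=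
  {x | IsVertex q s hlam x ∧ ∃ y, IsVertex q s hlam y ∧ fill y.tab y.ind = T ∧
    Relation.EqvGen (HArrow q s hlam) x y}

/-- `x` is a root of the component: it belongs to the component and has no antecedent. -/
def IsRootOf (q s : K) (hlam : lam.card = n + 1) (T : Filling lam) (x : Tuple4 K lam n) : Prop :=
  x ∈ component q s hlam T ∧ ∀ y, ¬ HArrow q s hlam y x

/-- The space spanned by the Macdonald polynomials of the component of `T`. -/
noncomputable def MT (q s : K) (hlam : lam.card = n + 1) (T : Filling lam) :
    Submodule K (VPoly K lam n) :=
  Submodule.span K (macdonald q s hlam '' component q s hlam T)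

/-- The symmetric polynomials in `MT`: those with `f 𝐓_i = s f` for all `i`. -/
noncomputable def symMT (q s : K) (hlam : lam.card = n + 1) (T : Filling lam) :
    Submodule K (VPoly K lam n) :=
  MT q s hlam T ⊓ ⨅ i : Fin n, LinearMap.ker (bT s i - s • LinearMap.id)

/-- The order `≻` on monomials `q^a s^b`. -/
def Succ (q s : K) (y z : K) : Prop :=
  ∃ a b a' b' : ℤ, y = q ^ a * s ^ b ∧ z = q ^ a' * s ^ b' ∧
    (a' < a ∨ (a = a' ∧ b ≤ b' - 2))

/-- The coefficients `b_ζ` of the symmetric Macdonald polynomial: `b = 1` at the root of the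
component, and `b_{ζ s_i} = (ζ[i] - ζ[i+1]) / (s ζ[i] - ζ[i+1]) b_ζ` whenever
`ζ[i+1] ≻ ζ[i]`. -/
def IsSymCoeff (q s : K) (hlam : lam.card = n + 1) (T : Filling lam)
    (b : component q s hlam T → K) : Prop :=
  (∀ x, IsRootOf q s hlam T x.1 → b x = 1) ∧
  ∀ (x y : component q s hlam T) (i : Fin n),
    Succ q s (x.1.spec i.succ) (x.1.spec i.castSucc) → y.1 = x.1.act i →
      b y = (x.1.spec i.castSucc - x.1.spec i.succ) /
        (s * x.1.spec i.castSucc - x.1.spec i.succ) * b x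

/-- The polynomial `∑_ζ b_ζ P_ζ`, summed over the (finite) component of `T`. -/
noncomputable def symMacdonald (q s : K) (hlam : lam.card = n + 1) (T : Filling lam)
    (b : component q s hlam T → K) : VPoly K lam n :=
  ∑ᶠ x : component q s hlam T, b x • macdonald q s hlam x.1

end Graph

end VVMac

/-!
The polynomials attached to paths of the Yang-Baxter graph satisfy a recursion built from two kinds
of steps, the operators `Y i a b = 𝐓_i + (1 - s) / (1 - b / a)` and the raising operator `Φ`. The
Hecke relations (quadratic, braid, commutation), together with `𝐓_i Φ = Φ 𝐓_{i+1}` and its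
wrap-around version for `Φ²` (`heckeRel_bT`), give the Yang-Baxter equation for the `Y i a b`, and
the diamond lemma then shows that the polynomial depends only on the end of the path
(`reach_unique`). Arrows between equal parts of the composition move the starting vector
(`yb_equal`), where they act through the seminormal form of the Hecke algebra. Consequently the
vertices are exactly the pairs (tableau, composition), with a well-defined polynomial `vpoly`
(`isVertex_iff`, `macdonald_eq`), and each generator acts on the line or plane spanned by the
polynomials of a vertex and of its image under `s_i` (`vertex_cases`): along an arrow the plane is
genuine, and at a fall the generator acts by `s` (neighbours in a row) or by `-1` (neighbours in a
column).

The polynomials of degree `d` span the vector valued polynomials of degree `d`, since their span is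
stable under the generators and is raised by `Φ`, hence by the multiplications by the variables. As
there are as many of them as monomials, they are linearly independent (`linearIndependent_vpoly`).

For an element `∑ b_ζ P_ζ` of `MT`, being an eigenvector of all `𝐓_i` for the eigenvalue `s` means,
by comparing coefficients, that `b` is multiplied by `(ζ[i] - ζ[i+1]) / (s ζ[i] - ζ[i+1])` along
each arrow, and that it vanishes at the falls where a generator acts by `-1`
(`bT_sum_eq_iff`). All vertices of a component are reached along arrows from a single sorted vertex,
its root (`component_induction`, `isRootOf_iff`), so such a `b` is determined by its value at the
root, and vanishes as soon as it vanishes somewhere. Conversely, the product of the ratios over the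
inversions of the spectral vector satisfies the recursion (`invProd_comp_sw`). If the tableau is
column-strict there is no fall of the second kind, and the symmetric elements form a line; otherwise
there is one (`exists_column_fall`), and only zero is left.
-/

namespace VVMac

/-! ### Compositions and their standardizations -/

section Compositions

variable {n : ℕ}

/-- The transposition of the neighbouring positions `i` and `i + 1`. -/
abbrev sw (i : Fin n) : Equiv.Perm (Fin (n + 1)) := Equiv.swap i.castSucc i.succ

theorem comp_sw_castSucc {α : Type*} (f : Fin (n + 1) → α) (i : Fin n) :
    (f ∘ sw i) i.castSucc = f i.succ := by
  simp [sw]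

theorem comp_sw_succ {α : Type*} (f : Fin (n + 1) → α) (i : Fin n) :
    (f ∘ sw i) i.succ = f i.castSucc := by
  simp [sw]

theorem comp_sw_of_ne {α : Type*} (f : Fin (n + 1) → α) (i : Fin n) {j : Fin (n + 1)}
    (h1 : j ≠ i.castSucc) (h2 : j ≠ i.succ) : (f ∘ sw i) j = f j := by
  simp [sw, Equiv.swap_apply_of_ne_of_ne h1 h2]

theorem comp_sw_sw {α : Type*} (f : Fin (n + 1) → α) (i : Fin n) : (f ∘ sw i) ∘ sw i = f := by
  funext j; simp [sw]

/-- A neighbouring transposition reverses the order of the two neighbours only. -/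
theorem sw_lt_sw_iff (i : Fin n) {a b : Fin (n + 1)} (h1 : ¬ (a = i.castSucc ∧ b = i.succ))
    (h2 : ¬ (a = i.succ ∧ b = i.castSucc)) : sw i a < sw i b ↔ a < b := by
  simp only [sw, Equiv.swap_apply_def, Fin.lt_def]
  split_ifs <;> simp only [Fin.ext_iff, Fin.val_castSucc, Fin.val_succ] at * <;> omega

theorem perm_eq_one_of_strictMono {m : ℕ} (p : Equiv.Perm (Fin m)) (h : StrictMono p) : p = 1 := by
  have := Subsingleton.elim (h.orderIsoOfSurjective _ p.surjective) (OrderIso.refl (Fin m))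
  ext1 x
  exact DFunLike.congr_fun this x

/-- `σ` is the standardization of `v`: it numbers the positions by decreasing value of `v`, and
positions with the same value from left to right. -/
def IsStd (v : Fin (n + 1) → ℕ) (σ : Equiv.Perm (Fin (n + 1))) : Prop :=
  ∀ i j, σ i < σ j ↔ (v j < v i ∨ v i = v j ∧ i < j)

/-- The standardization of `v`. -/
def std (v : Fin (n + 1) → ℕ) : Equiv.Perm (Fin (n + 1)) :=
  (Tuple.sort (fun i => OrderDual.toDual (v i)))⁻¹

theorem isStd_std (v : Fin (n + 1) → ℕ) : IsStd v (std v) := by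
  obtain ⟨h1, h2⟩ := Tuple.eq_sort_iff.mp (rfl : Tuple.sort (fun i => OrderDual.toDual (v i)) = _)
  have hτ : ∀ i, Tuple.sort (fun i => OrderDual.toDual (v i)) (std v i) = i := fun i => by
    simp [std]
  have key : ∀ i j, (v j < v i ∨ v i = v j ∧ i < j) → std v i < std v j := by
    intro i j h
    by_contra hc
    have h3 := h1 (not_lt.mp hc)
    simp only [Function.comp, hτ, OrderDual.toDual_le_toDual] at h3
    rcases h with h | ⟨h, hij⟩
    · omega
    · rcases (not_lt.mp hc).lt_or_eq with h4 | h4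
      · have := h2 _ _ h4 (by simp only [hτ]; rw [h])
        simp only [hτ] at this
        exact absurd this hij.asymm
      · exact hij.ne' ((std v).injective h4)
  intro i j
  refine ⟨fun h => ?_, key i j⟩
  by_contra hc
  have hne : i ≠ j := fun h' => by simp [h'] at h
  have : v i < v j ∨ v j = v i ∧ j < i := by
    rcases lt_or_gt_of_ne hne with h' | h' <;> simp only [h', h'.asymm, and_true, and_false] at hc ⊢
      <;> omega
  exact (key j i this).asymm h

theorem IsStd.unique {v : Fin (n + 1) → ℕ} {σ τ : Equiv.Perm (Fin (n + 1))} (hσ : IsStd v σ)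
    (hτ : IsStd v τ) : σ = τ := by
  have : σ * τ⁻¹ = 1 := by
    apply perm_eq_one_of_strictMono
    intro a b hab
    simp only [Equiv.Perm.mul_apply]
    rw [hσ, ← hτ]
    simpa using hab
  exact mul_inv_eq_one.mp this

theorem IsStd.std_eq {v : Fin (n + 1) → ℕ} {σ : Equiv.Perm (Fin (n + 1))} (hσ : IsStd v σ) :
    std v = σ := (isStd_std v).unique hσ

theorem std_of_antitone {v : Fin (n + 1) → ℕ} (hv : Antitone v) : std v = 1 := by
  apply IsStd.std_eq
  intro i j
  simp only [Equiv.Perm.one_apply]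
  constructor
  · intro h
    rcases (hv h.le).lt_or_eq with h' | h'
    · exact Or.inl h'
    · exact Or.inr ⟨h'.symm, h⟩
  · rintro (h | h)
    · by_contra hc
      have := hv (not_lt.mp hc)
      omega
    · exact h.2

theorem std_comp_sw {v : Fin (n + 1) → ℕ} {i : Fin n} (h : v i.castSucc ≠ v i.succ) :
    std (v ∘ sw i) = std v * sw i := by
  apply IsStd.std_eq
  intro a b
  simp only [Equiv.Perm.mul_apply]
  rw [isStd_std v]
  have ha : (v ∘ sw i) a = v (sw i a) := rfl
  have hb : (v ∘ sw i) b = v (sw i b) := rfl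
  rw [ha, hb]
  by_cases h1 : a = i.castSucc ∧ b = i.succ
  · obtain ⟨rfl, rfl⟩ := h1
    simp [sw, Ne.symm h]
  by_cases h2 : a = i.succ ∧ b = i.castSucc
  · obtain ⟨rfl, rfl⟩ := h2
    simp [sw, h]
  rw [sw_lt_sw_iff i h1 h2]

/-- Positions with equal neighbouring values carry consecutive numbers. -/
theorem std_succ_eq {v : Fin (n + 1) → ℕ} {i : Fin n} (h : v i.castSucc = v i.succ) :
    (std v i.succ).1 = (std v i.castSucc).1 + 1 := by
  have h1 : std v i.castSucc < std v i.succ :=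
    (isStd_std v _ _).mpr (Or.inr ⟨h, Fin.castSucc_lt_succ⟩)
  by_contra hc
  have h2 : (std v i.castSucc).1 + 1 < (std v i.succ).1 := by
    have : (std v i.castSucc).1 < (std v i.succ).1 := h1
    omega
  obtain ⟨j, hj⟩ := (std v).surjective ⟨(std v i.castSucc).1 + 1, by omega⟩
  have h3 : std v i.castSucc < std v j := by rw [hj, Fin.lt_def]; simp
  have h4 : std v j < std v i.succ := by rw [hj, Fin.lt_def]; exact h2
  rw [isStd_std] at h3 h4
  simp only [Fin.lt_def, Fin.val_castSucc, Fin.val_succ] at h3 h4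
  omega

theorem exists_std_eq {v : Fin (n + 1) → ℕ} {i : Fin n} (h : v i.castSucc = v i.succ) :
    ∃ k : Fin n, std v i.castSucc = k.castSucc ∧ std v i.succ = k.succ := by
  have h1 := std_succ_eq h
  refine ⟨⟨(std v i.castSucc).1, by have := (std v i.succ).2; omega⟩, ?_, ?_⟩
  · ext; simp
  · ext; simpa using h1

/-- The affine step on compositions: `[v_2, …, v_N, v_1 + 1]`. -/
def psiInd (v : Fin (n + 1) → ℕ) : Fin (n + 1) → ℕ :=
  Fin.snoc (α := fun _ => ℕ) (fun j : Fin n => v j.succ) (v 0 + 1)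

/-- The inverse of the affine step on compositions with positive last part:
`[v_N - 1, v_1, …, v_{N-1}]`. -/
def pd (w : Fin (n + 1) → ℕ) : Fin (n + 1) → ℕ :=
  Fin.cons (α := fun _ => ℕ) (w (Fin.last n) - 1) (fun j : Fin n => w j.castSucc)

@[simp] theorem psiInd_castSucc (v : Fin (n + 1) → ℕ) (j : Fin n) :
    psiInd v j.castSucc = v j.succ := by simp [psiInd]

@[simp] theorem psiInd_last (v : Fin (n + 1) → ℕ) : psiInd v (Fin.last n) = v 0 + 1 := by
  simp [psiInd]

@[simp] theorem pd_zero (w : Fin (n + 1) → ℕ) : pd w 0 = w (Fin.last n) - 1 := rfl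

@[simp] theorem pd_succ (w : Fin (n + 1) → ℕ) (j : Fin n) : pd w j.succ = w j.castSucc := rfl

@[simp] theorem pd_psiInd (v : Fin (n + 1) → ℕ) : pd (psiInd v) = v := by
  funext j
  induction j using Fin.cases with
  | zero => simp
  | succ j => simp

theorem psiInd_pd {w : Fin (n + 1) → ℕ} (h : 0 < w (Fin.last n)) : psiInd (pd w) = w := by
  funext j
  induction j using Fin.lastCases with
  | last => simp; omega
  | cast j => simp

theorem finRotate_castSucc (j : Fin n) : finRotate (n + 1) j.castSucc = j.succ := by
  rw [finRotate_apply]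
  ext
  simp

theorem std_psiInd (v : Fin (n + 1) → ℕ) : std (psiInd v) = std v * finRotate (n + 1) := by
  apply IsStd.std_eq
  intro a b
  simp only [Equiv.Perm.mul_apply]
  rw [isStd_std v]
  induction a using Fin.lastCases with
  | last =>
    induction b using Fin.lastCases with
    | last => simp
    | cast b =>
      simp only [finRotate_last, finRotate_castSucc, psiInd_castSucc, psiInd_last, Fin.lt_def,
        Fin.val_zero, Fin.val_succ, Fin.val_last, Fin.val_castSucc]
      omega
  | cast a =>
    induction b using Fin.lastCases with
    | last =>
      simp only [finRotate_last, finRotate_castSucc, psiInd_castSucc, psiInd_last, Fin.lt_def,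
        Fin.val_zero, Fin.val_succ, Fin.val_last, Fin.val_castSucc]
      omega
    | cast b =>
      simp only [finRotate_castSucc, psiInd_castSucc, Fin.lt_def, Fin.val_succ, Fin.val_castSucc]
      omega

theorem std_pd_zero {w : Fin (n + 1) → ℕ} (h : 0 < w (Fin.last n)) :
    std (pd w) 0 = std w (Fin.last n) := by
  conv_rhs => rw [← psiInd_pd h, std_psiInd]
  simp

theorem std_pd_succ {w : Fin (n + 1) → ℕ} (h : 0 < w (Fin.last n)) (j : Fin n) :
    std (pd w) j.succ = std w j.castSucc := by
  conv_rhs => rw [← psiInd_pd h, std_psiInd]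
  rw [Equiv.Perm.mul_apply, finRotate_castSucc]

/-- The well-founded order on compositions along which the Yang-Baxter graph grows: by degree, then
by the position of the large parts. -/
def Lower (v w : Fin (n + 1) → ℕ) : Prop :=
  ∑ i, v i < ∑ i, w i ∨
    (∑ i, v i = ∑ i, w i ∧ ∑ i, (n - i.1) * v i < ∑ i, (n - i.1) * w i)

theorem lower_wf : WellFounded (Lower (n := n)) := by
  have : WellFounded (InvImage (Prod.Lex (· < ·) (· < ·))
      (fun v : Fin (n + 1) → ℕ => (∑ i, v i, ∑ i, (n - i.1) * v i))) :=
    InvImage.wf _ (WellFounded.prod_lex wellFounded_lt wellFounded_lt)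
  refine Subrelation.wf ?_ this
  intro v w h
  exact (Prod.lex_def).mpr h

theorem Lower.trans {u v w : Fin (n + 1) → ℕ} (h1 : Lower u v) (h2 : Lower v w) : Lower u w := by
  unfold Lower at *
  omega

theorem sum_psiInd (v : Fin (n + 1) → ℕ) : ∑ i, psiInd v i = ∑ i, v i + 1 := by
  rw [Fin.sum_univ_castSucc, Fin.sum_univ_succ]
  simp only [psiInd_castSucc, psiInd_last]
  omega

theorem pd_lower {w : Fin (n + 1) → ℕ} (h : 0 < w (Fin.last n)) : Lower (pd w) w := by
  left
  conv_rhs => rw [← psiInd_pd h, sum_psiInd]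
  omega

theorem sum_comp_sw (v : Fin (n + 1) → ℕ) (i : Fin n) : ∑ j, (v ∘ sw i) j = ∑ j, v j :=
  Equiv.sum_comp (sw i) v

theorem sum_weight_comp_sw (v : Fin (n + 1) → ℕ) (i : Fin n) :
    ∑ j, (n - j.1) * (v ∘ sw i) j + v i.castSucc = ∑ j, (n - j.1) * v j + v i.succ := by
  have hne : i.succ ≠ i.castSucc := Fin.castSucc_lt_succ.ne'
  have hmem : i.succ ∈ Finset.univ.erase i.castSucc := by simp [hne]
  rw [← Finset.add_sum_erase _ _ (Finset.mem_univ i.castSucc),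
    ← Finset.add_sum_erase _ _ hmem,
    ← Finset.add_sum_erase _ (fun j => (n - j.1) * v j) (Finset.mem_univ i.castSucc),
    ← Finset.add_sum_erase _ (fun j => (n - j.1) * v j) hmem]
  rw [comp_sw_castSucc, comp_sw_succ]
  have : ∑ j ∈ (Finset.univ.erase i.castSucc).erase i.succ, (n - j.1) * (v ∘ sw i) j
      = ∑ j ∈ (Finset.univ.erase i.castSucc).erase i.succ, (n - j.1) * v j := by
    refine Finset.sum_congr rfl fun j hj => ?_
    simp only [Finset.mem_erase, Finset.mem_univ, and_true] at hj
    rw [comp_sw_of_ne v i hj.2 hj.1]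
  rw [this]
  obtain ⟨m, hm⟩ : ∃ m, n - i.1 = m + 1 := ⟨n - i.1 - 1, by omega⟩
  have e1 : n - i.castSucc.1 = m + 1 := by simpa using hm
  have e2 : n - i.succ.1 = m := by simp only [Fin.val_succ]; omega
  rw [e1, e2]
  ring

theorem sw_lower {w : Fin (n + 1) → ℕ} {i : Fin n} (h : w i.succ < w i.castSucc) :
    Lower (w ∘ sw i) w := by
  right
  refine ⟨sum_comp_sw w i, ?_⟩
  have := sum_weight_comp_sw w i
  omega

/-- A nonzero composition whose last part is zero has a positive part followed by a zero. -/
theorem exists_pos_zero {w : Fin (n + 1) → ℕ} (h : w (Fin.last n) = 0) (hw : w ≠ 0) :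
    ∃ j : Fin n, 0 < w j.castSucc ∧ w j.succ = 0 := by
  by_contra hc
  push Not at hc
  apply hw
  funext i
  induction i using Fin.reverseInduction with
  | last => exact h
  | cast j ih =>
    by_contra h0
    exact hc j (Nat.pos_of_ne_zero h0) ih

end Compositions

/-! ### Yang-Baxter paths for an abstract affine Hecke action -/

section AbstractHecke

variable {K : Type*} [Field K] {M : Type*} [AddCommGroup M] [Module K M] {n : ℕ}

/-- The relations between the generators `T_i` and the raising operator `Φ` that make the
Yang-Baxter construction path independent. -/
structure HeckeRel (s : K) (T : Fin n → Module.End K M) (Φ : Module.End K M) : Prop where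
  quad : ∀ i, T i * T i = (s - 1) • T i + s • 1
  braid : ∀ i j : Fin n, i.1 + 1 = j.1 → T i * T j * T i = T j * T i * T j
  comm : ∀ i j : Fin n, i.1 + 1 < j.1 → T i * T j = T j * T i
  phi : ∀ i j : Fin n, i.1 + 1 = j.1 → T i * Φ = Φ * T j
  phi_sq : ∀ i j : Fin n, i.1 + 1 = n → j.1 = 0 → T i * (Φ * Φ) = Φ * Φ * T j

/-- The coefficient of the Yang-Baxter operator that exchanges the spectral values `a` and `b`. -/
def cf (s a b : K) : K := (1 - s) / (1 - b / a)

/-- The Yang-Baxter operator `T_i + (1 - s) / (1 - b / a)`. -/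
def Y (s : K) (T : Fin n → Module.End K M) (i : Fin n) (a b : K) : Module.End K M :=
  T i + cf s a b • 1

theorem Y_apply (s : K) (T : Fin n → Module.End K M) (i : Fin n) (a b : K) (f : M) :
    Y s T i a b f = T i f + cf s a b • f := rfl

theorem cf_mul {q : K} (hq : q ≠ 0) (s a b : K) : cf s (q * a) (q * b) = cf s a b := by
  unfold cf
  rw [mul_div_mul_left _ _ hq]

theorem cf_add_cf {s a b : K} (ha : a ≠ 0) (hb : b ≠ 0) (hab : a ≠ b) :
    cf s a b + cf s b a = 1 - s := by
  unfold cf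
  have h1 : a - b ≠ 0 := sub_ne_zero.mpr hab
  have h2 : b - a ≠ 0 := sub_ne_zero.mpr hab.symm
  have h3 : 1 - b / a ≠ 0 := by
    rw [one_sub_div ha]; exact div_ne_zero h1 ha
  have h4 : 1 - a / b ≠ 0 := by
    rw [one_sub_div hb]; exact div_ne_zero h2 hb
  rw [one_sub_div ha, one_sub_div hb]
  field_simp
  ring

theorem cf_yang_baxter {s a b c : K} (ha : a ≠ 0) (hb : b ≠ 0) (hab : a ≠ b)
    (hac : a ≠ c) (hbc : b ≠ c) :
    cf s a c * (s - 1) + cf s a b * cf s a c + cf s a c * cf s b c = cf s a b * cf s b c := by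
  unfold cf
  have h1 : a - b ≠ 0 := sub_ne_zero.mpr hab
  have h2 : a - c ≠ 0 := sub_ne_zero.mpr hac
  have h3 : b - c ≠ 0 := sub_ne_zero.mpr hbc
  rw [one_sub_div ha, one_sub_div ha, one_sub_div hb]
  field_simp
  ring

theorem yang_baxter_of_coeff {A : Type*} [Ring A] [Algebra K A] {s α β γ : K} {x y : A}
    (hb : x * y * x = y * x * y) (hx : x * x = (s - 1) • x + s • (1 : A))
    (hy : y * y = (s - 1) • y + s • (1 : A)) (h : β * (s - 1) + α * β + β * γ = α * γ) :
    (x + γ • (1 : A)) * ((y + β • (1 : A)) * (x + α • (1 : A)))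
      = (y + α • (1 : A)) * ((x + β • (1 : A)) * (y + γ • (1 : A))) := by
  simp only [add_mul, mul_add, smul_mul_assoc, mul_smul_comm, one_mul, mul_one, ← mul_assoc]
  rw [hb, hx, hy]
  have e : (β * (s - 1) + α * β + β * γ - α * γ) • (x - y) = 0 := by rw [h, sub_self, zero_smul]
  rw [← sub_eq_zero, ← e]
  module

variable {s : K} {T : Fin n → Module.End K M} {Φ : Module.End K M}

theorem HeckeRel.yang_baxter (H : HeckeRel s T Φ) {i j : Fin n} (hij : i.1 + 1 = j.1) {a b c : K}
    (ha : a ≠ 0) (hb : b ≠ 0) (hab : a ≠ b) (hac : a ≠ c) (hbc : b ≠ c) (f : M) :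
    Y s T i b c (Y s T j a c (Y s T i a b f)) = Y s T j a b (Y s T i a c (Y s T j b c f)) :=
  LinearMap.congr_fun (yang_baxter_of_coeff (H.braid i j hij) (H.quad i) (H.quad j)
    (cf_yang_baxter ha hb hab hac hbc)) f

theorem HeckeRel.Y_comm (H : HeckeRel s T Φ) {i j : Fin n} (hij : i.1 + 1 < j.1) (a b c d : K)
    (f : M) : Y s T i a b (Y s T j c d f) = Y s T j c d (Y s T i a b f) := by
  have h := LinearMap.congr_fun (H.comm i j hij) f
  simp only [Module.End.mul_apply] at h
  simp only [Y_apply, map_add, map_smul, h]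
  module

theorem HeckeRel.Y_phi (H : HeckeRel s T Φ) {i j : Fin n} (hij : i.1 + 1 = j.1) (a b : K)
    (f : M) : Y s T i a b (Φ f) = Φ (Y s T j a b f) := by
  have h := LinearMap.congr_fun (H.phi i j hij) f
  simp only [Module.End.mul_apply] at h
  simp only [Y_apply, map_add, map_smul, h]

theorem HeckeRel.Y_phi_phi (H : HeckeRel s T Φ) {i j : Fin n} (hi : i.1 + 1 = n) (hj : j.1 = 0)
    (a b : K) (f : M) : Y s T i a b (Φ (Φ f)) = Φ (Φ (Y s T j a b f)) := by
  have h := LinearMap.congr_fun (H.phi_sq i j hi hj) f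
  simp only [Module.End.mul_apply] at h
  simp only [Y_apply, map_add, map_smul, h]

/-- The moves for `(a, b)` and then `(b, a)` compose to a scalar. -/
theorem HeckeRel.T_Y (H : HeckeRel s T Φ) (i : Fin n) {a b : K} (ha : a ≠ 0) (hb : b ≠ 0)
    (hab : a ≠ b) (f : M) :
    T i (Y s T i a b f)
      = -cf s b a • Y s T i a b f + ((1 - cf s a b) * (s + cf s a b)) • f := by
  have h := LinearMap.congr_fun (H.quad i) f
  simp only [Module.End.mul_apply, LinearMap.add_apply, LinearMap.smul_apply,
    Module.End.one_apply] at h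
  have hc : cf s b a = 1 - s - cf s a b := by rw [← cf_add_cf (s := s) ha hb hab]; ring
  simp only [Y_apply, map_add, map_smul, h, hc]
  module

/-! ### Spectral vectors -/

/-- The spectral vector of the composition `v` over the spectral vector `z` of the zero
composition. -/
def zeta (q : K) (z : Fin (n + 1) → K) (v : Fin (n + 1) → ℕ) (i : Fin (n + 1)) : K :=
  q ^ v i * z (std v i)

/-- Spectral values that no nontrivial power of `q` relates. -/
structure Generic (q : K) (z : Fin (n + 1) → K) : Prop where
  q_ne : q ≠ 0
  ne_zero : ∀ k, z k ≠ 0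
  pow_ne : ∀ k l (d : ℕ), 0 < d → q ^ d * z k ≠ z l

variable {q : K} {z : Fin (n + 1) → K}

theorem Generic.zeta_ne_zero (G : Generic q z) (v : Fin (n + 1) → ℕ) (i : Fin (n + 1)) :
    zeta q z v i ≠ 0 :=
  mul_ne_zero (pow_ne_zero _ G.q_ne) (G.ne_zero _)

theorem Generic.zeta_ne_of_lt (G : Generic q z) {v : Fin (n + 1) → ℕ} {i j : Fin (n + 1)}
    (h : v i < v j) : zeta q z v i ≠ zeta q z v j := by
  intro he
  unfold zeta at he
  obtain ⟨d, hd⟩ := Nat.exists_eq_add_of_lt h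
  rw [hd, show v i + d + 1 = v i + (d + 1) by ring, pow_add, mul_assoc] at he
  exact G.pow_ne _ _ (d + 1) (Nat.succ_pos d) (mul_left_cancel₀ (pow_ne_zero _ G.q_ne) he).symm

theorem Generic.zeta_ne (G : Generic q z) {v : Fin (n + 1) → ℕ} {i j : Fin (n + 1)}
    (h : v i ≠ v j) : zeta q z v i ≠ zeta q z v j := by
  rcases lt_or_gt_of_ne h with h | h
  · exact G.zeta_ne_of_lt h
  · exact (G.zeta_ne_of_lt h).symm

theorem zeta_comp_sw {v : Fin (n + 1) → ℕ} {i : Fin n} (h : v i.castSucc ≠ v i.succ) :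
    zeta q z (v ∘ sw i) = zeta q z v ∘ sw i := by
  funext j
  simp only [zeta, std_comp_sw h, Function.comp, Equiv.Perm.mul_apply]

theorem zeta_pd_zero {w : Fin (n + 1) → ℕ} (h : 0 < w (Fin.last n)) :
    zeta q z w (Fin.last n) = q * zeta q z (pd w) 0 := by
  unfold zeta
  rw [std_pd_zero h, pd_zero, ← mul_assoc, ← pow_succ', Nat.sub_add_cancel h]

theorem zeta_pd_succ {w : Fin (n + 1) → ℕ} (h : 0 < w (Fin.last n)) (j : Fin n) :
    zeta q z (pd w) j.succ = zeta q z w j.castSucc := by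
  unfold zeta
  rw [std_pd_succ h, pd_succ]

/-! ### Positions exchanged by neighbouring transpositions -/

theorem adjacent_castSucc {i j : Fin n} (hij : i.1 + 1 = j.1) : j.castSucc = i.succ := by
  ext; simpa using hij.symm

theorem adjacent_eval {α : Type*} {i j : Fin n} (hij : i.1 + 1 = j.1) (F : Fin (n + 1) → α) :
    (F ∘ sw i) j.succ = F j.succ ∧ (F ∘ sw j) i.castSucc = F i.castSucc ∧
      (F ∘ sw j) i.succ = F j.succ ∧ (F ∘ sw j) j.succ = F i.succ := by
  have h := adjacent_castSucc hij
  refine ⟨comp_sw_of_ne _ _ ?_ ?_, comp_sw_of_ne _ _ ?_ ?_, ?_, ?_⟩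
  · intro h; simp only [Fin.ext_iff, Fin.val_castSucc, Fin.val_succ] at h; omega
  · intro h; simp only [Fin.ext_iff, Fin.val_succ] at h; omega
  · intro h; simp only [Fin.ext_iff, Fin.val_castSucc] at h; omega
  · intro h; simp only [Fin.ext_iff, Fin.val_castSucc, Fin.val_succ] at h; omega
  · rw [← h, comp_sw_castSucc]
  · rw [comp_sw_succ, h]

theorem far_eval {α : Type*} {i j : Fin n} (hij : i.1 + 1 < j.1) (F : Fin (n + 1) → α) :
    (F ∘ sw i) j.castSucc = F j.castSucc ∧ (F ∘ sw i) j.succ = F j.succ ∧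
      (F ∘ sw j) i.castSucc = F i.castSucc ∧ (F ∘ sw j) i.succ = F i.succ := by
  refine ⟨comp_sw_of_ne _ _ ?_ ?_, comp_sw_of_ne _ _ ?_ ?_, comp_sw_of_ne _ _ ?_ ?_,
    comp_sw_of_ne _ _ ?_ ?_⟩ <;> intro h <;>
    simp only [Fin.ext_iff, Fin.val_castSucc, Fin.val_succ] at h <;> omega

theorem braid_comp {α : Type*} {i j : Fin n} (hij : i.1 + 1 = j.1) (F : Fin (n + 1) → α) :
    ((F ∘ sw i) ∘ sw j) ∘ sw i = ((F ∘ sw j) ∘ sw i) ∘ sw j := by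
  have h := adjacent_castSucc hij
  have h1 : i.castSucc ≠ i.succ := Fin.castSucc_lt_succ.ne
  have h2 : j.castSucc ≠ j.succ := Fin.castSucc_lt_succ.ne
  have h3 : i.castSucc ≠ j.succ := by
    intro h; simp only [Fin.ext_iff, Fin.val_castSucc, Fin.val_succ] at h; omega
  have e1 := Equiv.swap_mul_swap_mul_swap h1 h3
  have e2 := Equiv.swap_mul_swap_mul_swap (h ▸ h2).symm h3.symm
  have e : sw i * sw j * sw i = sw j * sw i * sw j := by
    rw [sw, sw, h, e1, Equiv.swap_comm i.castSucc, Equiv.swap_comm i.succ j.succ, e2,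
      Equiv.swap_comm]
  funext k
  exact congrArg F (DFunLike.congr_fun e k)

theorem far_comp {α : Type*} {i j : Fin n} (hij : i.1 + 1 < j.1) (F : Fin (n + 1) → α) :
    (F ∘ sw i) ∘ sw j = (F ∘ sw j) ∘ sw i := by
  funext k
  simp only [Function.comp, sw, Equiv.swap_apply_def]
  congr 1
  split_ifs <;> simp only [Fin.ext_iff, Fin.val_castSucc, Fin.val_succ] at * <;> omega

theorem pd_comp_sw {i j : Fin n} (hij : i.1 + 1 = j.1) (w : Fin (n + 1) → ℕ) :
    pd (w ∘ sw i) = pd w ∘ sw j := by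
  funext k
  have h := adjacent_castSucc hij
  induction k using Fin.cases with
  | zero =>
    rw [comp_sw_of_ne _ _ (by rw [h]; exact (Fin.succ_ne_zero _).symm) (Fin.succ_ne_zero _).symm,
      pd_zero, pd_zero, comp_sw_of_ne]
    · intro h; simp only [Fin.ext_iff, Fin.val_castSucc, Fin.val_last] at h; omega
    · intro h; simp only [Fin.ext_iff, Fin.val_last, Fin.val_succ] at h; omega
  | succ k =>
    rw [pd_succ]
    by_cases h1 : k = i
    · subst h1
      rw [comp_sw_castSucc, ← h, comp_sw_castSucc, pd_succ]
    by_cases h2 : k = j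
    · subst h2
      rw [comp_sw_succ, h, comp_sw_succ, pd_succ]
    · rw [comp_sw_of_ne, comp_sw_of_ne, pd_succ] <;> intro h3 <;>
        simp only [Fin.ext_iff, Fin.val_castSucc, Fin.val_succ] at h1 h2 h3 <;> omega

/-- Exchanging the last two parts becomes, after two inverse affine steps, exchanging the first
two. -/
theorem pd_pd_comp_sw {i j : Fin n} (hi : i.1 + 1 = n) (hj : j.1 = 0) (w : Fin (n + 1) → ℕ) :
    pd (pd (w ∘ sw i)) = pd (pd w) ∘ sw j := by
  obtain ⟨m, rfl⟩ : ∃ m, n = m + 1 := ⟨i.1, hi.symm⟩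
  obtain rfl : i = Fin.last m := by ext; simp; omega
  obtain rfl : j = 0 := by ext; simpa using hj
  have h0 : (Fin.castSucc (0 : Fin (m + 1))) = 0 := rfl
  have hl : Fin.last (m + 1) = (Fin.last m).succ := rfl
  funext k
  induction k using Fin.cases with
  | zero =>
    conv_rhs => rw [← h0]
    rw [comp_sw_castSucc, pd_succ, h0, pd_zero, pd_zero, hl, pd_succ, comp_sw_castSucc]
  | succ k =>
    induction k using Fin.cases with
    | zero => rw [comp_sw_succ, pd_succ, h0, pd_zero, pd_zero, hl, pd_succ, comp_sw_succ]
    | succ k =>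
      rw [comp_sw_of_ne _ _ (by simp [Fin.ext_iff]) (by simp [Fin.ext_iff]), pd_succ, pd_succ,
        ← Fin.succ_castSucc, pd_succ, pd_succ, comp_sw_of_ne]
      · intro h; simp only [Fin.ext_iff, Fin.val_castSucc, Fin.val_last] at h; omega
      · intro h; simp only [Fin.ext_iff, Fin.val_castSucc, Fin.val_succ, Fin.val_last] at h; omega

/-! ### Path independence -/

/-- `Reach q s T Φ z u v f`: the vector `f` is obtained from `u` along some path of affine steps and
Yang-Baxter moves from the zero composition to the composition `v`, for the spectral vectors over
`z`. The rules are read from the end of the path. -/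
inductive Reach (q s : K) (T : Fin n → Module.End K M) (Φ : Module.End K M)
    (z : Fin (n + 1) → K) (u : M) : (Fin (n + 1) → ℕ) → M → Prop
  | zero : Reach q s T Φ z u 0 u
  | aff {w : Fin (n + 1) → ℕ} {g : M} (h : 0 < w (Fin.last n)) (hg : Reach q s T Φ z u (pd w) g) :
      Reach q s T Φ z u w (Φ g)
  | step {w : Fin (n + 1) → ℕ} {g : M} (i : Fin n) (h : w i.succ < w i.castSucc)
      (hg : Reach q s T Φ z u (w ∘ sw i) g) :
      Reach q s T Φ z u w (Y s T i (zeta q z w i.succ) (zeta q z w i.castSucc) g)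

variable {u : M}

theorem Reach.up {v : Fin (n + 1) → ℕ} {g : M} (hg : Reach q s T Φ z u v g) (i : Fin n)
    (h : v i.castSucc < v i.succ) :
    Reach q s T Φ z u (v ∘ sw i) (Y s T i (zeta q z v i.castSucc) (zeta q z v i.succ) g) := by
  have h1 := Reach.step (q := q) (s := s) (T := T) (Φ := Φ) (z := z) (u := u) (w := v ∘ sw i)
    (g := g) i (by rw [comp_sw_succ, comp_sw_castSucc]; exact h) (by rwa [comp_sw_sw])
  rwa [zeta_comp_sw h.ne, comp_sw_succ, comp_sw_castSucc] at h1

theorem Reach.psi {v : Fin (n + 1) → ℕ} {g : M} (hg : Reach q s T Φ z u v g) :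
    Reach q s T Φ z u (psiInd v) (Φ g) :=
  Reach.aff (by simp) (by rwa [pd_psiInd])

theorem exists_reach (q s : K) (T : Fin n → Module.End K M) (Φ : Module.End K M)
    (z : Fin (n + 1) → K) (u : M) (v : Fin (n + 1) → ℕ) : ∃ f, Reach q s T Φ z u v f := by
  induction v using lower_wf.induction with
  | _ w ih =>
  rcases Nat.eq_zero_or_pos (w (Fin.last n)) with h | h
  · rcases eq_or_ne w 0 with rfl | hw
    · exact ⟨u, Reach.zero⟩
    · obtain ⟨j, h1, h2⟩ := exists_pos_zero h hw
      have h3 : w j.succ < w j.castSucc := by omega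
      obtain ⟨g, hg⟩ := ih _ (sw_lower h3)
      exact ⟨_, Reach.step j h3 hg⟩
  · obtain ⟨g, hg⟩ := ih _ (pd_lower h)
    exact ⟨_, Reach.aff h hg⟩

/-- Two paths ending with an affine step and with a Yang-Baxter move come from a common vertex. -/
theorem reach_unique_aff_step (H : HeckeRel s T Φ) (G : Generic q z) {w : Fin (n + 1) → ℕ}
    (ih : ∀ v, Lower v w → ∀ f g, Reach q s T Φ z u v f → Reach q s T Φ z u v g → f = g)
    (h : 0 < w (Fin.last n)) {g1 g2 : M} (hg1 : Reach q s T Φ z u (pd w) g1)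
    {i : Fin n} (hi : w i.succ < w i.castSucc) (hg2 : Reach q s T Φ z u (w ∘ sw i) g2) :
    Φ g1 = Y s T i (zeta q z w i.succ) (zeta q z w i.castSucc) g2 := by
  by_cases hin : i.1 + 1 < n
  · obtain ⟨j, hij⟩ : ∃ j : Fin n, i.1 + 1 = j.1 := ⟨⟨i.1 + 1, hin⟩, rfl⟩
    have hc := adjacent_castSucc hij
    have hl : 0 < (w ∘ sw i) (Fin.last n) := by
      rwa [comp_sw_of_ne]
      · intro h; simp only [Fin.ext_iff, Fin.val_castSucc, Fin.val_last] at h; omega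
      · intro h; simp only [Fin.ext_iff, Fin.val_last, Fin.val_succ] at h; omega
    obtain ⟨k, hk⟩ := exists_reach q s T Φ z u (pd (w ∘ sw i))
    have e2 : g2 = Φ k := ih _ (sw_lower hi) _ _ hg2 (Reach.aff hl hk)
    have hj : pd w j.succ < pd w j.castSucc := by rwa [hc, pd_succ, pd_succ, hc]
    rw [pd_comp_sw hij] at hk
    have e1 := ih _ (pd_lower h) _ _ hg1 (Reach.step j hj hk)
    rw [e1, e2, H.Y_phi hij, zeta_pd_succ h, hc, zeta_pd_succ h]
  · have hin' : i.1 + 1 = n := by have := i.2; omega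
    have hlast : Fin.last n = i.succ := by ext; simp [hin']
    obtain ⟨j, hj0⟩ : ∃ j : Fin n, j.1 = 0 := ⟨⟨0, by omega⟩, rfl⟩
    have hjc : j.castSucc = 0 := by ext; simpa using hj0
    obtain ⟨k, hk⟩ := exists_reach q s T Φ z u (pd (pd (w ∘ sw i)))
    have hl1 : 0 < (w ∘ sw i) (Fin.last n) := by rw [hlast, comp_sw_succ]; omega
    have hl2 : 0 < pd (w ∘ sw i) (Fin.last n) := by
      rw [hlast, pd_succ, comp_sw_castSucc, ← hlast]; exact h
    have e2 : g2 = Φ (Φ k) := ih _ (sw_lower hi) _ _ hg2 (Reach.aff hl1 (Reach.aff hl2 hk))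
    have hl3 : 0 < pd w (Fin.last n) := by rw [hlast, pd_succ]; omega
    rw [pd_pd_comp_sw hin' hj0] at hk
    have e0 : pd (pd w) j.castSucc = w i.castSucc - 1 := by rw [hjc, pd_zero, hlast, pd_succ]
    have e0' : pd (pd w) j.succ = w i.succ - 1 := by rw [pd_succ, hjc, pd_zero, hlast]
    have hj : pd (pd w) j.succ < pd (pd w) j.castSucc := by
      rw [e0, e0']; rw [hlast] at h; omega
    have e1 := ih _ (pd_lower h) _ _ hg1 (Reach.aff hl3 (Reach.step j hj hk))
    have z1 : zeta q z w i.succ = q * zeta q z (pd (pd w)) j.succ := by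
      rw [zeta_pd_succ hl3, hjc, ← zeta_pd_zero h, hlast]
    have z2 : zeta q z w i.castSucc = q * zeta q z (pd (pd w)) j.castSucc := by
      rw [hjc, ← zeta_pd_zero hl3, hlast, zeta_pd_succ h]
    rw [e1, e2, H.Y_phi_phi hin' hj0, z1, z2, Y, Y, cf_mul G.q_ne]

theorem reach_unique_far (H : HeckeRel s T Φ) {w : Fin (n + 1) → ℕ}
    (ih : ∀ v, Lower v w → ∀ f g, Reach q s T Φ z u v f → Reach q s T Φ z u v g → f = g)
    {g1 g2 : M} {i j : Fin n} (hij : i.1 + 1 < j.1)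
    (hi : w i.succ < w i.castSucc) (hg1 : Reach q s T Φ z u (w ∘ sw i) g1)
    (hj : w j.succ < w j.castSucc) (hg2 : Reach q s T Φ z u (w ∘ sw j) g2) :
    Y s T i (zeta q z w i.succ) (zeta q z w i.castSucc) g1
      = Y s T j (zeta q z w j.succ) (zeta q z w j.castSucc) g2 := by
  obtain ⟨k, hk⟩ := exists_reach q s T Φ z u ((w ∘ sw i) ∘ sw j)
  obtain ⟨a1, a2, a3, a4⟩ := far_eval hij w
  obtain ⟨b1, b2, b3, b4⟩ := far_eval hij (zeta q z w)
  have e1 := ih _ (sw_lower hi) _ _ hg1 (Reach.step j (by rwa [a1, a2]) hk)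
  rw [far_comp hij] at hk
  have e2 := ih _ (sw_lower hj) _ _ hg2 (Reach.step i (by rwa [a3, a4]) hk)
  rw [zeta_comp_sw hi.ne', b1, b2] at e1
  rw [zeta_comp_sw hj.ne', b3, b4] at e2
  rw [e1, e2, H.Y_comm hij]

theorem reach_unique_adjacent (H : HeckeRel s T Φ) (G : Generic q z) {w : Fin (n + 1) → ℕ}
    (ih : ∀ v, Lower v w → ∀ f g, Reach q s T Φ z u v f → Reach q s T Φ z u v g → f = g)
    {g1 g2 : M} {i j : Fin n} (hij : i.1 + 1 = j.1)
    (hi : w i.succ < w i.castSucc) (hg1 : Reach q s T Φ z u (w ∘ sw i) g1)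
    (hj : w j.succ < w j.castSucc) (hg2 : Reach q s T Φ z u (w ∘ sw j) g2) :
    Y s T i (zeta q z w i.succ) (zeta q z w i.castSucc) g1
      = Y s T j (zeta q z w j.succ) (zeta q z w j.castSucc) g2 := by
  have hc := adjacent_castSucc hij
  have hN := fun F : Fin (n + 1) → ℕ => adjacent_eval hij F
  have hK := fun F : Fin (n + 1) → K => adjacent_eval hij F
  have n1 := fun F => (hN F).1
  have n2 := fun F => (hN F).2.1
  have n3 := fun F => (hN F).2.2.1
  have n4 := fun F => (hN F).2.2.2
  have k1 := fun F => (hK F).1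
  have k2 := fun F => (hK F).2.1
  have k3 := fun F => (hK F).2.2.1
  have k4 := fun F => (hK F).2.2.2
  rw [hc] at hj
  have hik := hj.trans hi
  have l1 : (w ∘ sw i) j.succ < (w ∘ sw i) j.castSucc := by
    rwa [hc, n1, comp_sw_succ]
  have l2 : ((w ∘ sw i) ∘ sw j) i.succ < ((w ∘ sw i) ∘ sw j) i.castSucc := by
    rwa [n3, n2, n1, comp_sw_castSucc]
  have r1 : (w ∘ sw j) i.succ < (w ∘ sw j) i.castSucc := by
    rwa [n3, n2]
  have r2 : ((w ∘ sw j) ∘ sw i) j.succ < ((w ∘ sw j) ∘ sw i) j.castSucc := by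
    rwa [hc, n1, n4, comp_sw_succ, n2]
  obtain ⟨k, hk⟩ := exists_reach q s T Φ z u (((w ∘ sw i) ∘ sw j) ∘ sw i)
  have e1 := ih _ (sw_lower hi) _ _ hg1 (Reach.step j l1 (Reach.step i l2 hk))
  rw [braid_comp hij] at hk
  have e2 := ih _ (sw_lower (by rwa [hc])) _ _ hg2 (Reach.step i r1 (Reach.step j r2 hk))
  rw [zeta_comp_sw l1.ne', zeta_comp_sw hi.ne', hc] at e1
  rw [zeta_comp_sw r1.ne', zeta_comp_sw (by rw [hc]; exact hj.ne'), hc] at e2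
  simp only [k1, k2, k3, k4, comp_sw_succ, comp_sw_castSucc] at e1 e2
  rw [e1, e2, hc]
  exact H.yang_baxter hij (G.zeta_ne_zero _ _) (G.zeta_ne_zero _ _)
    (G.zeta_ne hj.ne) (G.zeta_ne hik.ne) (G.zeta_ne hi.ne) k

/-- Path independence: the vector attached to a composition does not depend on the path. Two last
steps are always completed to a square, to a Yang-Baxter hexagon, or to the relation between two
affine steps and the exchange of the last two parts. -/
theorem reach_unique (H : HeckeRel s T Φ) (G : Generic q z) (v : Fin (n + 1) → ℕ) :
    ∀ f g, Reach q s T Φ z u v f → Reach q s T Φ z u v g → f = g := by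
  induction v using lower_wf.induction with
  | _ w ih =>
  intro f g hf hg
  cases hf with
  | zero =>
    cases hg with
    | zero => rfl
    | aff h => simp at h
    | step i h => simp at h
  | aff h hf =>
    cases hg with
    | zero => simp at h
    | aff h hg => rw [ih _ (pd_lower h) _ _ hf hg]
    | step i h' hg => exact reach_unique_aff_step H G ih h hf h' hg
  | step i h hf =>
    cases hg with
    | zero => simp at h
    | aff h' hg => exact (reach_unique_aff_step H G ih h' hg h hf).symm
    | step j h' hg =>
      rcases lt_trichotomy i.1 j.1 with hij | hij | hij
      · rcases Nat.lt_or_eq_of_le (Nat.succ_le_of_lt hij) with h2 | h2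
        · exact reach_unique_far H ih h2 h hf h' hg
        · exact reach_unique_adjacent H G ih h2 h hf h' hg
      · obtain rfl := Fin.ext hij
        rw [ih _ (sw_lower h) _ _ hf hg]
      · rcases Nat.lt_or_eq_of_le (Nat.succ_le_of_lt hij) with h2 | h2
        · exact (reach_unique_far H ih h2 h' hg h hf).symm
        · exact (reach_unique_adjacent H G ih h2 h' hg h hf).symm

/-- The vector attached to the composition `v` over the starting vector `u` with spectral
vector `z`. -/
noncomputable def yb (q s : K) (T : Fin n → Module.End K M) (Φ : Module.End K M)
    (z : Fin (n + 1) → K) (u : M) (v : Fin (n + 1) → ℕ) : M :=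
  Classical.choose (exists_reach q s T Φ z u v)

theorem reach_yb (v : Fin (n + 1) → ℕ) : Reach q s T Φ z u v (yb q s T Φ z u v) :=
  Classical.choose_spec (exists_reach q s T Φ z u v)

theorem yb_zero (H : HeckeRel s T Φ) (G : Generic q z) : yb q s T Φ z u 0 = u :=
  reach_unique H G 0 _ _ (reach_yb 0) Reach.zero

theorem yb_psi (H : HeckeRel s T Φ) (G : Generic q z) (v : Fin (n + 1) → ℕ) :
    yb q s T Φ z u (psiInd v) = Φ (yb q s T Φ z u v) :=
  reach_unique H G _ _ _ (reach_yb _) (reach_yb v).psi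

theorem yb_up (H : HeckeRel s T Φ) (G : Generic q z) {v : Fin (n + 1) → ℕ} {i : Fin n}
    (h : v i.castSucc < v i.succ) :
    yb q s T Φ z u (v ∘ sw i)
      = Y s T i (zeta q z v i.castSucc) (zeta q z v i.succ) (yb q s T Φ z u v) :=
  reach_unique H G _ _ _ (reach_yb _) ((reach_yb v).up i h)

theorem yb_down (H : HeckeRel s T Φ) (G : Generic q z) {v : Fin (n + 1) → ℕ} {i : Fin n}
    (h : v i.succ < v i.castSucc) :
    yb q s T Φ z u v
      = Y s T i (zeta q z v i.succ) (zeta q z v i.castSucc) (yb q s T Φ z u (v ∘ sw i)) :=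
  reach_unique H G _ _ _ (reach_yb _) (Reach.step i h (reach_yb _))

theorem yb_aff (H : HeckeRel s T Φ) (G : Generic q z) {v : Fin (n + 1) → ℕ}
    (h : 0 < v (Fin.last n)) :
    yb q s T Φ z u v = Φ (yb q s T Φ z u (pd v)) :=
  reach_unique H G _ _ _ (reach_yb _) (Reach.aff h (reach_yb _))

end AbstractHecke

/-! ### Equal neighbouring parts -/

section EqualParts

variable {K : Type*} [Field K] {M : Type*} [AddCommGroup M] [Module K M] {n : ℕ}
  {s q : K} {T : Fin n → Module.End K M} {Φ : Module.End K M} {z : Fin (n + 1) → K}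

theorem Generic.comp_sw (G : Generic q z) (k : Fin n) : Generic q (z ∘ sw k) :=
  ⟨G.q_ne, fun _ => G.ne_zero _, fun _ _ d hd => G.pow_ne _ _ d hd⟩

theorem std_succ_of_eq {v : Fin (n + 1) → ℕ} {i k : Fin n} (h : v i.castSucc = v i.succ)
    (hk : std v i.castSucc = k.castSucc) : std v i.succ = k.succ := by
  ext
  rw [std_succ_eq h, hk]
  simp

theorem zeta_comp_sw_start {v : Fin (n + 1) → ℕ} {i k : Fin n} (h : v i.castSucc = v i.succ)
    (hk : std v i.castSucc = k.castSucc) : zeta q (z ∘ sw k) v = zeta q z v ∘ sw i := by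
  have hk' := std_succ_of_eq h hk
  funext j
  rcases eq_or_ne j i.castSucc with rfl | h1
  · rw [comp_sw_castSucc, zeta, zeta, hk, hk', comp_sw_castSucc, h]
  rcases eq_or_ne j i.succ with rfl | h2
  · rw [comp_sw_succ, zeta, zeta, hk, hk', comp_sw_succ, h]
  · rw [comp_sw_of_ne _ _ h1 h2, zeta, zeta, comp_sw_of_ne]
    · rw [← hk]; exact fun h => h1 ((std v).injective h)
    · rw [← hk']; exact fun h => h2 ((std v).injective h)

variable {u u' : M}

theorem yb_equal_of_greater_left (H : HeckeRel s T Φ) (G : Generic q z) {k : Fin n}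
    {v : Fin (n + 1) → ℕ}
    (ih : ∀ w, Lower w v → ∀ i : Fin n, w i.castSucc = w i.succ → std w i.castSucc = k.castSucc →
      Y s T i (zeta q z w i.castSucc) (zeta q z w i.succ) (yb q s T Φ z u w)
        = yb q s T Φ (z ∘ sw k) u' w)
    {i j : Fin n} (hij : j.1 + 1 = i.1) (h : v i.castSucc = v i.succ)
    (hki : std v i.castSucc = k.castSucc) (hj : v j.succ < v j.castSucc)
    (hbc : zeta q z v i.castSucc ≠ zeta q z v i.succ) :
    Y s T i (zeta q z v i.castSucc) (zeta q z v i.succ) (yb q s T Φ z u v)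
      = yb q s T Φ (z ∘ sw k) u' v := by
  have G' := G.comp_sw k
  have hc := adjacent_castSucc hij
  have n1 := fun F : Fin (n + 1) → ℕ => (adjacent_eval hij F).1
  have n3 := fun F : Fin (n + 1) → ℕ => (adjacent_eval hij F).2.2.1
  have n2 := fun F : Fin (n + 1) → ℕ => (adjacent_eval hij F).2.1
  have k1 := fun F : Fin (n + 1) → K => (adjacent_eval hij F).1
  have k2 := fun F : Fin (n + 1) → K => (adjacent_eval hij F).2.1
  have k3 := fun F : Fin (n + 1) → K => (adjacent_eval hij F).2.2.1
  have k4 := fun F : Fin (n + 1) → K => (adjacent_eval hij F).2.2.2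
  have l1 : (v ∘ sw j) i.succ < (v ∘ sw j) i.castSucc := by
    rw [hc, comp_sw_succ, n1, ← h, hc]; exact hj
  have hstd : std ((v ∘ sw j) ∘ sw i) j.castSucc = k.castSucc := by
    rw [std_comp_sw l1.ne', std_comp_sw hj.ne', ← hki, hc]
    exact ((adjacent_eval hij (std v ∘ sw j)).2.1).trans (comp_sw_castSucc _ _)
  have heq : ((v ∘ sw j) ∘ sw i) j.castSucc = ((v ∘ sw j) ∘ sw i) j.succ := by
    rw [n2, n3, n1, comp_sw_castSucc, ← h, hc]
  have key := ih _ ((sw_lower l1).trans (sw_lower hj)) j heq hstd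
  have e1 := yb_down (u := u) H G hj
  rw [yb_down (u := u) H G l1] at e1
  have e2 := yb_down (u := u') H G' hj
  rw [yb_down (u := u') H G' l1] at e2
  rw [zeta_comp_sw l1.ne', zeta_comp_sw hj.ne'] at key
  rw [zeta_comp_sw hj.ne', hc] at e1 e2
  rw [zeta_comp_sw_start h hki] at e2
  rw [hc] at hbc
  simp only [k1, k2, k3, k4, comp_sw_succ, comp_sw_castSucc] at e1 e2 key
  rw [e1, e2, ← key, hc]
  exact (H.yang_baxter hij (G.zeta_ne_zero _ _) (G.zeta_ne_zero _ _) hbc (G.zeta_ne hj.ne)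
    (G.zeta_ne (by rw [← h, hc]; exact hj.ne)) _).symm

theorem yb_equal_of_less_right (H : HeckeRel s T Φ) (G : Generic q z) {k : Fin n}
    {v : Fin (n + 1) → ℕ}
    (ih : ∀ w, Lower w v → ∀ i : Fin n, w i.castSucc = w i.succ → std w i.castSucc = k.castSucc →
      Y s T i (zeta q z w i.castSucc) (zeta q z w i.succ) (yb q s T Φ z u w)
        = yb q s T Φ (z ∘ sw k) u' w)
    {i j : Fin n} (hij : i.1 + 1 = j.1) (h : v i.castSucc = v i.succ)
    (hki : std v i.castSucc = k.castSucc) (hj : v j.succ < v j.castSucc)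
    (hbc : zeta q z v i.castSucc ≠ zeta q z v i.succ) :
    Y s T i (zeta q z v i.castSucc) (zeta q z v i.succ) (yb q s T Φ z u v)
      = yb q s T Φ (z ∘ sw k) u' v := by
  have G' := G.comp_sw k
  have hc := adjacent_castSucc hij
  have n1 := fun F : Fin (n + 1) → ℕ => (adjacent_eval hij F).1
  have n2 := fun F : Fin (n + 1) → ℕ => (adjacent_eval hij F).2.1
  have n3 := fun F : Fin (n + 1) → ℕ => (adjacent_eval hij F).2.2.1
  have n4 := fun F : Fin (n + 1) → ℕ => (adjacent_eval hij F).2.2.2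
  have k1 := fun F : Fin (n + 1) → K => (adjacent_eval hij F).1
  have k2 := fun F : Fin (n + 1) → K => (adjacent_eval hij F).2.1
  have k3 := fun F : Fin (n + 1) → K => (adjacent_eval hij F).2.2.1
  have k4 := fun F : Fin (n + 1) → K => (adjacent_eval hij F).2.2.2
  have l1 : (v ∘ sw j) i.succ < (v ∘ sw j) i.castSucc := by
    rw [n2, n3, h, ← hc]; exact hj
  have hstd : std ((v ∘ sw j) ∘ sw i) j.castSucc = k.castSucc := by
    rw [std_comp_sw l1.ne', std_comp_sw hj.ne', ← hki, hc]
    exact (comp_sw_succ (std v ∘ sw j) i).trans (adjacent_eval hij (std v)).2.1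
  have heq : ((v ∘ sw j) ∘ sw i) j.castSucc = ((v ∘ sw j) ∘ sw i) j.succ := by
    rw [hc, n1, comp_sw_succ, n4, n2, h]
  have key := ih _ ((sw_lower l1).trans (sw_lower hj)) j heq hstd
  have e1 := yb_down (u := u) H G hj
  rw [yb_down (u := u) H G l1] at e1
  have e2 := yb_down (u := u') H G' hj
  rw [yb_down (u := u') H G' l1] at e2
  rw [zeta_comp_sw l1.ne'] at key
  rw [zeta_comp_sw hj.ne', hc] at e1 e2 key
  rw [zeta_comp_sw_start h hki] at e2
  rw [hc] at hj
  simp only [k1, k2, k3, k4, comp_sw_succ, comp_sw_castSucc] at e1 e2 key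
  rw [e1, e2, ← key]
  exact H.yang_baxter hij (G.zeta_ne_zero _ _) (G.zeta_ne_zero _ _)
    (G.zeta_ne (by rw [h]; exact hj.ne)) (G.zeta_ne hj.ne) hbc _

/-- Where two neighbouring parts of `v` agree and carry the numbers `k` and `k + 1`, the
Yang-Baxter move at these parts acts as the move number `k` on the starting vector. -/
theorem yb_equal (H : HeckeRel s T Φ) (G : Generic q z) {k : Fin n}
    (hk : z k.castSucc ≠ z k.succ) (hu : Y s T k (z k.castSucc) (z k.succ) u = u')
    (v : Fin (n + 1) → ℕ) :
    ∀ i : Fin n, v i.castSucc = v i.succ → std v i.castSucc = k.castSucc →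
      Y s T i (zeta q z v i.castSucc) (zeta q z v i.succ) (yb q s T Φ z u v)
        = yb q s T Φ (z ∘ sw k) u' v := by
  have G' := G.comp_sw k
  induction v using lower_wf.induction with
  | _ v ih =>
  intro i h hki
  rcases Nat.eq_zero_or_pos (v (Fin.last n)) with h0 | h0
  · rcases eq_or_ne v 0 with rfl | hv
    · have h1 : std (0 : Fin (n + 1) → ℕ) = 1 := std_of_antitone (fun _ _ _ => le_rfl)
      rw [h1, Equiv.Perm.one_apply] at hki
      obtain rfl : i = k := Fin.castSucc_injective _ hki
      simp only [yb_zero H G, yb_zero H G', zeta, h1, Pi.zero_apply, pow_zero, one_mul,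
        Equiv.Perm.one_apply]
      exact hu
    · obtain ⟨j, hj1, hj0⟩ := exists_pos_zero h0 hv
      have hj : v j.succ < v j.castSucc := by omega
      have hbc : zeta q z v i.castSucc ≠ zeta q z v i.succ := by
        unfold zeta
        rw [hki, std_succ_of_eq h hki, h]
        exact fun he => hk (mul_left_cancel₀ (pow_ne_zero _ G.q_ne) he)
      have far : ∀ {i' j' : Fin n}, i'.1 + 1 < j'.1 → (i = i' ∧ j = j' ∨ i = j' ∧ j = i') →
          Y s T i (zeta q z v i.castSucc) (zeta q z v i.succ) (yb q s T Φ z u v)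
            = yb q s T Φ (z ∘ sw k) u' v := by
        intro i' j' hij hor
        have hcomm : ∀ a b c d (f : M),
            Y s T i a b (Y s T j c d f) = Y s T j c d (Y s T i a b f) := by
          intro a b c d f
          rcases hor with ⟨rfl, rfl⟩ | ⟨rfl, rfl⟩
          · exact H.Y_comm hij a b c d f
          · exact (H.Y_comm hij c d a b f).symm
        have ev : ∀ {α : Type _} (F : Fin (n + 1) → α), (F ∘ sw j) i.castSucc = F i.castSucc ∧
            (F ∘ sw j) i.succ = F i.succ ∧ (F ∘ sw i) j.castSucc = F j.castSucc ∧
            (F ∘ sw i) j.succ = F j.succ := by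
          intro α F
          rcases hor with ⟨rfl, rfl⟩ | ⟨rfl, rfl⟩
          · obtain ⟨a, b, c, d⟩ := far_eval hij F
            exact ⟨c, d, a, b⟩
          · exact far_eval hij F
        have ev' : (v ∘ sw j) i.castSucc = v i.castSucc ∧ (v ∘ sw j) i.succ = v i.succ := by
          rcases hor with ⟨rfl, rfl⟩ | ⟨rfl, rfl⟩
          · exact (far_eval hij v).2.2
          · exact ⟨(far_eval hij v).1, (far_eval hij v).2.1⟩
        have evs : (std v ∘ sw j) i.castSucc = std v i.castSucc := by
          rcases hor with ⟨rfl, rfl⟩ | ⟨rfl, rfl⟩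
          · exact (far_eval hij (std v)).2.2.1
          · exact (far_eval hij (std v)).1
        have key := ih _ (sw_lower hj) i (by rw [ev'.1, ev'.2, h])
          (by rw [std_comp_sw hj.ne', ← hki]; exact evs)
        rw [zeta_comp_sw hj.ne', (ev (zeta q z v)).1, (ev (zeta q z v)).2.1] at key
        rw [yb_down (u := u) H G hj, yb_down (u := u') H G' hj, hcomm, key,
          zeta_comp_sw_start h hki, (ev (zeta q z v)).2.2.1, (ev (zeta q z v)).2.2.2]
      rcases lt_trichotomy i.1 j.1 with hij | hij | hij
      · rcases Nat.lt_or_eq_of_le (Nat.succ_le_of_lt hij) with h2 | h2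
        · exact far h2 (Or.inl ⟨rfl, rfl⟩)
        · exact yb_equal_of_less_right H G ih h2 h hki hj hbc
      · obtain rfl := Fin.ext hij
        omega
      · rcases Nat.lt_or_eq_of_le (Nat.succ_le_of_lt hij) with h2 | h2
        · exact far h2 (Or.inr ⟨rfl, rfl⟩)
        · exact yb_equal_of_greater_left H G ih h2 h hki hj hbc
  · rw [yb_aff (u := u) H G h0, yb_aff (u := u') H G' h0]
    by_cases hin : i.1 + 1 < n
    · obtain ⟨j, hij⟩ : ∃ j : Fin n, i.1 + 1 = j.1 := ⟨⟨i.1 + 1, hin⟩, rfl⟩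
      have hc := adjacent_castSucc hij
      have key := ih _ (pd_lower h0) j (by rw [hc, pd_succ, pd_succ, h, hc])
        (by rw [hc, std_pd_succ h0, hki])
      rw [H.Y_phi hij, ← key, hc, zeta_pd_succ h0, zeta_pd_succ h0, hc]
    · have hin' : i.1 + 1 = n := by have := i.2; omega
      have hlast : Fin.last n = i.succ := by ext; simp [hin']
      obtain ⟨j, hj0⟩ : ∃ j : Fin n, j.1 = 0 := ⟨⟨0, by omega⟩, rfl⟩
      have hjc : j.castSucc = 0 := by ext; simpa using hj0
      have h1 : 0 < pd v (Fin.last n) := by rw [hlast, pd_succ, h, ← hlast]; exact h0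
      rw [yb_aff (u := u) H G h1, yb_aff (u := u') H G' h1]
      have key := ih _ ((pd_lower h1).trans (pd_lower h0)) j
        (by rw [hjc, pd_zero, pd_succ, hjc, pd_zero, hlast, pd_succ, h])
        (by rw [hjc, std_pd_zero h1, hlast, std_pd_succ h0, hki])
      have z1 : zeta q z v i.succ = q * zeta q z (pd (pd v)) j.succ := by
        rw [zeta_pd_succ h1, hjc, ← zeta_pd_zero h0, hlast]
      have z2 : zeta q z v i.castSucc = q * zeta q z (pd (pd v)) j.castSucc := by
        rw [hjc, ← zeta_pd_zero h1, hlast, zeta_pd_succ h0]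
      rw [H.Y_phi_phi hin' hj0, ← key, z1, z2, Y, Y, cf_mul G.q_ne]

end EqualParts

/-! ### Neighbouring entries of reverse standard tableaux -/

section Tableaux

variable {lam : YoungDiagram} {n : ℕ}

/-- The bijection from entries to cells underlying a reverse standard tableau. -/
def RST.pos (t : RST lam n) : Fin (n + 1) ≃ Cell lam := t.1

theorem RST.isRST (t : RST lam n) : IsRST t.pos := t.2

/-- The reverse standard tableau with given positions. -/
def RST.ofPos (e : Fin (n + 1) ≃ Cell lam) (h : IsRST e) : RST lam n := ⟨e, h⟩

@[simp] theorem RST.pos_ofPos (e : Fin (n + 1) ≃ Cell lam) (h : IsRST e) :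
    (RST.ofPos e h).pos = e := rfl

theorem RST.pos_injective {t t' : RST lam n} (h : t.pos = t'.pos) : t = t' := Subtype.ext h

/-- The content of a cell. -/
def cc (A : Cell lam) : ℤ := (A.1.2 : ℤ) - (A.1.1 : ℤ)

theorem exists_entry (e : Fin (n + 1) ≃ Cell lam) (b : Fin (n + 1)) {r c : ℕ}
    (hr : r ≤ (e b).1.1) (hc : c ≤ (e b).1.2) : ∃ m, (e m).1 = (r, c) := by
  have hb : ((e b).1.1, (e b).1.2) ∈ lam := (YoungDiagram.mem_cells _).mp (e b).2
  refine ⟨e.symm ⟨(r, c), (YoungDiagram.mem_cells _).mpr (lam.up_left_mem hr hc hb)⟩, ?_⟩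
  simp

theorem IsRST.lt_of_le {e : Fin (n + 1) ≃ Cell lam} (he : IsRST e) {a b : Fin (n + 1)}
    (hr : (e a).1.1 ≤ (e b).1.1) (hc : (e a).1.2 ≤ (e b).1.2) (hab : a ≠ b) : b < a := by
  obtain ⟨m, hm⟩ := exists_entry e b hr le_rfl
  have h1 : m = a ∨ m < a := by
    rcases hc.lt_or_eq with h | h
    · exact Or.inr ((he a m).1 (by rw [hm]) (by rw [hm]; exact h))
    · exact Or.inl (e.injective (Subtype.ext (by rw [hm, ← h])))
  have h2 : m = b ∨ b < m := by
    rcases hr.lt_or_eq with h | h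
    · exact Or.inr ((he m b).2 (by rw [hm]) (by rw [hm]; exact h))
    · exact Or.inl (e.injective (Subtype.ext (by rw [hm, h])))
  rcases h1 with rfl | h1 <;> rcases h2 with rfl | h2
  · exact absurd rfl hab
  · exact h2
  · exact h1
  · exact h2.trans h1

theorem val_ne_of_fst_ne (e : Fin (n + 1) ≃ Cell lam) {a b : Fin (n + 1)}
    (h : (e a).1.1 ≠ (e b).1.1) : a ≠ b := fun h' => h (by rw [h'])

/-- The cell of `k + 1` is the left neighbour of the cell of `k`, or its lower neighbour, or it is
strictly to the south-east, or strictly to the north-west. -/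
theorem IsRST.neighbours {e : Fin (n + 1) ≃ Cell lam} (he : IsRST e) (k : Fin n) :
    ((e k.castSucc).1.1 = (e k.succ).1.1 ∧ (e k.castSucc).1.2 = (e k.succ).1.2 + 1) ∨
    ((e k.castSucc).1.2 = (e k.succ).1.2 ∧ (e k.castSucc).1.1 = (e k.succ).1.1 + 1) ∨
    ((e k.succ).1.1 < (e k.castSucc).1.1 ∧ (e k.castSucc).1.2 < (e k.succ).1.2) ∨
    ((e k.castSucc).1.1 < (e k.succ).1.1 ∧ (e k.succ).1.2 < (e k.castSucc).1.2) := by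
  set a := k.castSucc with ha
  set b := k.succ with hb
  have hab : a < b := Fin.castSucc_lt_succ
  have hcons : ∀ m : Fin (n + 1), ¬ (a < m ∧ m < b) := by
    rintro m ⟨h1, h2⟩
    simp only [ha, hb, Fin.lt_def, Fin.val_castSucc, Fin.val_succ] at h1 h2
    omega
  have h0 : ¬ ((e a).1.1 ≤ (e b).1.1 ∧ (e a).1.2 ≤ (e b).1.2) := fun h =>
    hab.asymm (he.lt_of_le h.1 h.2 hab.ne)
  -- a cell of the rectangle spanned by the two cells would hold an entry between `k` and `k + 1`
  have h1 : ∀ r c, (e b).1.1 ≤ r → r ≤ (e a).1.1 → (e b).1.2 ≤ c → c ≤ (e a).1.2 →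
      ((r, c) = (e a).1 ∨ (r, c) = (e b).1) := by
    intro r c hr1 hr2 hc1 hc2
    obtain ⟨m, hm⟩ := exists_entry e a hr2 hc2
    by_contra hcon
    push Not at hcon
    have hma : m ≠ a := fun h => hcon.1 (by rw [← hm, h])
    have hmb : m ≠ b := fun h => hcon.2 (by rw [← hm, h])
    exact hcons m ⟨he.lt_of_le (by rw [hm]; exact hr2) (by rw [hm]; exact hc2) hma,
      he.lt_of_le (by rw [hm]; exact hr1) (by rw [hm]; exact hc1) hmb.symm⟩
  rcases lt_trichotomy (e a).1.1 (e b).1.1 with hr | hr | hr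
  · exact Or.inr (Or.inr (Or.inr ⟨hr, by omega⟩))
  · left
    refine ⟨hr, ?_⟩
    have := h1 (e a).1.1 ((e b).1.2 + 1) hr.ge le_rfl (by omega) (by omega)
    simp only [Prod.ext_iff] at this
    omega
  · rcases lt_or_ge (e a).1.2 (e b).1.2 with hc | hc
    · exact Or.inr (Or.inr (Or.inl ⟨hr, hc⟩))
    · have h2 := h1 ((e b).1.1 + 1) (e b).1.2 (by omega) (by omega) le_rfl hc
      simp only [Prod.ext_iff] at h2
      exact Or.inr (Or.inl (by omega))

/-- Entries whose difference is at most two lie on different diagonals. -/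
theorem IsRST.content_ne {e : Fin (n + 1) ≃ Cell lam} (he : IsRST e) {a c : Fin (n + 1)}
    (hac : a < c) (h2 : c.1 ≤ a.1 + 2) : cc (e a) ≠ cc (e c) := by
  intro h
  unfold cc at h
  have h0 : ¬ ((e a).1.1 ≤ (e c).1.1 ∧ (e a).1.2 ≤ (e c).1.2) := fun h =>
    hac.asymm (he.lt_of_le h.1 h.2 hac.ne)
  have hr : (e c).1.1 < (e a).1.1 := by omega
  have hc : (e c).1.2 < (e a).1.2 := by omega
  obtain ⟨m, hm⟩ := exists_entry e a hr.le le_rfl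
  obtain ⟨m', hm'⟩ := exists_entry e a le_rfl hc.le
  have m1 : a < m := (he m a).2 (by rw [hm]) (by rw [hm]; exact hr)
  have m2 : m < c := (he c m).1 (by rw [hm]) (by rw [hm]; exact hc)
  have m1' : a < m' := (he m' a).1 (by rw [hm']) (by rw [hm']; exact hc)
  have m2' : m' < c := (he c m').2 (by rw [hm']) (by rw [hm']; exact hr)
  have hne : m ≠ m' := val_ne_of_fst_ne e (by rw [hm, hm']; exact hr.ne)
  have : m.1 ≠ m'.1 := fun h => hne (Fin.ext h)
  simp only [Fin.lt_def] at m1 m2 m1' m2'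
  omega

theorem IsRST.exchange {e : Fin (n + 1) ≃ Cell lam} (he : IsRST e) {k : Fin n}
    (hr : (e k.castSucc).1.1 ≠ (e k.succ).1.1) (hc : (e k.castSucc).1.2 ≠ (e k.succ).1.2) :
    IsRST ((sw k).trans e) := by
  have key : ∀ a b : Fin (n + 1), ((e (sw k a)).1.1 = (e (sw k b)).1.1 ∨
      (e (sw k a)).1.2 = (e (sw k b)).1.2) → sw k b < sw k a → b < a := by
    intro a b h hlt
    refine (sw_lt_sw_iff k ?_ ?_).mp hlt
    · rintro ⟨rfl, rfl⟩
      simp only [sw, Equiv.swap_apply_left, Equiv.swap_apply_right] at h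
      rcases h with h | h
      · exact hr h
      · exact hc h
    · rintro ⟨rfl, rfl⟩
      simp only [sw, Equiv.swap_apply_left, Equiv.swap_apply_right] at h
      rcases h with h | h
      · exact hr h.symm
      · exact hc h.symm
  intro a b
  exact ⟨fun h1 h2 => key a b (Or.inl h1) ((he _ _).1 h1 h2),
    fun h1 h2 => key a b (Or.inr h1) ((he _ _).2 h1 h2)⟩

theorem sw_trans_castSucc (e : Fin (n + 1) ≃ Cell lam) (k : Fin n) :
    ((sw k).trans e) k.castSucc = e k.succ := by simp [sw]

theorem sw_trans_succ (e : Fin (n + 1) ≃ Cell lam) (k : Fin n) :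
    ((sw k).trans e) k.succ = e k.castSucc := by simp [sw]

theorem sw_trans_sw_trans (e : Fin (n + 1) ≃ Cell lam) (k : Fin n) :
    (sw k).trans ((sw k).trans e) = e := by
  ext1 x; simp [sw]

theorem not_isRST_exchange {e : Fin (n + 1) ≃ Cell lam} (he : IsRST e) {k : Fin n}
    (h : (e k.castSucc).1.1 = (e k.succ).1.1 ∨ (e k.castSucc).1.2 = (e k.succ).1.2) :
    ¬ IsRST ((sw k).trans e) := by
  intro he'
  have h1 := he.neighbours k
  have h2 := he'.neighbours k
  rw [sw_trans_castSucc, sw_trans_succ] at h2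
  omega

end Tableaux

/-! ### The seminormal representation of the Hecke algebra -/

section Seminormal

variable {K : Type*} [Field K] {lam : YoungDiagram} {n : ℕ}

open Classical in
/-- The basis vector of a filling if it is a reverse standard tableau, and zero otherwise. -/
noncomputable def ev (K : Type*) [Field K] (e : Fin (n + 1) ≃ Cell lam) : V K lam n :=
  if h : IsRST e then Finsupp.single (RST.ofPos e h) 1 else 0

theorem ev_of_isRST {e : Fin (n + 1) ≃ Cell lam} (h : IsRST e) :
    ev K e = Finsupp.single (RST.ofPos e h) 1 := dif_pos h

theorem ev_of_not {e : Fin (n + 1) ≃ Cell lam} (h : ¬ IsRST e) : ev K e = 0 := dif_neg h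

theorem ev_pos (t : RST lam n) : ev K t.pos = Finsupp.single t 1 := ev_of_isRST t.isRST

/-- The off-diagonal coefficient of the seminormal form, for neighbouring entries in the cells `A`
and `B`; it vanishes for cells of the same row or column. -/
noncomputable def beta (s : K) (A B : Cell lam) : K :=
  if A.1.1 = B.1.1 ∨ A.1.2 = B.1.2 then 0
  else if A.1.1 < B.1.1 then 1
  else s * (1 - s ^ (cc B - cc A + 1)) * (1 - s ^ (cc B - cc A - 1)) / (1 - s ^ (cc B - cc A)) ^ 2

/-- Minus the diagonal coefficient of the seminormal form. -/
noncomputable def gam (s : K) (A B : Cell lam) : K := cf s (s ^ cc A) (s ^ cc B)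

theorem gam_eq {s : K} (hs0 : s ≠ 0) (A B : Cell lam) :
    gam s A B = (1 - s) / (1 - s ^ (cc B - cc A)) := by
  rw [gam, cf, zpow_sub₀ hs0]

theorem zpow_ne_zpow {s : K} (hs0 : s ≠ 0) (hs : ∀ m : ℤ, m ≠ 0 → s ^ m ≠ 1) {a b : ℤ}
    (h : a ≠ b) : s ^ a ≠ s ^ b := by
  intro he
  apply hs (a - b) (sub_ne_zero.mpr h)
  rw [zpow_sub₀ hs0, he, div_self (zpow_ne_zero _ hs0)]

variable {s : K}

theorem gam_of_row (hs0 : s ≠ 0) (hs : ∀ m : ℤ, m ≠ 0 → s ^ m ≠ 1) {A B : Cell lam}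
    (h : cc B - cc A = -1) : gam s A B = -s := by
  have h1 : s - 1 ≠ 0 := sub_ne_zero.mpr (by simpa using hs 1 one_ne_zero)
  rw [gam_eq hs0, h, zpow_neg_one]
  have h2 : 1 - s⁻¹ ≠ 0 := by
    rw [show 1 - s⁻¹ = (s - 1) / s by field_simp]
    exact div_ne_zero h1 hs0
  rw [div_eq_iff h2]
  field_simp
  ring

theorem gam_of_col (hs0 : s ≠ 0) (hs : ∀ m : ℤ, m ≠ 0 → s ^ m ≠ 1) {A B : Cell lam}
    (h : cc B - cc A = 1) : gam s A B = 1 := by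
  have h1 : 1 - s ≠ 0 := sub_ne_zero.mpr (by simpa using (hs 1 one_ne_zero).symm)
  rw [gam_eq hs0, h, zpow_one, div_self h1]

theorem heckeVec_eq (hs0 : s ≠ 0) (hs : ∀ m : ℤ, m ≠ 0 → s ^ m ≠ 1) (t : RST lam n) (i : Fin n) :
    heckeVec s i t = -gam s (t.pos i.castSucc) (t.pos i.succ) • ev K t.pos +
      beta s (t.pos i.castSucc) (t.pos i.succ) • ev K ((sw i).trans t.pos) := by
  have hn := t.isRST.neighbours i
  have hdef : heckeVec s i t = if (t.pos i.castSucc).1.1 = (t.pos i.succ).1.1 then s • ev K t.pos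
      else if (t.pos i.castSucc).1.2 = (t.pos i.succ).1.2 then -ev K t.pos
      else if (t.pos i.castSucc).1.1 < (t.pos i.succ).1.1 then
        ev K ((sw i).trans t.pos) -
          ((1 - s) / (1 - s ^ (cc (t.pos i.succ) - cc (t.pos i.castSucc)))) • ev K t.pos
      else
        ((s - 1) / (1 - s ^ (cc (t.pos i.succ) - cc (t.pos i.castSucc)))) • ev K t.pos +
          (s * (1 - s ^ (cc (t.pos i.succ) - cc (t.pos i.castSucc) + 1)) *
            (1 - s ^ (cc (t.pos i.succ) - cc (t.pos i.castSucc) - 1)) /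
              (1 - s ^ (cc (t.pos i.succ) - cc (t.pos i.castSucc))) ^ 2) •
            ev K ((sw i).trans t.pos) := by
    rw [ev_pos]
    rfl
  rw [hdef]
  by_cases h1 : (t.pos i.castSucc).1.1 = (t.pos i.succ).1.1
  · rw [if_pos h1, gam_of_row hs0 hs (by unfold cc; omega), beta, if_pos (Or.inl h1)]
    simp
  by_cases h2 : (t.pos i.castSucc).1.2 = (t.pos i.succ).1.2
  · rw [if_neg h1, if_pos h2, gam_of_col hs0 hs (by unfold cc; omega), beta, if_pos (Or.inr h2)]
    simp
  rw [if_neg h1, if_neg h2, gam_eq hs0, beta, if_neg (not_or.mpr ⟨h1, h2⟩)]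
  by_cases h3 : (t.pos i.castSucc).1.1 < (t.pos i.succ).1.1
  · rw [if_pos h3, if_pos h3]
    module
  · rw [if_neg h3, if_neg h3, ← neg_div, neg_sub]

/-- The seminormal form of `T_i`, uniformly for all fillings. -/
theorem heckeV_ev (hs0 : s ≠ 0) (hs : ∀ m : ℤ, m ≠ 0 → s ^ m ≠ 1) (e : Fin (n + 1) ≃ Cell lam)
    (i : Fin n) : heckeV s i (ev K e) = -gam s (e i.castSucc) (e i.succ) • ev K e +
      beta s (e i.castSucc) (e i.succ) • ev K ((sw i).trans e) := by
  by_cases he : IsRST e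
  · have := heckeVec_eq hs0 hs (RST.ofPos e he) i
    rw [RST.pos_ofPos] at this
    rw [← this, ev_of_isRST he, heckeV, Finsupp.linearCombination_single, one_smul]
  · rw [ev_of_not he, map_zero, smul_zero, zero_add]
    by_cases he' : IsRST ((sw i).trans e)
    · -- the two entries share a row or a column, since their exchange is not allowed
      have : (e i.castSucc).1.1 = (e i.succ).1.1 ∨ (e i.castSucc).1.2 = (e i.succ).1.2 := by
        by_contra hc
        push Not at hc
        apply he
        have := he'.exchange (k := i) (by rw [sw_trans_castSucc, sw_trans_succ]; exact hc.1.symm)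
          (by rw [sw_trans_castSucc, sw_trans_succ]; exact hc.2.symm)
        rwa [sw_trans_sw_trans] at this
      rw [beta, if_pos this, zero_smul]
    · rw [ev_of_not he', smul_zero]

theorem gam_add_gam (hs0 : s ≠ 0) (hs : ∀ m : ℤ, m ≠ 0 → s ^ m ≠ 1) {A B : Cell lam}
    (h : cc A ≠ cc B) : gam s A B + gam s B A = 1 - s :=
  cf_add_cf (zpow_ne_zero _ hs0) (zpow_ne_zero _ hs0) (zpow_ne_zpow hs0 hs h)

theorem beta_formula (hs0 : s ≠ 0) (hs : ∀ m : ℤ, m ≠ 0 → s ^ m ≠ 1) {m : ℤ} (hm : m ≠ 0) :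
    s * (1 - s ^ (m + 1)) * (1 - s ^ (m - 1)) / (1 - s ^ m) ^ 2
      = (1 - (1 - s) / (1 - s ^ m)) * (s + (1 - s) / (1 - s ^ m)) := by
  have h1 : 1 - s ^ m ≠ 0 := sub_ne_zero.mpr (hs m hm).symm
  rw [zpow_add₀ hs0, zpow_sub₀ hs0, zpow_one]
  field_simp
  ring

theorem beta_mul_beta (hs0 : s ≠ 0) (hs : ∀ m : ℤ, m ≠ 0 → s ^ m ≠ 1)
    {e : Fin (n + 1) ≃ Cell lam} (he : IsRST e) (i : Fin n) :
    beta s (e i.castSucc) (e i.succ) * beta s (e i.succ) (e i.castSucc)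
      = (1 - gam s (e i.castSucc) (e i.succ)) * (s + gam s (e i.castSucc) (e i.succ)) := by
  have hn := he.neighbours i
  by_cases h1 : (e i.castSucc).1.1 = (e i.succ).1.1
  · rw [gam_of_row hs0 hs (by unfold cc; omega), beta, if_pos (Or.inl h1)]
    ring
  by_cases h2 : (e i.castSucc).1.2 = (e i.succ).1.2
  · rw [gam_of_col hs0 hs (by unfold cc; omega), beta, if_pos (Or.inr h2)]
    ring
  have hct := he.content_ne (Fin.castSucc_lt_succ (i := i)) (by simp)
  rcases lt_or_gt_of_ne h1 with h3 | h3
  · rw [beta, if_neg (by tauto), if_pos h3, beta, if_neg (by omega), if_neg (by omega),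
      beta_formula hs0 hs (sub_ne_zero.mpr hct), ← gam_eq hs0, one_mul]
    have := gam_add_gam hs0 hs hct
    rw [eq_sub_of_add_eq' this]
    ring
  · rw [beta, if_neg (by tauto), if_neg (by omega), beta, if_neg (by omega), if_pos h3,
      beta_formula hs0 hs (sub_ne_zero.mpr hct.symm), ← gam_eq hs0, mul_one]

theorem linearMap_ext_ev {W : Type*} [AddCommGroup W] [Module K W] {f g : V K lam n →ₗ[K] W}
    (h : ∀ e : Fin (n + 1) ≃ Cell lam, IsRST e → f (ev K e) = g (ev K e)) : f = g := by
  apply Finsupp.lhom_ext'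
  intro t
  ext
  have := h t.pos t.isRST
  rw [ev_pos] at this
  simpa using this

theorem heckeV_quad (hs0 : s ≠ 0) (hs : ∀ m : ℤ, m ≠ 0 → s ^ m ≠ 1) (i : Fin n) :
    (heckeV s i * heckeV s i : Module.End K (V K lam n)) = (s - 1) • heckeV s i + s • 1 := by
  apply linearMap_ext_ev
  intro e he
  have h1 := beta_mul_beta hs0 hs he i
  have h2 := gam_add_gam hs0 hs (he.content_ne (Fin.castSucc_lt_succ (i := i)) (by simp))
  simp only [Module.End.mul_apply, LinearMap.add_apply, LinearMap.smul_apply,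
    Module.End.one_apply, heckeV_ev hs0 hs, map_add, map_smul,
    sw_trans_castSucc, sw_trans_succ, sw_trans_sw_trans]
  rw [eq_sub_of_add_eq' h2]
  linear_combination (norm := module) h1 • ev K e

theorem heckeV_comm (hs0 : s ≠ 0) (hs : ∀ m : ℤ, m ≠ 0 → s ^ m ≠ 1) {i j : Fin n}
    (hij : i.1 + 1 < j.1) :
    (heckeV s i * heckeV s j : Module.End K (V K lam n)) = heckeV s j * heckeV s i := by
  apply linearMap_ext_ev
  intro e _
  obtain ⟨a1, a2, a3, a4⟩ := far_eval hij e
  have b1 : ((sw i).trans e) j.castSucc = e j.castSucc := a1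
  have b2 : ((sw i).trans e) j.succ = e j.succ := a2
  have b3 : ((sw j).trans e) i.castSucc = e i.castSucc := a3
  have b4 : ((sw j).trans e) i.succ = e i.succ := a4
  have b5 : (sw j).trans ((sw i).trans e) = (sw i).trans ((sw j).trans e) :=
    DFunLike.coe_injective (far_comp hij e)
  simp only [Module.End.mul_apply, heckeV_ev hs0 hs, map_add, map_smul, b1, b2, b3, b4, b5]
  module

theorem heckeV_braid (hs0 : s ≠ 0) (hs : ∀ m : ℤ, m ≠ 0 → s ^ m ≠ 1) {i j : Fin n}
    (hij : i.1 + 1 = j.1) :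
    (heckeV s i * heckeV s j * heckeV s i : Module.End K (V K lam n))
      = heckeV s j * heckeV s i * heckeV s j := by
  apply linearMap_ext_ev
  intro e he
  have hc := adjacent_castSucc hij
  have b1 : ∀ f : Fin (n + 1) ≃ Cell lam, ((sw i).trans f) j.succ = f j.succ :=
    fun f => (adjacent_eval hij f).1
  have b2 : ∀ f : Fin (n + 1) ≃ Cell lam, ((sw j).trans f) i.castSucc = f i.castSucc :=
    fun f => (adjacent_eval hij f).2.1
  have b3 : ∀ f : Fin (n + 1) ≃ Cell lam, ((sw j).trans f) i.succ = f j.succ :=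
    fun f => (adjacent_eval hij f).2.2.1
  have b4 : ∀ f : Fin (n + 1) ≃ Cell lam, ((sw j).trans f) j.succ = f i.succ :=
    fun f => (adjacent_eval hij f).2.2.2
  have b5 : (sw i).trans ((sw j).trans ((sw i).trans e))
      = (sw j).trans ((sw i).trans ((sw j).trans e)) :=
    DFunLike.coe_injective (braid_comp hij e)
  have p1 := beta_mul_beta hs0 hs he i
  have p2 := beta_mul_beta hs0 hs he j
  have c1 := he.content_ne (Fin.castSucc_lt_succ (i := i)) (by simp)
  have c2 := he.content_ne (Fin.castSucc_lt_succ (i := j)) (by simp)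
  have c3 := he.content_ne (a := i.castSucc) (c := j.succ)
    (by simp only [Fin.lt_def, Fin.val_castSucc, Fin.val_succ]; omega)
    (by simp only [Fin.val_castSucc, Fin.val_succ]; omega)
  rw [hc] at c2 p2
  have g1 := gam_add_gam hs0 hs c1
  have g2 := gam_add_gam hs0 hs c2
  have hy : gam s (e i.castSucc) (e j.succ) * (s - 1)
      + gam s (e i.castSucc) (e i.succ) * gam s (e i.castSucc) (e j.succ)
      + gam s (e i.castSucc) (e j.succ) * gam s (e i.succ) (e j.succ)
      = gam s (e i.castSucc) (e i.succ) * gam s (e i.succ) (e j.succ) :=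
    cf_yang_baxter (zpow_ne_zero _ hs0) (zpow_ne_zero _ hs0) (zpow_ne_zpow hs0 hs c1)
      (zpow_ne_zpow hs0 hs c3) (zpow_ne_zpow hs0 hs c2)
  simp only [Module.End.mul_apply, heckeV_ev hs0 hs, map_add, map_smul, hc, b1, b2, b3, b4, b5,
    sw_trans_castSucc, sw_trans_succ, sw_trans_sw_trans]
  generalize e i.castSucc = A at *
  generalize e i.succ = B at *
  generalize e j.succ = C at *
  rw [eq_sub_of_add_eq' g1, eq_sub_of_add_eq' g2]
  have h0 : -(gam s A B * gam s B C * gam s A B) - gam s A C * (beta s A B * beta s B A)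
      = -(gam s A B * gam s B C * gam s B C) - gam s A C * (beta s B C * beta s C B) := by
    rw [p1, p2]
    linear_combination (gam s A B - gam s B C) * hy
  have h1 : beta s A B * (gam s A B * gam s B C + gam s A C * (1 - s - gam s A B))
      = beta s A B * (gam s B C * gam s A C) := by
    linear_combination (-beta s A B) * hy
  have h2 : beta s B C * (gam s A B * gam s A C)
      = beta s B C * (gam s A B * gam s B C + gam s A C * (1 - s - gam s B C)) := by
    linear_combination (beta s B C) * hy
  linear_combination (norm := module) h0 • ev K e + h1 • ev K ((sw i).trans e)
    + h2 • ev K ((sw j).trans e)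

end Seminormal

/-! ### Identities between divided differences and exchanges of variables -/

section PolynomialOperators

variable {K : Type*} [Field K] {n : ℕ} {s : K}

/-- A polynomial with its variables permuted by `w`, as an element of the fraction field, where the
divided differences are actual quotients and identities between operators can be computed. -/
noncomputable def frac (w : Equiv.Perm (Fin (n + 1))) :
    MvPolynomial (Fin (n + 1)) K →+* FractionRing (MvPolynomial (Fin (n + 1)) K) :=
  (algebraMap _ _).comp (MvPolynomial.rename w).toRingHom

/-- The variable `x_k` in the fraction field. -/
noncomputable def fracX (K : Type*) [Field K] (k : Fin (n + 1)) :
    FractionRing (MvPolynomial (Fin (n + 1)) K) :=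
  algebraMap _ _ (MvPolynomial.X k : MvPolynomial (Fin (n + 1)) K)

/-- The scalar `c` in the fraction field. -/
noncomputable def fracC (n : ℕ) (c : K) : FractionRing (MvPolynomial (Fin (n + 1)) K) :=
  algebraMap _ _ (MvPolynomial.C c : MvPolynomial (Fin (n + 1)) K)

theorem fracX_sub_ne {k l : Fin (n + 1)} (h : k ≠ l) : fracX K k - fracX K l ≠ 0 := by
  rw [sub_ne_zero]
  intro he
  exact h (MvPolynomial.X_injective (IsFractionRing.injective (MvPolynomial (Fin (n + 1)) K)
    (FractionRing (MvPolynomial (Fin (n + 1)) K)) he))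

theorem frac_injective (w : Equiv.Perm (Fin (n + 1))) : Function.Injective (frac (K := K) w) :=
  (IsFractionRing.injective (MvPolynomial (Fin (n + 1)) K)
    (FractionRing (MvPolynomial (Fin (n + 1)) K))).comp
    (MvPolynomial.rename_injective w w.injective)

theorem frac_X (w : Equiv.Perm (Fin (n + 1))) (k : Fin (n + 1)) :
    frac (K := K) w (MvPolynomial.X k) = fracX K (w k) := by
  simp [frac, fracX]

theorem frac_smul (w : Equiv.Perm (Fin (n + 1))) (c : K) (f : MvPolynomial (Fin (n + 1)) K) :
    frac w (c • f) = fracC n c * frac w f := by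
  rw [MvPolynomial.smul_eq_C_mul, map_mul]
  simp [frac, fracC]

theorem frac_swapX (w : Equiv.Perm (Fin (n + 1))) (i : Fin n) (f : MvPolynomial (Fin (n + 1)) K) :
    frac w (swapX i f) = frac (w * sw i) f := by
  simp only [frac, swapX, RingHom.comp_apply, AlgHom.toRingHom_eq_coe, RingHom.coe_coe,
    AlgHom.toLinearMap_apply, MvPolynomial.rename_rename]
  rfl

theorem fracC_sub (a b : K) : fracC n (a - b) = fracC n a - fracC n b := by simp [fracC]

theorem fracC_one : fracC n (1 : K) = 1 := by simp [fracC]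

theorem frac_delta (w : Equiv.Perm (Fin (n + 1))) (i : Fin n)
    (f : MvPolynomial (Fin (n + 1)) K) :
    frac w (delta s i f) = (1 - fracC n s) * fracX K (w i.succ) /
      (fracX K (w i.castSucc) - fracX K (w i.succ)) * (frac w f - frac (w * sw i) f) := by
  have h := congrArg (frac w) (divDiff_spec i f)
  rw [map_mul, map_sub, map_sub, frac_X, frac_X, frac_swapX] at h
  have hne : fracX K (w i.castSucc) - fracX K (w i.succ) ≠ 0 :=
    fracX_sub_ne (w.injective.ne Fin.castSucc_lt_succ.ne)
  rw [← h]
  have : delta s i f = (1 - s) • (MvPolynomial.X i.succ * divDiff i f) := rfl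
  rw [this, frac_smul, map_mul, frac_X, fracC_sub, fracC_one]
  field_simp

theorem end_ext {f g : Module.End K (MvPolynomial (Fin (n + 1)) K)}
    (h : ∀ p, frac 1 (f p) = frac 1 (g p)) : f = g :=
  LinearMap.ext fun p => frac_injective 1 (h p)

theorem sw_mul_sw (i : Fin n) : sw i * sw i = 1 := Equiv.swap_mul_self _ _

theorem swapX_mul_swapX (i : Fin n) :
    (swapX i * swapX i : Module.End K (MvPolynomial (Fin (n + 1)) K)) = 1 := by
  apply end_ext
  intro p
  simp only [Module.End.mul_apply, Module.End.one_apply, frac_swapX, one_mul, sw_mul_sw]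

theorem delta_mul_delta (i : Fin n) :
    (delta s i * delta s i : Module.End K (MvPolynomial (Fin (n + 1)) K))
      = (s - 1) • delta s i := by
  apply end_ext
  intro p
  have hne := fracX_sub_ne (K := K) (Fin.castSucc_lt_succ (i := i)).ne
  have hne' := fracX_sub_ne (K := K) (Fin.castSucc_lt_succ (i := i)).ne'
  simp only [Module.End.mul_apply, LinearMap.smul_apply, frac_smul, frac_delta,
    one_mul, Equiv.Perm.one_apply, sw, Equiv.swap_apply_left, Equiv.swap_apply_right,
    Equiv.swap_mul_self, fracC_sub, fracC_one]
  generalize fracX K i.castSucc = a at *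
  generalize fracX K i.succ = b at *
  field_simp
  ring

theorem delta_swapX (i : Fin n) :
    (delta s i * swapX i + swapX i * delta s i + (s - 1) • 1 :
      Module.End K (MvPolynomial (Fin (n + 1)) K)) = (s - 1) • swapX i := by
  apply end_ext
  intro p
  have hne := fracX_sub_ne (K := K) (Fin.castSucc_lt_succ (i := i)).ne
  have hne' := fracX_sub_ne (K := K) (Fin.castSucc_lt_succ (i := i)).ne'
  simp only [Module.End.mul_apply, LinearMap.add_apply, LinearMap.smul_apply, frac_smul,
    frac_delta, frac_swapX, map_add, Module.End.one_apply,
    one_mul, Equiv.Perm.one_apply, sw, Equiv.swap_apply_left, Equiv.swap_apply_right,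
    Equiv.swap_mul_self, fracC_sub, fracC_one]
  generalize fracX K i.castSucc = a at *
  generalize fracX K i.succ = b at *
  field_simp
  ring

/-- The permutations of three neighbouring positions. -/
theorem adjacent_perm {i j : Fin n} (hij : i.1 + 1 = j.1) :
    sw i * sw j * sw i = sw j * sw i * sw j := by
  ext1 x
  exact congrFun (braid_comp hij id) x

theorem swapX_braid {i j : Fin n} (hij : i.1 + 1 = j.1) :
    (swapX i * swapX j * swapX i : Module.End K (MvPolynomial (Fin (n + 1)) K))
      = swapX j * swapX i * swapX j := by
  apply end_ext
  intro p
  simp only [Module.End.mul_apply, frac_swapX, one_mul, adjacent_perm hij]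

theorem swapX_swapX_delta {i j : Fin n} (hij : i.1 + 1 = j.1) :
    (swapX i * swapX j * delta s i : Module.End K (MvPolynomial (Fin (n + 1)) K))
      = delta s j * swapX i * swapX j := by
  apply end_ext
  intro p
  have h1 : (sw i * sw j) i.castSucc = j.castSucc := by
    rw [adjacent_castSucc hij]
    exact ((adjacent_eval hij (sw i)).2.1).trans (Equiv.swap_apply_left _ _)
  have h2 : (sw i * sw j) i.succ = j.succ :=
    ((adjacent_eval hij (sw i)).2.2.1).trans (adjacent_eval hij id).1
  simp only [Module.End.mul_apply, frac_swapX, frac_delta, one_mul, adjacent_perm hij, h1, h2,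
    Equiv.Perm.one_apply]

theorem delta_swapX_swapX {i j : Fin n} (hij : i.1 + 1 = j.1) :
    (delta s i * swapX j * swapX i : Module.End K (MvPolynomial (Fin (n + 1)) K))
      = swapX j * swapX i * delta s j := by
  apply end_ext
  intro p
  have h1 : (sw j * sw i) j.castSucc = i.castSucc := by
    rw [adjacent_castSucc hij]
    exact (comp_sw_succ (sw j) i).trans (adjacent_eval hij id).2.1
  have h2 : (sw j * sw i) j.succ = i.succ :=
    ((adjacent_eval hij (sw j)).1).trans (adjacent_eval hij id).2.2.2
  simp only [Module.End.mul_apply, frac_swapX, frac_delta, one_mul, adjacent_perm hij, h1, h2,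
    Equiv.Perm.one_apply]

section Adjacent

variable {i j : Fin n}

theorem fracX_adjacent_ne (hij : i.1 + 1 = j.1) :
    fracX K i.castSucc - fracX K i.succ ≠ 0 ∧ fracX K i.succ - fracX K i.castSucc ≠ 0 ∧
    fracX K i.succ - fracX K j.succ ≠ 0 ∧ fracX K j.succ - fracX K i.succ ≠ 0 ∧
    fracX K i.castSucc - fracX K j.succ ≠ 0 ∧ fracX K j.succ - fracX K i.castSucc ≠ 0 := by
  have h1 : i.castSucc ≠ i.succ := Fin.castSucc_lt_succ.ne
  have h2 : i.succ ≠ j.succ := by rw [← adjacent_castSucc hij]; exact Fin.castSucc_lt_succ.ne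
  have h3 : i.castSucc ≠ j.succ := by
    intro h; simp only [Fin.ext_iff, Fin.val_castSucc, Fin.val_succ] at h; omega
  exact ⟨fracX_sub_ne h1, fracX_sub_ne h1.symm, fracX_sub_ne h2, fracX_sub_ne h2.symm,
    fracX_sub_ne h3, fracX_sub_ne h3.symm⟩

theorem sw_eval_adjacent (hij : i.1 + 1 = j.1) :
    (sw i i.castSucc = i.succ ∧ sw i i.succ = i.castSucc ∧ sw i j.succ = j.succ) ∧
    (sw j i.castSucc = i.castSucc ∧ sw j i.succ = j.succ ∧ sw j j.succ = i.succ) :=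
  ⟨⟨Equiv.swap_apply_left _ _, Equiv.swap_apply_right _ _, (adjacent_eval hij id).1⟩,
    (adjacent_eval hij id).2⟩

theorem delta_delta_delta (hij : i.1 + 1 = j.1) :
    (delta s i * delta s j * delta s i + s • (swapX i * delta s j * swapX i) :
      Module.End K (MvPolynomial (Fin (n + 1)) K))
      = delta s j * delta s i * delta s j + s • (swapX j * delta s i * swapX j) := by
  apply end_ext
  intro p
  obtain ⟨⟨a1, a2, a3⟩, a4, a5, a6⟩ := sw_eval_adjacent hij
  obtain ⟨h1, h1', h2, h2', h3, h3'⟩ := fracX_adjacent_ne (K := K) hij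
  simp only [Module.End.mul_apply, LinearMap.add_apply, LinearMap.smul_apply, frac_smul,
    frac_delta, frac_swapX, map_add, one_mul, sw_mul_sw, Equiv.Perm.one_apply,
    Equiv.Perm.mul_apply, adjacent_castSucc hij, a1, a2, a3, a4, a5, a6, adjacent_perm hij]
  generalize fracX K i.castSucc = a at *
  generalize fracX K i.succ = b at *
  generalize fracX K j.succ = c at *
  field_simp
  ring

theorem delta_swapX_delta_left (hij : i.1 + 1 = j.1) :
    (delta s i * delta s j * swapX i + swapX i * delta s j * delta s i
      + (s - 1) • (swapX i * delta s j * swapX i) : Module.End K (MvPolynomial (Fin (n + 1)) K))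
      = delta s j * swapX i * delta s j := by
  apply end_ext
  intro p
  obtain ⟨⟨a1, a2, a3⟩, a4, a5, a6⟩ := sw_eval_adjacent hij
  obtain ⟨h1, h1', h2, h2', h3, h3'⟩ := fracX_adjacent_ne (K := K) hij
  simp only [Module.End.mul_apply, LinearMap.add_apply, LinearMap.smul_apply, frac_smul,
    frac_delta, frac_swapX, map_add, one_mul, sw_mul_sw, Equiv.Perm.one_apply,
    Equiv.Perm.mul_apply, adjacent_castSucc hij, a1, a2, a3, a4, a5, a6, adjacent_perm hij,
    fracC_sub, fracC_one]
  generalize fracX K i.castSucc = a at *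
  generalize fracX K i.succ = b at *
  generalize fracX K j.succ = c at *
  field_simp
  ring

theorem delta_swapX_delta_right (hij : i.1 + 1 = j.1) :
    (delta s i * swapX j * delta s i : Module.End K (MvPolynomial (Fin (n + 1)) K))
      = delta s j * delta s i * swapX j + swapX j * delta s i * delta s j
      + (s - 1) • (swapX j * delta s i * swapX j) := by
  apply end_ext
  intro p
  obtain ⟨⟨a1, a2, a3⟩, a4, a5, a6⟩ := sw_eval_adjacent hij
  obtain ⟨h1, h1', h2, h2', h3, h3'⟩ := fracX_adjacent_ne (K := K) hij
  simp only [Module.End.mul_apply, LinearMap.add_apply, LinearMap.smul_apply, frac_smul,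
    frac_delta, frac_swapX, map_add, one_mul, sw_mul_sw, Equiv.Perm.one_apply,
    Equiv.Perm.mul_apply, adjacent_castSucc hij, a1, a2, a3, a4, a5, a6, adjacent_perm hij,
    fracC_sub, fracC_one]
  generalize fracX K i.castSucc = a at *
  generalize fracX K i.succ = b at *
  generalize fracX K j.succ = c at *
  field_simp
  ring

end Adjacent

section Far

variable {i j : Fin n}

theorem far_perm (hij : i.1 + 1 < j.1) : sw i * sw j = sw j * sw i := by
  ext1 x
  exact congrFun (far_comp hij id) x

theorem swapX_comm (hij : i.1 + 1 < j.1) :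
    (swapX i * swapX j : Module.End K (MvPolynomial (Fin (n + 1)) K)) = swapX j * swapX i := by
  apply end_ext
  intro p
  simp only [Module.End.mul_apply, frac_swapX, one_mul, far_perm hij]

theorem delta_comm_swapX (hij : i.1 + 1 < j.1) :
    (delta s i * swapX j : Module.End K (MvPolynomial (Fin (n + 1)) K))
      = swapX j * delta s i := by
  apply end_ext
  intro p
  obtain ⟨_, _, a3, a4⟩ := far_eval hij id
  simp only [Function.comp, id] at a3 a4
  simp only [Module.End.mul_apply, frac_swapX, frac_delta, one_mul, far_perm hij, a3, a4,
    Equiv.Perm.one_apply]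

theorem swapX_comm_delta (hij : i.1 + 1 < j.1) :
    (swapX i * delta s j : Module.End K (MvPolynomial (Fin (n + 1)) K))
      = delta s j * swapX i := by
  apply end_ext
  intro p
  obtain ⟨a1, a2, _, _⟩ := far_eval hij id
  simp only [Function.comp, id] at a1 a2
  simp only [Module.End.mul_apply, frac_swapX, frac_delta, one_mul, far_perm hij, a1, a2,
    Equiv.Perm.one_apply]

theorem delta_comm (hij : i.1 + 1 < j.1) :
    (delta s i * delta s j : Module.End K (MvPolynomial (Fin (n + 1)) K))
      = delta s j * delta s i := by
  apply end_ext
  intro p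
  obtain ⟨a1, a2, a3, a4⟩ := far_eval hij id
  simp only [Function.comp, id] at a1 a2 a3 a4
  simp only [Module.End.mul_apply, frac_delta, one_mul, far_perm hij, a1, a2, a3, a4,
    Equiv.Perm.one_apply]
  ring

end Far

/-- Multiplication by the variable `x_k`. -/
noncomputable def mulX (K : Type*) [Field K] (k : Fin (n + 1)) :
    Module.End K (MvPolynomial (Fin (n + 1)) K) :=
  LinearMap.mulLeft K (MvPolynomial.X k)

theorem frac_mulX (w : Equiv.Perm (Fin (n + 1))) (k : Fin (n + 1))
    (f : MvPolynomial (Fin (n + 1)) K) :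
    frac w (mulX K k f) = fracX K (w k) * frac w f := by
  rw [mulX, LinearMap.mulLeft_apply, map_mul, frac_X]

theorem mulX_comm (k l : Fin (n + 1)) : mulX K k * mulX K l = mulX K l * mulX K k := by
  apply end_ext
  intro p
  simp only [Module.End.mul_apply, frac_mulX]
  ring

theorem swapX_mulX_swapX (i : Fin n) :
    swapX i * mulX K i.castSucc * swapX i = mulX K i.succ := by
  apply end_ext
  intro p
  simp only [Module.End.mul_apply, frac_mulX, frac_swapX, one_mul, sw,
    Equiv.swap_apply_left, Equiv.swap_mul_self, Equiv.Perm.one_apply]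

theorem delta_mulX_delta (i : Fin n) :
    delta s i * mulX K i.castSucc * delta s i = 0 := by
  apply end_ext
  intro p
  have hne := fracX_sub_ne (K := K) (Fin.castSucc_lt_succ (i := i)).ne
  have hne' := fracX_sub_ne (K := K) (Fin.castSucc_lt_succ (i := i)).ne'
  simp only [Module.End.mul_apply, frac_mulX, frac_delta, one_mul, sw,
    Equiv.swap_apply_left, Equiv.swap_apply_right, Equiv.swap_mul_self, Equiv.Perm.one_apply,
    LinearMap.zero_apply, map_zero]
  generalize fracX K i.castSucc = a at *
  generalize fracX K i.succ = b at *
  field_simp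
  ring

theorem delta_mulX_swapX (i : Fin n) :
    delta s i * mulX K i.castSucc * swapX i + swapX i * mulX K i.castSucc * delta s i
      + (s - 1) • mulX K i.succ = 0 := by
  apply end_ext
  intro p
  have hne := fracX_sub_ne (K := K) (Fin.castSucc_lt_succ (i := i)).ne
  have hne' := fracX_sub_ne (K := K) (Fin.castSucc_lt_succ (i := i)).ne'
  simp only [Module.End.mul_apply, LinearMap.add_apply, LinearMap.smul_apply, frac_smul, frac_mulX,
    frac_delta, frac_swapX, one_mul, sw, map_add,
    Equiv.swap_apply_left, Equiv.swap_apply_right, Equiv.swap_mul_self, Equiv.Perm.one_apply,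
    LinearMap.zero_apply, map_zero, fracC_sub, fracC_one]
  generalize fracX K i.castSucc = a at *
  generalize fracX K i.succ = b at *
  field_simp
  ring

theorem swapX_comm_mulX {i : Fin n} {k : Fin (n + 1)} (h1 : k ≠ i.castSucc) (h2 : k ≠ i.succ) :
    swapX i * mulX K k = mulX K k * swapX i := by
  apply end_ext
  intro p
  simp only [Module.End.mul_apply, frac_mulX, frac_swapX, one_mul, sw,
    Equiv.swap_apply_of_ne_of_ne h1 h2, Equiv.Perm.one_apply]

theorem delta_comm_mulX {i : Fin n} {k : Fin (n + 1)} (h1 : k ≠ i.castSucc) (h2 : k ≠ i.succ) :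
    delta s i * mulX K k = mulX K k * delta s i := by
  apply end_ext
  intro p
  simp only [Module.End.mul_apply, frac_mulX, frac_delta, one_mul, sw,
    Equiv.swap_apply_of_ne_of_ne h1 h2, Equiv.Perm.one_apply]
  ring

end PolynomialOperators

/-! ### The affine Hecke relations on vector valued polynomials -/

section RaisingOperator

variable {A : Type*} [Ring A]

/-- The product `t_{m-1} ⋯ t_0`. -/
def descProd (t : ℕ → A) : ℕ → A
  | 0 => 1
  | m + 1 => t m * descProd t m

theorem foldl_range_eq_descProd (t : ℕ → A) (m : ℕ) :
    (List.range m).foldl (fun B k => t k * B) 1 = descProd t m := by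
  induction m with
  | zero => rfl
  | succ m ih => rw [List.range_succ, List.foldl_append, ih]; rfl

theorem descProd_succ (t : ℕ → A) (m : ℕ) :
    descProd t (m + 1) = descProd (fun k => t (k + 1)) m * t 0 := by
  induction m with
  | zero => simp [descProd]
  | succ m ih => rw [descProd, ih, descProd, mul_assoc]

/-- Mutually inverse braid generators `T_k` and `t_k` for `k < n`. -/
structure BraidRel (n : ℕ) (T t : ℕ → A) : Prop where
  mul_inv : ∀ k < n, T k * t k = 1
  inv_mul : ∀ k < n, t k * T k = 1
  braid : ∀ k, k + 1 < n → T k * T (k + 1) * T k = T (k + 1) * T k * T (k + 1)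
  comm : ∀ k l, k + 1 < l → l < n → T k * T l = T l * T k

variable {n : ℕ} {T t : ℕ → A}

theorem comm_inv_of_comm {x y y' : A} (h : x * y = y * x) (h1 : y * y' = 1) (h2 : y' * y = 1) :
    x * y' = y' * x := by
  calc x * y' = y' * y * (x * y') := by rw [h2, one_mul]
    _ = y' * (y * x) * y' := by noncomm_ring
    _ = y' * x * (y * y') := by rw [← h]; noncomm_ring
    _ = y' * x := by rw [h1, mul_one]

theorem BraidRel.comm_descProd (H : BraidRel n T t) {m l : ℕ} (h : m < l) (hl : l < n) :
    T l * descProd t m = descProd t m * T l := by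
  induction m with
  | zero => simp [descProd]
  | succ m ih =>
    have h1 : T l * t m = t m * T l :=
      comm_inv_of_comm (H.comm m l h hl).symm (H.mul_inv m (by omega)) (H.inv_mul m (by omega))
    rw [descProd, ← mul_assoc, h1, mul_assoc, ih (by omega), mul_assoc]

theorem BraidRel.mul_descProd (H : BraidRel n T t) {k m : ℕ} (hk : k + 1 < m) (hm : m ≤ n) :
    T k * descProd t m = descProd t m * T (k + 1) := by
  induction m with
  | zero => omega
  | succ m ih =>
    rcases Nat.lt_or_eq_of_le (Nat.lt_succ_iff.mp hk) with h | h
    · have h1 : T k * t m = t m * T k :=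
        comm_inv_of_comm (H.comm k m h (by omega)) (H.mul_inv m (by omega)) (H.inv_mul m (by omega))
      rw [descProd, ← mul_assoc, h1, mul_assoc, ih h (by omega), mul_assoc]
    · subst h
      have i1 := H.mul_inv k (by omega)
      have i2 := H.inv_mul k (by omega)
      have j1 := H.mul_inv (k + 1) (by omega)
      have j2 := H.inv_mul (k + 1) (by omega)
      have hb := H.braid k (by omega)
      have h1 : T k * t (k + 1) * t k = t (k + 1) * t k * T (k + 1) := by
        calc T k * t (k + 1) * t k
            = t (k + 1) * (t k * T k) * T (k + 1) * (T k * t (k + 1) * t k) := by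
              rw [i2, mul_one, j2, one_mul]
          _ = t (k + 1) * t k * (T k * T (k + 1) * T k) * t (k + 1) * t k := by noncomm_ring
          _ = t (k + 1) * t k * (T (k + 1) * T k * (T (k + 1) * t (k + 1)) * t k) := by
              rw [hb]; noncomm_ring
          _ = t (k + 1) * t k * (T (k + 1) * (T k * t k)) := by rw [j1]; noncomm_ring
          _ = t (k + 1) * t k * T (k + 1) := by rw [i1, mul_one]
      have h2 := H.comm_descProd (m := k) (l := k + 1) (by omega) (by omega)
      calc T k * descProd t (k + 1 + 1)
          = T k * t (k + 1) * t k * descProd t k := by simp only [descProd]; noncomm_ring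
        _ = t (k + 1) * t k * (T (k + 1) * descProd t k) := by rw [h1]; noncomm_ring
        _ = descProd t (k + 1 + 1) * T (k + 1) := by rw [h2]; simp only [descProd]; noncomm_ring

theorem BraidRel.inv_mul_descProd (H : BraidRel n T t) {k : ℕ} (hk : k + 1 < n) :
    t k * descProd t n = descProd t n * t (k + 1) := by
  have h := H.mul_descProd hk le_rfl
  calc t k * descProd t n = t k * descProd t n * (T (k + 1) * t (k + 1)) := by
        rw [H.mul_inv _ hk, mul_one]
    _ = t k * (descProd t n * T (k + 1)) * t (k + 1) := by noncomm_ring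
    _ = (t k * T k) * descProd t n * t (k + 1) := by rw [← h]; noncomm_ring
    _ = descProd t n * t (k + 1) := by rw [H.inv_mul k (by omega), one_mul]

theorem BraidRel.descProd_mul_descProd (H : BraidRel n T t) {m : ℕ} (hm : m < n) :
    descProd t m * descProd t n = descProd t n * descProd (fun k => t (k + 1)) m := by
  induction m with
  | zero => simp [descProd]
  | succ m ih =>
    rw [descProd, mul_assoc, ih (by omega), ← mul_assoc, H.inv_mul_descProd hm, mul_assoc]
    rfl

/-- The square of `t_{m} ⋯ t_0` conjugates the first braid generator to the last one. -/
theorem BraidRel.last_mul_sq {m : ℕ} (H : BraidRel (m + 1) T t) :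
    T m * (descProd t m * descProd t (m + 1)) = descProd t m * descProd t (m + 1) * T 0 := by
  have h1 : T m * descProd t (m + 1) = descProd t m := by
    rw [descProd, ← mul_assoc, H.mul_inv m (by omega), one_mul]
  have h2 : descProd (fun k => t (k + 1)) m = descProd t (m + 1) * T 0 := by
    rw [descProd_succ, mul_assoc, H.inv_mul 0 (by omega), mul_one]
  have h3 : descProd t m * descProd t (m + 1) = descProd t (m + 1) * descProd t (m + 1) * T 0 := by
    rw [H.descProd_mul_descProd (by omega), h2, mul_assoc]
  calc T m * (descProd t m * descProd t (m + 1))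
      = (T m * descProd t (m + 1)) * descProd t (m + 1) * T 0 := by rw [h3]; noncomm_ring
    _ = descProd t m * descProd t (m + 1) * T 0 := by rw [h1]

/-- Exchange relation between `(x t_m ⋯ t_0)²` and the braid generators. The relation
`T x' T = s x` makes `x t x` commute with `T`. -/
theorem BraidRel.last_mul_phi_sq {K : Type*} [Field K] [Algebra K A] {s : K} (hs : s ≠ 0) {m : ℕ}
    (H : BraidRel (m + 1) T t) {x x' : A} (hx : T m * x' * T m = s • x) (hxx : x * x' = x' * x)
    (hcomm : ∀ k < m, T k * x = x * T k) :
    T m * ((x * descProd t (m + 1)) * (x * descProd t (m + 1)))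
      = (x * descProd t (m + 1)) * (x * descProd t (m + 1)) * T 0 := by
  have hd : ∀ l, l ≤ m → descProd t l * x = x * descProd t l := by
    intro l hl
    induction l with
    | zero => simp [descProd]
    | succ l ih =>
      have := comm_inv_of_comm (hcomm l hl).symm (H.mul_inv l (by omega)) (H.inv_mul l (by omega))
      rw [descProd, mul_assoc, ih (by omega), ← mul_assoc, ← this, mul_assoc]
  have i1 := H.mul_inv m (by omega)
  have i2 := H.inv_mul m (by omega)
  have h1 : s • (t m * x) = x' * T m := by
    rw [← mul_smul_comm, ← hx, mul_assoc (T m), ← mul_assoc (t m), i2, one_mul]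
  have h2 : s • (x * t m) = T m * x' := by
    rw [← smul_mul_assoc, ← hx, mul_assoc _ (T m), i1, mul_one]
  have h3 : s • (T m * (x * t m * x)) = s • (x * t m * x * T m) := by
    have e1 : s • (T m * (x * t m * x)) = T m * x * (s • (t m * x)) := by
      rw [mul_smul_comm]; noncomm_ring
    have e2 : s • (x * t m * x * T m) = s • (x * t m) * x * T m := by
      rw [smul_mul_assoc, smul_mul_assoc]
    rw [e1, h1, e2, h2]
    calc T m * x * (x' * T m) = T m * (x * x') * T m := by noncomm_ring
      _ = T m * x' * x * T m := by rw [hxx]; noncomm_ring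
  have h4 : T m * (x * t m * x) = x * t m * x * T m := smul_right_injective A hs h3
  have h5 : (x * descProd t (m + 1)) * (x * descProd t (m + 1))
      = x * t m * x * (descProd t m * descProd t (m + 1)) := by
    calc (x * descProd t (m + 1)) * (x * descProd t (m + 1))
        = x * t m * (descProd t m * x) * descProd t (m + 1) := by
          simp only [descProd]; noncomm_ring
      _ = x * t m * x * (descProd t m * descProd t (m + 1)) := by
          rw [hd m le_rfl]; noncomm_ring
  rw [h5, ← mul_assoc, h4, mul_assoc _ (T m), H.last_mul_sq]
  noncomm_ring

end RaisingOperator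

section TensorOperators

variable {K : Type*} [Field K] {P W : Type*} [AddCommGroup P] [Module K P] [AddCommGroup W]
  [Module K W] {s : K}

/-- The tensor product of two endomorphisms. -/
noncomputable abbrev tm (f : Module.End K P) (g : Module.End K W) :
    Module.End K (TensorProduct K P W) := TensorProduct.map f g

theorem tm_mul (f f' : Module.End K P) (g g' : Module.End K W) :
    tm f g * tm f' g' = tm (f * f') (g * g') :=
  (TensorProduct.map_mul f f' g g').symm

theorem tm_one : tm (1 : Module.End K P) (1 : Module.End K W) = 1 := TensorProduct.map_one

theorem tm_add_left (f f' : Module.End K P) (g : Module.End K W) :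
    tm (f + f') g = tm f g + tm f' g :=
  TensorProduct.map_add_left f f' g

theorem tm_add_right (f : Module.End K P) (g g' : Module.End K W) :
    tm f (g + g') = tm f g + tm f g' :=
  TensorProduct.map_add_right f g g'

theorem tm_smul_left (c : K) (f : Module.End K P) (g : Module.End K W) :
    tm (c • f) g = c • tm f g :=
  TensorProduct.map_smul_left c f g

theorem tm_smul_right (c : K) (f : Module.End K P) (g : Module.End K W) :
    tm f (c • g) = c • tm f g :=
  TensorProduct.map_smul_right c f g

theorem tm_zero_left (g : Module.End K W) : tm (0 : Module.End K P) g = 0 :=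
  TensorProduct.map_zero_left g

/-- The quadratic relation for `d ⊗ 1 + σ ⊗ h`, from that of `h` and relations between `d` and
`σ`. -/
theorem tm_quad {d σ : Module.End K P} {h : Module.End K W} (hh : h * h = (s - 1) • h + s • 1)
    (hσ : σ * σ = 1) (hd : d * d = (s - 1) • d)
    (hdσ : d * σ + σ * d + (s - 1) • 1 = (s - 1) • σ) :
    (tm d 1 + tm σ h) * (tm d 1 + tm σ h) = (s - 1) • (tm d 1 + tm σ h) + s • 1 := by
  have e1 := congrArg (fun f => tm f h) hdσ
  simp only [tm_add_left, tm_smul_left] at e1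
  simp only [add_mul, mul_add, tm_mul, hd, hσ, hh, mul_one, one_mul, tm_add_right, tm_smul_right,
    tm_smul_left, tm_one]
  linear_combination (norm := module) e1

/-- The braid relation for `d ⊗ 1 + σ ⊗ h`, by comparing the coefficients of the words in `h` and
`h'` on both sides. -/
theorem tm_braid {d d' σ σ' : Module.End K P} {h h' : Module.End K W}
    (hh : h * h = (s - 1) • h + s • 1) (hh' : h' * h' = (s - 1) • h' + s • 1)
    (hb : h * h' * h = h' * h * h') (hσ : σ * σ' * σ = σ' * σ * σ')
    (h1 : σ * σ' * d = d' * σ * σ') (h2 : d * σ' * σ = σ' * σ * d')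
    (h3 : d * d' * d + s • (σ * d' * σ) = d' * d * d' + s • (σ' * d * σ'))
    (h4 : d * d' * σ + σ * d' * d + (s - 1) • (σ * d' * σ) = d' * σ * d')
    (h5 : d * σ' * d = d' * d * σ' + σ' * d * d' + (s - 1) • (σ' * d * σ')) :
    (tm d 1 + tm σ h) * (tm d' 1 + tm σ' h') * (tm d 1 + tm σ h)
      = (tm d' 1 + tm σ' h') * (tm d 1 + tm σ h) * (tm d' 1 + tm σ' h') := by
  have e0 := congrArg (fun f => tm f (1 : Module.End K W)) h3
  have e1 := congrArg (fun f => tm f h) h4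
  have e2 := congrArg (fun f => tm f h') h5
  simp only [tm_add_left, tm_smul_left] at e0 e1 e2
  simp only [add_mul, mul_add, tm_mul, hh, hh', hb, mul_one, one_mul, hσ, h1, h2, tm_add_right,
    tm_smul_right]
  linear_combination (norm := module) e0 + e1 + e2

/-- The cross relation between `d ⊗ 1 + σ ⊗ h` and the multiplications by two neighbouring
variables. -/
theorem tm_variable {d σ x x' : Module.End K P} {h : Module.End K W}
    (hh : h * h = (s - 1) • h + s • 1) (hσ : σ * x * σ = x') (hd : d * x * d = 0)
    (hdσ : d * x * σ + σ * x * d + (s - 1) • x' = 0) :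
    (tm d 1 + tm σ h) * tm x 1 * (tm d 1 + tm σ h) = s • tm x' 1 := by
  have e1 := congrArg (fun f => tm f h) hdσ
  simp only [tm_add_left, tm_smul_left, tm_zero_left] at e1
  simp only [add_mul, mul_add, tm_mul, hd, hσ, hh, mul_one, one_mul, tm_add_right, tm_smul_right,
    tm_zero_left]
  linear_combination (norm := module) e1

end TensorOperators

section BoldOperators

variable {K : Type*} [Field K] {lam : YoungDiagram} {n : ℕ} {s : K}

theorem bT_eq (i : Fin n) : (bT s i : Module.End K (VPoly K lam n))
    = tm (delta s i) 1 + tm (swapX i) (heckeV s i) := rfl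

theorem bT_quad (hs0 : s ≠ 0) (hs : ∀ m : ℤ, m ≠ 0 → s ^ m ≠ 1) (i : Fin n) :
    (bT s i * bT s i : Module.End K (VPoly K lam n)) = (s - 1) • bT s i + s • 1 :=
  tm_quad (heckeV_quad hs0 hs i) (swapX_mul_swapX i) (delta_mul_delta i) (delta_swapX i)

theorem bT_comm (hs0 : s ≠ 0) (hs : ∀ m : ℤ, m ≠ 0 → s ^ m ≠ 1) {i j : Fin n}
    (hij : i.1 + 1 < j.1) :
    (bT s i * bT s j : Module.End K (VPoly K lam n)) = bT s j * bT s i := by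
  have hq : (heckeV s i * heckeV s j : Module.End K (V K lam n)) = heckeV s j * heckeV s i :=
    heckeV_comm hs0 hs hij
  simp only [bT_eq, add_mul, mul_add, tm_mul, swapX_comm hij, delta_comm hij, delta_comm_swapX hij,
    swapX_comm_delta hij, hq, mul_one, one_mul]
  abel

theorem bT_braid (hs0 : s ≠ 0) (hs : ∀ m : ℤ, m ≠ 0 → s ^ m ≠ 1) {i j : Fin n}
    (hij : i.1 + 1 = j.1) :
    (bT s i * bT s j * bT s i : Module.End K (VPoly K lam n)) = bT s j * bT s i * bT s j :=
  tm_braid (heckeV_quad hs0 hs i) (heckeV_quad hs0 hs j) (heckeV_braid hs0 hs hij)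
    (swapX_braid hij) (swapX_swapX_delta hij) (delta_swapX_swapX hij) (delta_delta_delta hij)
    (delta_swapX_delta_left hij) (delta_swapX_delta_right hij)

/-- Multiplication of vector valued polynomials by the variable `x_k`. -/
noncomputable def bX (lam : YoungDiagram) (K : Type*) [Field K] (k : Fin (n + 1)) :
    Module.End K (VPoly K lam n) := tm (mulX K k) 1

theorem bX_comm (k l : Fin (n + 1)) : bX lam K k * bX lam K l = bX lam K l * bX lam K k := by
  simp only [bX, tm_mul, mulX_comm k l]

theorem bT_comm_bX {i : Fin n} {k : Fin (n + 1)} (h1 : k ≠ i.castSucc) (h2 : k ≠ i.succ) :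
    bT s i * bX lam K k = bX lam K k * bT s i := by
  simp only [bT_eq, bX, add_mul, mul_add, tm_mul, swapX_comm_mulX h1 h2, delta_comm_mulX h1 h2,
    mul_one, one_mul]

theorem bT_bX_bT (hs0 : s ≠ 0) (hs : ∀ m : ℤ, m ≠ 0 → s ^ m ≠ 1) (i : Fin n) :
    bT s i * bX lam K i.castSucc * bT s i = s • bX lam K i.succ :=
  tm_variable (heckeV_quad hs0 hs i) (swapX_mulX_swapX i) (delta_mulX_delta i)
    (delta_mulX_swapX i)

theorem bT_mul_bTinv (hs0 : s ≠ 0) (hs : ∀ m : ℤ, m ≠ 0 → s ^ m ≠ 1) (i : Fin n) :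
    (bT s i * bTinv s i : Module.End K (VPoly K lam n)) = 1 := by
  have h : (bTinv s i : Module.End K (VPoly K lam n)) = s⁻¹ • (bT s i + (1 - s) • 1) := rfl
  rw [h, mul_smul_comm, mul_add, bT_quad hs0 hs, mul_smul_comm, mul_one, inv_smul_eq_iff₀ hs0]
  module

theorem bTinv_mul_bT (hs0 : s ≠ 0) (hs : ∀ m : ℤ, m ≠ 0 → s ^ m ≠ 1) (i : Fin n) :
    (bTinv s i * bT s i : Module.End K (VPoly K lam n)) = 1 := by
  have h : (bTinv s i : Module.End K (VPoly K lam n)) = s⁻¹ • (bT s i + (1 - s) • 1) := rfl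
  rw [h, smul_mul_assoc, add_mul, bT_quad hs0 hs, smul_mul_assoc, one_mul, inv_smul_eq_iff₀ hs0]
  module

/-- The extension of a family indexed by `Fin n` to all natural numbers, by one. -/
def extOne {A : Type*} [One A] (f : Fin n → A) (k : ℕ) : A := if h : k < n then f ⟨k, h⟩ else 1

theorem extOne_val {A : Type*} [One A] (f : Fin n → A) (i : Fin n) : extOne f i.1 = f i :=
  dif_pos i.2

theorem extOne_of_lt {A : Type*} [One A] (f : Fin n → A) {k : ℕ} (h : k < n) :
    extOne f k = f ⟨k, h⟩ := dif_pos h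

theorem bT_braidRel (hs0 : s ≠ 0) (hs : ∀ m : ℤ, m ≠ 0 → s ^ m ≠ 1) :
    BraidRel n (extOne fun i => (bT s i : Module.End K (VPoly K lam n)))
      (extOne fun i => bTinv s i) where
  mul_inv k hk := by rw [extOne_of_lt _ hk, extOne_of_lt _ hk, bT_mul_bTinv hs0 hs]
  inv_mul k hk := by rw [extOne_of_lt _ hk, extOne_of_lt _ hk, bTinv_mul_bT hs0 hs]
  braid k hk := by
    rw [extOne_of_lt _ hk, extOne_of_lt _ (by omega : k < n)]
    exact bT_braid hs0 hs rfl
  comm k l hkl hl := by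
    rw [extOne_of_lt _ hl, extOne_of_lt _ (by omega : k < n)]
    exact bT_comm hs0 hs hkl

theorem bPhi_eq : (bPhi s : Module.End K (VPoly K lam n))
    = bX lam K (Fin.last n) * descProd (extOne fun i => bTinv s i) n := by
  have h : (List.finRange n).foldl
      (fun (B : Module.End K (VPoly K lam n)) i => bTinv s i * B) 1
        = descProd (extOne fun i => bTinv s i) n := by
    rw [← foldl_range_eq_descProd, ← List.map_coe_finRange_eq_range, List.foldl_map]
    simp only [extOne_val]
  rw [← h]
  rfl

theorem heckeRel_bT (hs0 : s ≠ 0) (hs : ∀ m : ℤ, m ≠ 0 → s ^ m ≠ 1) :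
    HeckeRel s (fun i => (bT s i : Module.End K (VPoly K lam n))) (bPhi s) where
  quad := bT_quad hs0 hs
  braid _ _ := bT_braid hs0 hs
  comm _ _ := bT_comm hs0 hs
  phi i j hij := by
    have h1 : bT s i * bX lam K (Fin.last n) = bX lam K (Fin.last n) * bT s i := by
      apply bT_comm_bX
      · intro h; simp only [Fin.ext_iff, Fin.val_castSucc, Fin.val_last] at h; omega
      · intro h; simp only [Fin.ext_iff, Fin.val_succ, Fin.val_last] at h; omega
    have h2 := (bT_braidRel (lam := lam) (n := n) hs0 hs).mul_descProd (k := i.1)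
      (by rw [hij]; exact j.2) le_rfl
    rw [hij, extOne_val, extOne_val] at h2
    rw [bPhi_eq, ← mul_assoc, h1, mul_assoc, h2, mul_assoc]
  phi_sq i j hi hj := by
    obtain ⟨m, rfl⟩ : ∃ m, n = m + 1 := ⟨i.1, hi.symm⟩
    obtain rfl : i = Fin.last m := by ext; simp; omega
    obtain rfl : j = 0 := by ext; simpa using hj
    have H := bT_braidRel (lam := lam) (n := m + 1) hs0 hs
    have e1 : extOne (fun i => (bT s i : Module.End K (VPoly K lam (m + 1)))) m
        = bT s (Fin.last m) := extOne_val (fun i => bT s i) (Fin.last m)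
    have e2 : extOne (fun i => (bT s i : Module.End K (VPoly K lam (m + 1)))) 0
        = bT s 0 := extOne_val (fun i => bT s i) 0
    have h := H.last_mul_phi_sq hs0 (x := bX lam K (Fin.last (m + 1)))
      (x' := bX lam K (Fin.last m).castSucc)
      (by rw [e1]; exact bT_bX_bT hs0 hs (Fin.last m)) (bX_comm _ _) (by
        intro k hk
        rw [extOne_of_lt _ (by omega : k < m + 1)]
        apply bT_comm_bX
        · intro h; simp only [Fin.ext_iff, Fin.val_castSucc, Fin.val_last] at h; omega
        · intro h; simp only [Fin.ext_iff, Fin.val_succ, Fin.val_last] at h; omega)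
    rw [e1, e2] at h
    rw [bPhi_eq]
    exact h

end BoldOperators

open scoped TensorProduct

/-! ### The vertices of the Yang-Baxter graph -/

section Vertices

variable {K : Type*} [Field K]

/-- Multiplicative independence of `q` and `s`. -/
structure MonomialIndep (q s : K) : Prop where
  q_ne : q ≠ 0
  s_ne : s ≠ 0
  eq_of : ∀ a b a' b' : ℤ, q ^ a * s ^ b = q ^ a' * s ^ b' → a = a' ∧ b = b'

theorem monomialIndep_of_algebraicIndependent [CharZero K] {q s : K}
    (h : AlgebraicIndependent ℚ ![q, s]) : MonomialIndep q s := by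
  have hq : q ≠ 0 := by simpa using h.ne_zero 0
  have hs : s ≠ 0 := by simpa using h.ne_zero 1
  have hnat : ∀ a b a' b' : ℕ, q ^ a * s ^ b = q ^ a' * s ^ b' → a = a' ∧ b = b' := by
    intro a b a' b' he
    have h1 : MvPolynomial.aeval (R := ℚ) ![q, s] (MvPolynomial.X 0 ^ a * MvPolynomial.X 1 ^ b)
        = MvPolynomial.aeval (R := ℚ) ![q, s] (MvPolynomial.X 0 ^ a' * MvPolynomial.X 1 ^ b') := by
      simpa using he
    have h2 := h h1
    rw [MvPolynomial.X_pow_eq_monomial, MvPolynomial.X_pow_eq_monomial,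
      MvPolynomial.X_pow_eq_monomial, MvPolynomial.X_pow_eq_monomial, MvPolynomial.monomial_mul,
      MvPolynomial.monomial_mul, mul_one] at h2
    have h3 := MvPolynomial.monomial_left_injective (one_ne_zero : (1 : ℚ) ≠ 0) h2
    have h4 := DFunLike.congr_fun h3 0
    have h5 := DFunLike.congr_fun h3 1
    simp at h4 h5
    exact ⟨h4, h5⟩
  refine ⟨hq, hs, fun a b a' b' he => ?_⟩
  -- clear the negative exponents
  obtain ⟨m, hm⟩ : ∃ m : ℕ, 0 ≤ a + m ∧ 0 ≤ b + m ∧ 0 ≤ a' + m ∧ 0 ≤ b' + m :=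
    ⟨a.natAbs + b.natAbs + a'.natAbs + b'.natAbs, by omega⟩
  obtain ⟨h1, h2, h3, h4⟩ := hm
  obtain ⟨A, hA⟩ := Int.eq_ofNat_of_zero_le h1
  obtain ⟨B, hB⟩ := Int.eq_ofNat_of_zero_le h2
  obtain ⟨A', hA'⟩ := Int.eq_ofNat_of_zero_le h3
  obtain ⟨B', hB'⟩ := Int.eq_ofNat_of_zero_le h4
  have he' : q ^ (a + m) * s ^ (b + m) = q ^ (a' + m) * s ^ (b' + m) := by
    rw [zpow_add₀ hq, zpow_add₀ hs, zpow_add₀ hq, zpow_add₀ hs]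
    linear_combination (q ^ (m : ℤ) * s ^ (m : ℤ)) * he
  rw [hA, hB, hA', hB', zpow_natCast, zpow_natCast, zpow_natCast, zpow_natCast] at he'
  obtain ⟨h5, h6⟩ := hnat _ _ _ _ he'
  omega

theorem MonomialIndep.zpow_ne_one {q s : K} (I : MonomialIndep q s) (m : ℤ) (hm : m ≠ 0) :
    s ^ m ≠ 1 := by
  intro h
  have := I.eq_of 0 m 0 0 (by simpa using h)
  exact hm this.2

variable {lam : YoungDiagram} {n : ℕ}

/-- The spectral vector of a filling: the powers of `s` given by the contents. -/
def zt (s : K) (e : Fin (n + 1) ≃ Cell lam) (k : Fin (n + 1)) : K := s ^ cc (e k)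

theorem zt_sw_trans (s : K) (e : Fin (n + 1) ≃ Cell lam) (k : Fin n) :
    zt s ((sw k).trans e) = zt s e ∘ sw k := rfl

variable {q s : K}

theorem MonomialIndep.generic (I : MonomialIndep q s) (e : Fin (n + 1) ≃ Cell lam) :
    Generic q (zt s e) where
  q_ne := I.q_ne
  ne_zero _ := zpow_ne_zero _ I.s_ne
  pow_ne k l d hd h := by
    have := I.eq_of d (cc (e k)) 0 (cc (e l)) (by simpa [zt] using h)
    omega

theorem delta_one (i : Fin n) : delta s i (1 : MvPolynomial (Fin (n + 1)) K) = 0 := by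
  apply frac_injective 1
  rw [frac_delta]
  simp

theorem swapX_one (i : Fin n) : swapX i (1 : MvPolynomial (Fin (n + 1)) K) = 1 := by
  simp [swapX]

theorem bT_one_tmul (i : Fin n) (u : V K lam n) :
    bT s i ((1 : MvPolynomial (Fin (n + 1)) K) ⊗ₜ[K] u) = 1 ⊗ₜ[K] heckeV s i u := by
  simp [bT, delta_one, swapX_one]

/-- The polynomial attached to the filling `e` and the composition `v`; it vanishes unless `e` is a
reverse standard tableau. -/
noncomputable def fillPoly (q s : K) (e : Fin (n + 1) ≃ Cell lam) (v : Fin (n + 1) → ℕ) :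
    VPoly K lam n :=
  yb q s (fun i => bT s i) (bPhi s) (zt s e) (1 ⊗ₜ[K] ev K e) v

section

variable {M : Type*} [AddCommGroup M] [Module K M] {T : Fin n → Module.End K M}
  {Φ : Module.End K M} {z : Fin (n + 1) → K} {u : M}

theorem Reach.smul (c : K) {v : Fin (n + 1) → ℕ} {f : M} (h : Reach q s T Φ z u v f) :
    Reach q s T Φ z (c • u) v (c • f) := by
  induction h with
  | zero => exact Reach.zero
  | aff h _ ih => rw [← map_smul]; exact Reach.aff h ih
  | step i h _ ih => rw [← map_smul]; exact Reach.step i h ih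

theorem yb_smul (H : HeckeRel s T Φ) (G : Generic q z) (c : K) (v : Fin (n + 1) → ℕ) :
    yb q s T Φ z (c • u) v = c • yb q s T Φ z u v :=
  reach_unique H G _ _ _ (reach_yb v) ((reach_yb v).smul c)

end

theorem MonomialIndep.hecke (I : MonomialIndep q s) :
    HeckeRel s (fun i => (bT s i : Module.End K (VPoly K lam n))) (bPhi s) :=
  heckeRel_bT I.s_ne I.zpow_ne_one

theorem fillPoly_zero (I : MonomialIndep q s) (e : Fin (n + 1) ≃ Cell lam) :
    fillPoly q s e 0 = 1 ⊗ₜ[K] ev K e := yb_zero I.hecke (I.generic e)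

theorem fillPoly_psi (I : MonomialIndep q s) (e : Fin (n + 1) ≃ Cell lam)
    (v : Fin (n + 1) → ℕ) : fillPoly q s e (psiInd v) = bPhi s (fillPoly q s e v) :=
  yb_psi I.hecke (I.generic e) v

theorem fillPoly_up (I : MonomialIndep q s) (e : Fin (n + 1) ≃ Cell lam)
    {v : Fin (n + 1) → ℕ} {i : Fin n} (h : v i.castSucc < v i.succ) :
    fillPoly q s e (v ∘ sw i) = bT s i (fillPoly q s e v)
      + cf s (zeta q (zt s e) v i.castSucc) (zeta q (zt s e) v i.succ) • fillPoly q s e v :=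
  yb_up I.hecke (I.generic e) h

theorem fillPoly_equal (I : MonomialIndep q s) {e : Fin (n + 1) ≃ Cell lam} (he : IsRST e)
    {v : Fin (n + 1) → ℕ} {i k : Fin n} (h : v i.castSucc = v i.succ)
    (hk : std v i.castSucc = k.castSucc) :
    bT s i (fillPoly q s e v)
      + cf s (zeta q (zt s e) v i.castSucc) (zeta q (zt s e) v i.succ) • fillPoly q s e v
      = beta s (e k.castSucc) (e k.succ) • fillPoly q s ((sw k).trans e) v := by
  have hct := he.content_ne (Fin.castSucc_lt_succ (i := k)) (by simp)
  have hz : zt s e k.castSucc ≠ zt s e k.succ := zpow_ne_zpow I.s_ne I.zpow_ne_one hct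
  have hu : Y s (fun i => (bT s i : Module.End K (VPoly K lam n))) k (zt s e k.castSucc)
      (zt s e k.succ) (1 ⊗ₜ[K] ev K e)
      = beta s (e k.castSucc) (e k.succ) • (1 ⊗ₜ[K] ev K ((sw k).trans e)) := by
    rw [Y_apply, bT_one_tmul, heckeV_ev I.s_ne I.zpow_ne_one, TensorProduct.tmul_add,
      TensorProduct.tmul_smul, TensorProduct.tmul_smul]
    have : cf s (zt s e k.castSucc) (zt s e k.succ) = gam s (e k.castSucc) (e k.succ) := rfl
    rw [this]
    module
  have := yb_equal I.hecke (I.generic e) hz hu v i h hk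
  rw [Y_apply] at this
  rw [fillPoly, this, yb_smul I.hecke ((I.generic e).comp_sw k), fillPoly, zt_sw_trans]

/-- The vertex with tableau `t` and composition `v`. -/
def vtx (q s : K) (t : RST lam n) (v : Fin (n + 1) → ℕ) : Tuple4 K lam n where
  tab := t
  spec := zeta q (zt s t.pos) v
  ind := v
  perm := std v

theorem vtx_inj {t t' : RST lam n} {v v' : Fin (n + 1) → ℕ}
    (h : vtx q s t v = vtx q s t' v') : t = t' ∧ v = v' :=
  ⟨congrArg Tuple4.tab h, congrArg Tuple4.ind h⟩

theorem vtx_act_of_ne (t : RST lam n) {v : Fin (n + 1) → ℕ} {i : Fin n}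
    (h : v i.castSucc ≠ v i.succ) : (vtx q s t v).act i = vtx q s t (v ∘ sw i) := by
  have h' : (vtx q s t v).ind i.succ ≠ (vtx q s t v).ind i.castSucc := h.symm
  rw [Tuple4.act, if_pos h']
  simp only [vtx, zeta_comp_sw h, std_comp_sw h]

theorem vtx_act_of_eq {t : RST lam n} {v : Fin (n + 1) → ℕ} {i k : Fin n}
    (h : v i.castSucc = v i.succ) (hk : std v i.castSucc = k.castSucc)
    (hex : IsRST ((sw k).trans t.pos)) :
    (vtx q s t v).act i = vtx q s (RST.ofPos _ hex) v := by
  have h' : ¬ (vtx q s t v).ind i.succ ≠ (vtx q s t v).ind i.castSucc := not_not.mpr h.symm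
  have he : (vtx q s t v).tab.exchange ((vtx q s t v).perm i.castSucc) ((vtx q s t v).perm i.succ)
      = (sw k).trans t.pos := by
    simp only [vtx, hk, std_succ_of_eq h hk]
    rfl
  rw [Tuple4.act, if_neg h', dif_pos (by rw [he]; exact hex)]
  simp only [vtx, RST.pos_ofPos, zt_sw_trans, zeta_comp_sw_start h hk]
  congr 1
  exact Subtype.ext he

theorem vtx_act_of_fall {t : RST lam n} {v : Fin (n + 1) → ℕ} {i k : Fin n}
    (h : v i.castSucc = v i.succ) (hk : std v i.castSucc = k.castSucc)
    (hex : ¬ IsRST ((sw k).trans t.pos)) :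
    (vtx q s t v).act i = vtx q s t v := by
  have h' : ¬ (vtx q s t v).ind i.succ ≠ (vtx q s t v).ind i.castSucc := not_not.mpr h.symm
  have he : (vtx q s t v).tab.exchange ((vtx q s t v).perm i.castSucc) ((vtx q s t v).perm i.succ)
      = (sw k).trans t.pos := by
    simp only [vtx, hk, std_succ_of_eq h hk]
    rfl
  rw [Tuple4.act, if_neg h', dif_neg (by rw [he]; exact hex)]

theorem vtx_psi (t : RST lam n) (v : Fin (n + 1) → ℕ) :
    (vtx q s t v).psi q = vtx q s t (psiInd v) := by
  have hl : 0 < psiInd v (Fin.last n) := by simp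
  have h : (Fin.snoc (α := fun _ => K) (fun j : Fin n => zeta q (zt s t.pos) v j.succ)
      (q * zeta q (zt s t.pos) v 0) : Fin (n + 1) → K) = zeta q (zt s t.pos) (psiInd v) := by
    funext j
    induction j using Fin.lastCases with
    | last => rw [Fin.snoc_last, zeta_pd_zero hl, pd_psiInd]
    | cast j => rw [Fin.snoc_castSucc, ← zeta_pd_succ hl, pd_psiInd]
  simp only [Tuple4.psi, vtx, h, std_psiInd]
  rfl

theorem std_zero : std (0 : Fin (n + 1) → ℕ) = 1 := std_of_antitone (fun _ _ _ => le_rfl)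

theorem rootTuple_eq (q s : K) (hlam : lam.card = n + 1) :
    rootTuple s hlam = vtx q s (rootTab hlam) 0 := by
  have h : (fun i => s ^ (rootTab hlam).ct i) = zeta q (zt s (rootTab hlam).pos) 0 := by
    funext i
    simp only [zeta, std_zero, Pi.zero_apply, pow_zero, one_mul, Equiv.Perm.one_apply, zt]
    rfl
  simp only [rootTuple, vtx, h, std_zero]
  rfl

theorem hasArrow_vtx_iff (t : RST lam n) {v : Fin (n + 1) → ℕ} {i : Fin n} :
    (vtx q s t v).HasArrow i ↔ v i.castSucc < v i.succ ∨ ∃ k : Fin n,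
      v i.castSucc = v i.succ ∧ std v i.castSucc = k.castSucc ∧
      (t.pos k.castSucc).1.1 < (t.pos k.succ).1.1 ∧
      (t.pos k.succ).1.2 < (t.pos k.castSucc).1.2 := by
  unfold Tuple4.HasArrow
  refine or_congr Iff.rfl ?_
  constructor
  · rintro ⟨h1, -, h3⟩
    obtain ⟨k, hk, hk'⟩ := exists_std_eq (show v i.castSucc = v i.succ from h1)
    refine ⟨k, h1, hk, ?_⟩
    have h3' : cc (t.pos (std v i.succ)) + 2 ≤ cc (t.pos (std v i.castSucc)) := h3
    rw [hk, hk'] at h3'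
    have := t.isRST.neighbours k
    unfold cc at h3'
    omega
  · rintro ⟨k, h1, hk, h2, h3⟩
    have hk' := std_succ_of_eq h1 hk
    refine ⟨h1, ?_, ?_⟩
    · have := t.isRST.exchange (k := k) h2.ne h3.ne'
      show IsRST ((Equiv.swap (std v i.castSucc) (std v i.succ)).trans t.pos)
      rw [hk, hk']
      exact this
    · show cc (t.pos (std v i.succ)) + 2 ≤ cc (t.pos (std v i.castSucc))
      rw [hk, hk']
      unfold cc
      omega

/-- The polynomial of the tableau `t` and the composition `v`. -/
noncomputable def vpoly (q s : K) (t : RST lam n) (v : Fin (n + 1) → ℕ) : VPoly K lam n :=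
  fillPoly q s t.pos v

theorem beta_of_row_lt {A B : Cell lam} (h1 : A.1.1 < B.1.1) (h2 : B.1.2 < A.1.2) :
    beta s A B = 1 := by
  rw [beta, if_neg (by omega), if_pos h1]

theorem YBPath.poly_eq (I : MonomialIndep q s) {hlam : lam.card = n + 1} {x : Tuple4 K lam n}
    (p : YBPath q s hlam x) : ∃ t v, x = vtx q s t v ∧ p.poly = vpoly q s t v := by
  induction p with
  | nil =>
    refine ⟨rootTab hlam, 0, rootTuple_eq q s hlam, ?_⟩
    rw [vpoly, fillPoly_zero I, ev_pos]
    rfl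
  | step p i h ih =>
    obtain ⟨t, v, rfl, hp⟩ := ih
    have hpoly : (YBPath.step p i h).poly = bT s i p.poly
      + cf s (zeta q (zt s t.pos) v i.castSucc) (zeta q (zt s t.pos) v i.succ) • p.poly := rfl
    rw [hpoly, hp]
    rcases (hasArrow_vtx_iff t).mp h with h1 | ⟨k, h1, hk, h2, h3⟩
    · exact ⟨t, v ∘ sw i, vtx_act_of_ne t h1.ne, (fillPoly_up I t.pos h1).symm⟩
    · refine ⟨RST.ofPos _ (t.isRST.exchange h2.ne h3.ne'), v, vtx_act_of_eq h1 hk _, ?_⟩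
      rw [vpoly, fillPoly_equal I t.isRST h1 hk, beta_of_row_lt h2 h3, one_smul, vpoly,
        RST.pos_ofPos]
  | affine p ih =>
    obtain ⟨t, v, rfl, hp⟩ := ih
    refine ⟨t, psiInd v, vtx_psi t v, ?_⟩
    rw [vpoly, fillPoly_psi I, ← vpoly, ← hp]
    rfl

theorem IsVertex.exists_vtx (I : MonomialIndep q s) {hlam : lam.card = n + 1} {x : Tuple4 K lam n}
    (h : IsVertex q s hlam x) : ∃ t v, x = vtx q s t v := by
  obtain ⟨p⟩ := h
  obtain ⟨t, v, h, -⟩ := p.poly_eq I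
  exact ⟨t, v, h⟩

theorem macdonald_vtx (I : MonomialIndep q s) {hlam : lam.card = n + 1} {t : RST lam n}
    {v : Fin (n + 1) → ℕ} (h : IsVertex q s hlam (vtx q s t v)) :
    macdonald q s hlam (vtx q s t v) = vpoly q s t v := by
  rw [macdonald, dif_pos h]
  obtain ⟨t', v', h1, h2⟩ := (Classical.choice h).poly_eq I
  obtain ⟨rfl, rfl⟩ := vtx_inj h1
  exact h2

end Vertices

/-! ### Descent to the root -/

section Descent

variable {K : Type*} [Field K] {lam : YoungDiagram} {n : ℕ} {q s : K}

theorem decr_std (v : Fin (n + 1) → ℕ) (i : Fin (n + 1)) : decr v (std v i) = v i := by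
  have h1 : Monotone (v ∘ (Fin.revPerm.trans (std v)⁻¹)) := by
    intro a b hab
    by_contra hc
    have hc' : v ((std v)⁻¹ b.rev) < v ((std v)⁻¹ a.rev) := not_le.mp hc
    have h := (isStd_std v ((std v)⁻¹ a.rev) ((std v)⁻¹ b.rev)).mpr (Or.inl hc')
    rw [← Equiv.Perm.mul_apply, ← Equiv.Perm.mul_apply, mul_inv_cancel] at h
    simp only [Equiv.Perm.one_apply, Fin.rev_lt_rev] at h
    exact absurd hab (not_le.mpr h)
  have h2 := congrFun (Tuple.unique_monotone (Tuple.monotone_sort v) h1) (std v i).rev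
  simpa [decr] using h2

theorem decr_comp_perm (v : Fin (n + 1) → ℕ) (p : Equiv.Perm (Fin (n + 1))) :
    decr (v ∘ p) = decr v := by
  have h : (v ∘ p) ∘ Tuple.sort (v ∘ p) = v ∘ Tuple.sort v := by
    have := Tuple.unique_monotone (f := v) (σ := (Tuple.sort (v ∘ p)).trans p)
      (τ := Tuple.sort v) (Tuple.monotone_sort (v ∘ p)) (Tuple.monotone_sort v)
    exact this
  funext i
  exact congrFun h i.rev

theorem decr_antitone (v : Fin (n + 1) → ℕ) : Antitone (decr v) := fun _ _ h =>
  Tuple.monotone_sort v (Fin.rev_le_rev.mpr h)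

theorem fill_pos (t : RST lam n) (v : Fin (n + 1) → ℕ) (k : Fin (n + 1)) :
    fill t v (t.pos k) = decr v k := by
  show decr v (t.pos.symm (t.pos k)) = _
  rw [Equiv.symm_apply_apply]

/-- Two fillings of the same values: equality can be tested on the entries of a tableau. -/
theorem fill_eq_iff {t : RST lam n} {v : Fin (n + 1) → ℕ} {F : Filling lam} :
    fill t v = F ↔ ∀ k, decr v k = F (t.pos k) := by
  constructor
  · rintro rfl k
    rw [fill_pos]
  · intro h
    funext c
    obtain ⟨k, rfl⟩ := t.pos.surjective c
    rw [fill_pos, h]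

theorem fill_exchange {t t' : RST lam n} {v : Fin (n + 1) → ℕ} {i k : Fin n}
    (h : v i.castSucc = v i.succ) (hk : std v i.castSucc = k.castSucc)
    (ht : t'.pos = (sw k).trans t.pos) : fill t' v = fill t v := by
  rw [fill_eq_iff, ht]
  intro j
  show decr v j = fill t v (t.pos (sw k j))
  rw [fill_pos]
  have h1 : decr v k.castSucc = decr v k.succ := by
    rw [← hk, ← std_succ_of_eq h hk, decr_std, decr_std, h]
  rcases eq_or_ne j k.castSucc with rfl | hj
  · rw [sw, Equiv.swap_apply_left, h1]
  rcases eq_or_ne j k.succ with rfl | hj'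
  · rw [sw, Equiv.swap_apply_right, h1]
  · rw [sw, Equiv.swap_apply_of_ne_of_ne hj hj']

/-- The order in which the cells of a filling are numbered, backwards, in the root of its
component: by value, then by column, then by row. -/
def key (F : Filling lam) (c : Cell lam) : ℕ ×ₗ ℕ ×ₗ ℕ := toLex (F c, toLex (c.1.2, c.1.1))

theorem key_lt_iff {F : Filling lam} {c d : Cell lam} : key F c < key F d ↔
    F c < F d ∨ F c = F d ∧ (c.1.2 < d.1.2 ∨ c.1.2 = d.1.2 ∧ c.1.1 < d.1.1) := by
  simp only [key, Prod.Lex.toLex_lt_toLex]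

theorem equiv_eq_of_strictAnti {A κ : Type*} [LinearOrder κ] {m : ℕ} (g : A → κ)
    {e e' : Fin m ≃ A} (h : StrictAnti (g ∘ e)) (h' : StrictAnti (g ∘ e')) : e = e' := by
  have : (e.trans e'.symm : Equiv.Perm (Fin m)) = 1 := by
    apply perm_eq_one_of_strictMono
    intro a b hab
    have h1 := h hab
    rw [← h'.lt_iff_gt]
    simpa using h1
  ext1 x
  have h2 := DFunLike.congr_fun this x
  simp only [Equiv.trans_apply, Equiv.Perm.one_apply] at h2
  rw [← h2, Equiv.apply_symm_apply, h2]

/-- The potential that increases along the arrows that are not affine. -/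
def potential (t : RST lam n) (v : Fin (n + 1) → ℕ) : ℕ :=
  ∑ i, (n - i.1) * v i + ∑ k, (n - k.1) * (t.pos k).1.1

/-- A vertex is the target of an arrow that is not affine, unless its composition is increasing and
its tableau numbers the cells by decreasing key. -/
theorem exists_arrow_or_sorted (q s : K) (t : RST lam n) (v : Fin (n + 1) → ℕ) :
    (∃ t' v' i, (vtx q s t' v').HasArrow i ∧ (vtx q s t' v').act i = vtx q s t v ∧
      fill t' v' = fill t v ∧ ∑ j, v' j = ∑ j, v j ∧ potential t' v' < potential t v) ∨
    (Monotone v ∧ StrictAnti (key (fill t v) ∘ t.pos)) := by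
  by_cases h1 : ∃ i : Fin n, v i.succ < v i.castSucc
  · obtain ⟨i, hi⟩ := h1
    left
    refine ⟨t, v ∘ sw i, i, ?_, ?_, ?_, sum_comp_sw v i, ?_⟩
    · rw [hasArrow_vtx_iff, comp_sw_castSucc, comp_sw_succ]
      exact Or.inl hi
    · rw [vtx_act_of_ne, comp_sw_sw]
      rw [comp_sw_castSucc, comp_sw_succ]
      exact hi.ne
    · unfold fill
      rw [decr_comp_perm]
    · have := sum_weight_comp_sw v i
      unfold potential
      omega
  have hv : Monotone v := by
    rw [Fin.monotone_iff_le_succ]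
    intro i
    exact not_lt.mp fun h => h1 ⟨i, h⟩
  by_cases h2 : ∃ i k : Fin n, v i.castSucc = v i.succ ∧ std v i.castSucc = k.castSucc ∧
      (t.pos k.succ).1.1 < (t.pos k.castSucc).1.1 ∧ (t.pos k.castSucc).1.2 < (t.pos k.succ).1.2
  · obtain ⟨i, k, h, hk, hr, hc⟩ := h2
    have hex := t.isRST.exchange hr.ne' hc.ne
    left
    refine ⟨RST.ofPos _ hex, v, i, ?_, ?_, fill_exchange h hk rfl, rfl, ?_⟩
    · rw [hasArrow_vtx_iff]
      refine Or.inr ⟨k, h, hk, ?_⟩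
      rw [RST.pos_ofPos, sw_trans_castSucc, sw_trans_succ]
      exact ⟨hr, hc⟩
    · have hback : (sw k).trans (RST.ofPos _ hex).pos = t.pos := sw_trans_sw_trans t.pos k
      rw [vtx_act_of_eq h hk (by rw [hback]; exact t.isRST)]
      congr 1
      exact RST.pos_injective hback
    · have := sum_weight_comp_sw (fun j => (t.pos j).1.1) k
      have h3 : ∑ j, (n - j.1) * ((RST.ofPos _ hex).pos j).1.1
          = ∑ j, (n - j.1) * ((fun j => (t.pos j).1.1) ∘ sw k) j := rfl
      unfold potential
      omega
  right
  refine ⟨hv, ?_⟩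
  rw [Fin.strictAnti_iff_succ_lt]
  intro k
  simp only [Function.comp]
  rw [key_lt_iff, fill_pos, fill_pos]
  rcases (decr_antitone v (Fin.castSucc_lt_succ (i := k)).le).lt_or_eq with h | h
  · exact Or.inl h
  refine Or.inr ⟨h, ?_⟩
  -- equal values are at neighbouring positions, since `v` is increasing
  obtain ⟨p, hp⟩ := (std v).surjective k.castSucc
  obtain ⟨p', hp'⟩ := (std v).surjective k.succ
  have hvp : v p = v p' := by rw [← decr_std v p, ← decr_std v p', hp, hp', h]
  have hpp : p < p' := by
    have : std v p < std v p' := by rw [hp, hp']; exact Fin.castSucc_lt_succ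
    rw [isStd_std] at this
    omega
  have hadj : p'.1 = p.1 + 1 := by
    by_contra hne
    have hlt : p.1 + 1 < p'.1 := by
      have : p.1 < p'.1 := hpp
      omega
    let m : Fin (n + 1) := ⟨p.1 + 1, by omega⟩
    have hm1 : p < m := by rw [Fin.lt_def]; simp [m]
    have hm2 : m < p' := by rw [Fin.lt_def]; exact hlt
    have e1 : v p = v m := le_antisymm (hv hm1.le) (by rw [hvp]; exact hv hm2.le)
    have l1 := (isStd_std v p m).mpr (Or.inr ⟨e1, hm1⟩)
    have l2 := (isStd_std v m p').mpr (Or.inr ⟨e1.symm.trans hvp, hm2⟩)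
    rw [hp] at l1
    rw [hp'] at l2
    simp only [Fin.lt_def, Fin.val_castSucc, Fin.val_succ] at l1 l2
    omega
  obtain ⟨i, hi, hi'⟩ : ∃ i : Fin n, i.castSucc = p ∧ i.succ = p' :=
    ⟨⟨p.1, by omega⟩, by ext; simp, by ext; simp [hadj]⟩
  have hns : ¬ ((t.pos k.succ).1.1 < (t.pos k.castSucc).1.1 ∧
      (t.pos k.castSucc).1.2 < (t.pos k.succ).1.2) := fun hh =>
    h2 ⟨i, k, by rw [hi, hi', hvp], by rw [hi, hp], hh⟩
  have := t.isRST.neighbours k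
  omega

theorem rootTab_strictAnti (hlam : lam.card = n + 1) (F : Filling lam) (hF : ∀ c d, F c = F d) :
    StrictAnti (key F ∘ (rootTab hlam).pos) := by
  intro a b hab
  simp only [Function.comp]
  rw [key_lt_iff]
  refine Or.inr ⟨hF _ _, ?_⟩
  have h1 : columnReading hlam b.rev < columnReading hlam a.rev := by
    rw [(columnReading hlam).lt_iff_lt, Fin.rev_lt_rev]
    exact hab
  exact Prod.Lex.lt_iff.mp h1

theorem fill_zero_const (t : RST lam n) (c d : Cell lam) : fill t 0 c = fill t 0 d := rfl

theorem isVertex_vtx (q s : K) (hlam : lam.card = n + 1) (t : RST lam n) (v : Fin (n + 1) → ℕ) :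
    IsVertex q s hlam (vtx q s t v) := by
  induction hd : ∑ j, v j using Nat.strong_induction_on generalizing t v with
  | _ d ihd =>
  induction hm : potential t v using Nat.strong_induction_on generalizing t v with
  | _ m ihm =>
  rcases exists_arrow_or_sorted q s t v with ⟨t', v', i, h1, h2, -, h4, h5⟩ | ⟨hv, ht⟩
  · obtain ⟨p⟩ := ihm _ (hm ▸ h5) t' v' (by rw [h4, hd]) rfl
    exact ⟨h2 ▸ YBPath.step p i h1⟩
  · rcases Nat.eq_zero_or_pos (v (Fin.last n)) with h0 | h0
    · have hv0 : v = 0 := by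
        funext j
        have := hv (Fin.le_last j)
        exact Nat.le_zero.mp (h0 ▸ this)
      subst hv0
      have : t = rootTab hlam := RST.pos_injective
        (equiv_eq_of_strictAnti _ ht (rootTab_strictAnti hlam _ (fill_zero_const t)))
      rw [this, ← rootTuple_eq]
      exact ⟨YBPath.nil⟩
    · have hs := sum_psiInd (pd v)
      rw [psiInd_pd h0] at hs
      obtain ⟨p⟩ := ihd _ (by omega) t (pd v) rfl
      have := YBPath.affine p
      rw [vtx_psi, psiInd_pd h0] at this
      exact ⟨this⟩

theorem isVertex_iff (I : MonomialIndep q s) (hlam : lam.card = n + 1) (x : Tuple4 K lam n) :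
    IsVertex q s hlam x ↔ ∃ t v, x = vtx q s t v :=
  ⟨fun h => h.exists_vtx I, fun ⟨t, v, h⟩ => h ▸ isVertex_vtx q s hlam t v⟩

theorem macdonald_eq (I : MonomialIndep q s) (hlam : lam.card = n + 1) (t : RST lam n)
    (v : Fin (n + 1) → ℕ) : macdonald q s hlam (vtx q s t v) = vpoly q s t v :=
  macdonald_vtx I (isVertex_vtx q s hlam t v)

end Descent

/-! ### The action of the generators on the Macdonald polynomials -/

section Action

variable {K : Type*} [Field K] {lam : YoungDiagram} {n : ℕ} {q s : K}

/-- The coefficient of the Yang-Baxter move number `i` at the vertex `x`. -/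
def xcf (s : K) (x : Tuple4 K lam n) (i : Fin n) : K :=
  cf s (x.spec i.castSucc) (x.spec i.succ)

theorem xcf_vtx_of_eq (I : MonomialIndep q s) (t : RST lam n) {v : Fin (n + 1) → ℕ} {i k : Fin n}
    (h : v i.castSucc = v i.succ) (hk : std v i.castSucc = k.castSucc) :
    xcf s (vtx q s t v) i = gam s (t.pos k.castSucc) (t.pos k.succ) := by
  show cf s (zeta q (zt s t.pos) v i.castSucc) (zeta q (zt s t.pos) v i.succ) = _
  rw [zeta, zeta, hk, std_succ_of_eq h hk, h, cf_mul (pow_ne_zero _ I.q_ne)]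
  rfl

theorem fillPoly_down (I : MonomialIndep q s) (e : Fin (n + 1) ≃ Cell lam)
    {v : Fin (n + 1) → ℕ} {i : Fin n} (h : v i.succ < v i.castSucc) {a b : K}
    (ha : zeta q (zt s e) v i.castSucc = a) (hb : zeta q (zt s e) v i.succ = b) :
    bT s i (fillPoly q s e v) = -cf s a b • fillPoly q s e v
      + ((1 - cf s a b) * (s + cf s a b)) • fillPoly q s e (v ∘ sw i) := by
  have G := I.generic (q := q) e
  have ha0 : a ≠ 0 := ha ▸ G.zeta_ne_zero v _
  have hb0 : b ≠ 0 := hb ▸ G.zeta_ne_zero v _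
  have hab : a ≠ b := ha ▸ hb ▸ G.zeta_ne h.ne'
  have h1 : fillPoly q s e v
      = Y s (fun i => (bT s i : Module.End K (VPoly K lam n))) i b a (fillPoly q s e (v ∘ sw i)) :=
    ha ▸ hb ▸ yb_down I.hecke G h
  have h2 := I.hecke.T_Y i hb0 ha0 hab.symm (fillPoly q s e (v ∘ sw i))
  rw [← h1] at h2
  rw [h2, eq_sub_of_add_eq (cf_add_cf (s := s) hb0 ha0 hab.symm)]
  congr 2
  ring

theorem bT_vpoly_of_eq (I : MonomialIndep q s) (t : RST lam n) {v : Fin (n + 1) → ℕ} {i k : Fin n}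
    (h : v i.castSucc = v i.succ) (hk : std v i.castSucc = k.castSucc) :
    bT s i (vpoly q s t v) = -xcf s (vtx q s t v) i • vpoly q s t v
      + beta s (t.pos k.castSucc) (t.pos k.succ) • fillPoly q s ((sw k).trans t.pos) v := by
  rw [← fillPoly_equal I t.isRST h hk, vpoly, xcf, vtx]
  module

/-- At a fall between two entries of the same column, the generator acts by `-1`. -/
theorem bT_vpoly_of_col (I : MonomialIndep q s) (t : RST lam n) {v : Fin (n + 1) → ℕ} {i k : Fin n}
    (h : v i.castSucc = v i.succ) (hk : std v i.castSucc = k.castSucc)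
    (hc : (t.pos k.castSucc).1.2 = (t.pos k.succ).1.2) :
    bT s i (vpoly q s t v) = -vpoly q s t v := by
  have := t.isRST.neighbours k
  rw [bT_vpoly_of_eq I t h hk, beta, if_pos (Or.inr hc), xcf_vtx_of_eq I t h hk,
    gam_of_col I.s_ne I.zpow_ne_one (by unfold cc; omega)]
  module

/-- The four kinds of moves at a vertex: along an arrow, against an arrow, and the two kinds of
falls, where the generator acts by `s` or by `-1`. -/
theorem vertex_cases (I : MonomialIndep q s) (t : RST lam n) (v : Fin (n + 1) → ℕ) (i : Fin n) :
    ∃ t' v', (vtx q s t v).act i = vtx q s t' v' ∧ (vtx q s t' v').act i = vtx q s t v ∧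
      fill t' v' = fill t v ∧ ∑ j, v' j = ∑ j, v j ∧
    (((vtx q s t v).HasArrow i ∧ ¬ (vtx q s t' v').HasArrow i ∧
      bT s i (vpoly q s t v) = -xcf s (vtx q s t v) i • vpoly q s t v + vpoly q s t' v') ∨
    ((vtx q s t' v').HasArrow i ∧ ¬ (vtx q s t v).HasArrow i ∧
      bT s i (vpoly q s t v) = -xcf s (vtx q s t v) i • vpoly q s t v +
        ((1 - xcf s (vtx q s t v) i) * (s + xcf s (vtx q s t v) i)) • vpoly q s t' v') ∨
    (t' = t ∧ v' = v ∧ ¬ (vtx q s t v).HasArrow i ∧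
      bT s i (vpoly q s t v) = s • vpoly q s t v) ∨
    (t' = t ∧ v' = v ∧ ¬ (vtx q s t v).HasArrow i ∧ ¬ ColumnStrict (fill t v) ∧
      bT s i (vpoly q s t v) = -vpoly q s t v)) := by
  rcases lt_trichotomy (v i.castSucc) (v i.succ) with h | h | h
  · refine ⟨t, v ∘ sw i, vtx_act_of_ne t h.ne, ?_, ?_, sum_comp_sw v i, Or.inl ⟨?_, ?_, ?_⟩⟩
    · rw [vtx_act_of_ne, comp_sw_sw]
      rw [comp_sw_castSucc, comp_sw_succ]
      exact h.ne'
    · unfold fill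
      rw [decr_comp_perm]
    · rw [hasArrow_vtx_iff]
      exact Or.inl h
    · rw [hasArrow_vtx_iff, comp_sw_castSucc, comp_sw_succ]
      rintro (h' | ⟨k, h', -⟩) <;> omega
    · have : vpoly q s t (v ∘ sw i) = _ := fillPoly_up I t.pos h
      rw [this, vpoly, xcf, vtx]
      module
  · obtain ⟨k, hk, -⟩ := exists_std_eq h
    have hc := xcf_vtx_of_eq I t h hk
    have hP := bT_vpoly_of_eq I t h hk
    have hdecr : decr v k.castSucc = decr v k.succ := by
      rw [← hk, ← std_succ_of_eq h hk, decr_std, decr_std, h]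
    have huniq : ∀ k' : Fin n, std v i.castSucc = k'.castSucc → k' = k := fun k' hk' =>
      Fin.castSucc_injective _ (hk'.symm.trans hk)
    have hback : (sw k).trans ((sw k).trans t.pos) = t.pos := sw_trans_sw_trans t.pos k
    rcases t.isRST.neighbours k with ⟨h1, h2⟩ | ⟨h1, h2⟩ | ⟨h1, h2⟩ | ⟨h1, h2⟩
    · have hact : (vtx q s t v).act i = vtx q s t v :=
        vtx_act_of_fall h hk (not_isRST_exchange t.isRST (Or.inl h1))
      refine ⟨t, v, hact, hact, rfl, rfl, Or.inr (Or.inr (Or.inl ⟨rfl, rfl, ?_, ?_⟩))⟩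
      · rw [hasArrow_vtx_iff]
        rintro (h' | ⟨k', -, hk', h3, -⟩)
        · omega
        · rw [huniq k' hk'] at h3
          omega
      · rw [hP, beta, if_pos (Or.inl h1), hc,
          gam_of_row I.s_ne I.zpow_ne_one (by unfold cc; omega)]
        module
    · have hact : (vtx q s t v).act i = vtx q s t v :=
        vtx_act_of_fall h hk (not_isRST_exchange t.isRST (Or.inr h1))
      refine ⟨t, v, hact, hact, rfl, rfl, Or.inr (Or.inr (Or.inr ⟨rfl, rfl, ?_, ?_, ?_⟩))⟩
      · rw [hasArrow_vtx_iff]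
        rintro (h' | ⟨k', -, hk', h3, -⟩)
        · omega
        · rw [huniq k' hk'] at h3
          omega
      · intro hcs
        have := hcs (t.pos k.succ) (t.pos k.castSucc) h1.symm (by omega)
        rw [fill_pos, fill_pos] at this
        omega
      · exact bT_vpoly_of_col I t h hk h1
    · have hex := t.isRST.exchange h1.ne' h2.ne
      have hback' : (sw k).trans (RST.ofPos _ hex).pos = t.pos := hback
      refine ⟨RST.ofPos _ hex, v, vtx_act_of_eq h hk hex, ?_, fill_exchange h hk rfl, rfl,
        Or.inr (Or.inl ⟨?_, ?_, ?_⟩)⟩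
      · rw [vtx_act_of_eq h hk (by rw [hback']; exact t.isRST)]
        congr 1
        exact RST.pos_injective hback
      · rw [hasArrow_vtx_iff]
        refine Or.inr ⟨k, h, hk, ?_⟩
        rw [RST.pos_ofPos, sw_trans_castSucc, sw_trans_succ]
        exact ⟨h1, h2⟩
      · rw [hasArrow_vtx_iff]
        rintro (h' | ⟨k', -, hk', h3, -⟩)
        · omega
        · rw [huniq k' hk'] at h3
          omega
      · have hb := beta_mul_beta I.s_ne I.zpow_ne_one t.isRST k
        rw [beta_of_row_lt h1 h2, mul_one] at hb
        rw [hP, hb, hc]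
        rfl
    · have hex := t.isRST.exchange h1.ne h2.ne'
      have hback' : (sw k).trans (RST.ofPos _ hex).pos = t.pos := hback
      refine ⟨RST.ofPos _ hex, v, vtx_act_of_eq h hk hex, ?_, fill_exchange h hk rfl, rfl,
        Or.inl ⟨?_, ?_, ?_⟩⟩
      · rw [vtx_act_of_eq h hk (by rw [hback']; exact t.isRST)]
        congr 1
        exact RST.pos_injective hback
      · rw [hasArrow_vtx_iff]
        exact Or.inr ⟨k, h, hk, h1, h2⟩
      · rw [hasArrow_vtx_iff]
        rintro (h' | ⟨k', -, hk', h3, -⟩)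
        · omega
        · rw [huniq k' hk', RST.pos_ofPos, sw_trans_castSucc, sw_trans_succ] at h3
          omega
      · rw [hP, beta_of_row_lt h1 h2, one_smul]
        rfl
  · refine ⟨t, v ∘ sw i, vtx_act_of_ne t h.ne', ?_, ?_, sum_comp_sw v i,
      Or.inr (Or.inl ⟨?_, ?_, ?_⟩)⟩
    · rw [vtx_act_of_ne, comp_sw_sw]
      rw [comp_sw_castSucc, comp_sw_succ]
      exact h.ne
    · unfold fill
      rw [decr_comp_perm]
    · rw [hasArrow_vtx_iff, comp_sw_castSucc, comp_sw_succ]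
      exact Or.inl h
    · rw [hasArrow_vtx_iff]
      rintro (h' | ⟨k, h', -⟩) <;> omega
    · exact fillPoly_down I t.pos h rfl rfl

end Action

/-! ### Linear independence -/

section Independence

variable {K : Type*} [Field K] {lam : YoungDiagram} {n : ℕ} {q s : K}

/-- The span of the Macdonald polynomials of degree `d`. -/
noncomputable def degSpan (q s : K) (lam : YoungDiagram) (n d : ℕ) : Submodule K (VPoly K lam n) :=
  Submodule.span K {f | ∃ (t : RST lam n) (v : Fin (n + 1) → ℕ), ∑ j, v j = d ∧ f = vpoly q s t v}

theorem vpoly_mem_degSpan (t : RST lam n) (v : Fin (n + 1) → ℕ) {d : ℕ} (h : ∑ j, v j = d) :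
    vpoly q s t v ∈ degSpan q s lam n d :=
  Submodule.subset_span ⟨t, v, h, rfl⟩

theorem bT_mem_degSpan (I : MonomialIndep q s) {d : ℕ} {f : VPoly K lam n}
    (hf : f ∈ degSpan q s lam n d) (i : Fin n) : bT s i f ∈ degSpan q s lam n d := by
  induction hf using Submodule.span_induction with
  | mem f hf =>
    obtain ⟨t, v, hv, rfl⟩ := hf
    obtain ⟨t', v', -, -, -, hs, h⟩ := vertex_cases I t v i
    have m1 := vpoly_mem_degSpan (q := q) (s := s) t v hv
    have m2 := vpoly_mem_degSpan (q := q) (s := s) t' v' (hs.trans hv)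
    rcases h with ⟨-, -, h⟩ | ⟨-, -, h⟩ | ⟨-, -, -, h⟩ | ⟨-, -, -, -, h⟩ <;> rw [h]
    · exact add_mem (Submodule.smul_mem _ _ m1) m2
    · exact add_mem (Submodule.smul_mem _ _ m1) (Submodule.smul_mem _ _ m2)
    · exact Submodule.smul_mem _ _ m1
    · exact neg_mem m1
  | zero => rw [map_zero]; exact zero_mem _
  | add f g _ _ hf hg => rw [map_add]; exact add_mem hf hg
  | smul c f _ hf => rw [map_smul]; exact Submodule.smul_mem _ _ hf

theorem bTinv_mem_degSpan (I : MonomialIndep q s) {d : ℕ} {f : VPoly K lam n}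
    (hf : f ∈ degSpan q s lam n d) (i : Fin n) : bTinv s i f ∈ degSpan q s lam n d :=
  Submodule.smul_mem _ _ (add_mem (bT_mem_degSpan I hf i) (Submodule.smul_mem _ _ hf))

theorem bPhi_mem_degSpan (I : MonomialIndep q s) {d : ℕ} {f : VPoly K lam n}
    (hf : f ∈ degSpan q s lam n d) : bPhi s f ∈ degSpan q s lam n (d + 1) := by
  induction hf using Submodule.span_induction with
  | mem f hf =>
    obtain ⟨t, v, hv, rfl⟩ := hf
    rw [vpoly, ← fillPoly_psi I]
    exact vpoly_mem_degSpan t _ (by rw [sum_psiInd, hv])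
  | zero => rw [map_zero]; exact zero_mem _
  | add f g _ _ hf hg => rw [map_add]; exact add_mem hf hg
  | smul c f _ hf => rw [map_smul]; exact Submodule.smul_mem _ _ hf

theorem exists_descProd_eq (I : MonomialIndep q s) {d m : ℕ} (hm : m ≤ n) {f : VPoly K lam n}
    (hf : f ∈ degSpan q s lam n d) : ∃ g ∈ degSpan q s lam n d,
      descProd (extOne fun i => (bTinv s i : Module.End K (VPoly K lam n))) m g = f := by
  induction m generalizing f with
  | zero => exact ⟨f, hf, rfl⟩
  | succ m ih =>
    obtain ⟨g, hg, h⟩ := ih (by omega) (bT_mem_degSpan I hf ⟨m, hm⟩)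
    refine ⟨g, hg, ?_⟩
    rw [descProd, Module.End.mul_apply, h, extOne_of_lt _ (by omega : m < n),
      ← Module.End.mul_apply, bTinv_mul_bT I.s_ne I.zpow_ne_one, Module.End.one_apply]

theorem bX_mem_degSpan (I : MonomialIndep q s) (k : Fin (n + 1)) {d : ℕ} {f : VPoly K lam n}
    (hf : f ∈ degSpan q s lam n d) : bX lam K k f ∈ degSpan q s lam n (d + 1) := by
  induction k using Fin.reverseInduction generalizing f with
  | last =>
    obtain ⟨g, hg, rfl⟩ := exists_descProd_eq I le_rfl hf
    rw [← Module.End.mul_apply, ← bPhi_eq]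
    exact bPhi_mem_degSpan I hg
  | cast i ih =>
    have h1 := ih (bTinv_mem_degSpan I hf i)
    have h2 := Submodule.smul_mem _ s (bTinv_mem_degSpan I h1 i)
    have h3 : (bX lam K i.castSucc : Module.End K (VPoly K lam n))
        = s • (bTinv s i * bX lam K i.succ * bTinv s i) := by
      have hx := bT_bX_bT (lam := lam) I.s_ne I.zpow_ne_one i
      have e1 := bTinv_mul_bT (lam := lam) I.s_ne I.zpow_ne_one i
      have e2 := bT_mul_bTinv (lam := lam) I.s_ne I.zpow_ne_one i
      calc (bX lam K i.castSucc : Module.End K (VPoly K lam n))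
          = (bTinv s i * bT s i) * bX lam K i.castSucc * (bT s i * bTinv s i) := by
            rw [e1, e2, one_mul, mul_one]
        _ = bTinv s i * (bT s i * bX lam K i.castSucc * bT s i) * bTinv s i := by
            simp only [mul_assoc]
        _ = s • (bTinv s i * bX lam K i.succ * bTinv s i) := by
            rw [hx, mul_smul_comm, smul_mul_assoc]
    rw [h3]
    exact h2

theorem monomial_tmul_mem_degSpan (I : MonomialIndep q s) (t : RST lam n) (d : ℕ) :
    ∀ m : Fin (n + 1) →₀ ℕ, ∑ j, m j = d →
      MvPolynomial.monomial m (1 : K) ⊗ₜ[K] Finsupp.single t 1 ∈ degSpan q s lam n d := by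
  induction d with
  | zero =>
    intro m hm
    have : m = 0 := by
      ext j
      exact (Finset.sum_eq_zero_iff.mp hm) j (Finset.mem_univ j)
    subst this
    have h := vpoly_mem_degSpan (q := q) (s := s) t 0 (by simp : ∑ j, (0 : Fin (n + 1) → ℕ) j = 0)
    rw [vpoly, fillPoly_zero I, ev_pos] at h
    simpa using h
  | succ d ih =>
    intro m hm
    obtain ⟨k, hk⟩ : ∃ k, m k ≠ 0 := by
      by_contra hc
      push Not at hc
      rw [Finset.sum_eq_zero (fun j _ => hc j)] at hm
      omega
    have hle : Finsupp.single k 1 ≤ m := by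
      rw [Finsupp.single_le_iff]
      omega
    obtain ⟨m', rfl⟩ := exists_add_of_le hle
    have hs : ∑ j, m' j = d := by
      simp only [Finsupp.add_apply, Finset.sum_add_distrib] at hm
      rw [← Finsupp.sum_fintype (Finsupp.single k 1) (fun _ b => b) (fun _ => rfl),
        Finsupp.sum_single_index rfl] at hm
      omega
    have h := bX_mem_degSpan I k (ih m' hs)
    have e : bX lam K k (MvPolynomial.monomial m' (1 : K) ⊗ₜ[K] Finsupp.single t 1)
        = MvPolynomial.monomial (Finsupp.single k 1 + m') (1 : K) ⊗ₜ[K] Finsupp.single t 1 := by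
      rw [bX, TensorProduct.map_tmul, mulX, LinearMap.mulLeft_apply, MvPolynomial.X,
        MvPolynomial.monomial_mul, one_mul]
      rfl
    rwa [e] at h

instance : Finite (RST lam n) := by
  unfold RST
  infer_instance

theorem finite_degree (lam : YoungDiagram) (n d : ℕ) :
    Finite {p : RST lam n × (Fin (n + 1) → ℕ) // ∑ j, p.2 j = d} := by
  have hlt : ∀ (p : {p : RST lam n × (Fin (n + 1) → ℕ) // ∑ j, p.2 j = d}) (i : Fin (n + 1)),
      p.1.2 i < d + 1 := fun p i => by
    have := Finset.single_le_sum (f := p.1.2) (fun _ _ => Nat.zero_le _) (Finset.mem_univ i)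
    have := p.2
    omega
  apply Finite.of_injective (fun p => ((p.1.1, fun i => ⟨p.1.2 i, hlt p i⟩) :
    RST lam n × (Fin (n + 1) → Fin (d + 1))))
  intro p p' h
  simp only [Prod.mk.injEq] at h
  refine Subtype.ext (Prod.ext h.1 (funext fun i => ?_))
  exact congrArg Fin.val (congrFun h.2 i)

/-- The Macdonald polynomials of a given degree are linearly independent: they span the vector
valued polynomials of that degree, and there are as many of them as monomials. -/
theorem linearIndependent_vpoly (I : MonomialIndep q s) (d : ℕ) :
    LinearIndependent K
      (fun p : {p : RST lam n × (Fin (n + 1) → ℕ) // ∑ j, p.2 j = d} =>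
        vpoly q s p.1.1 p.1.2) := by
  have := finite_degree lam n d
  have := Fintype.ofFinite {p : RST lam n × (Fin (n + 1) → ℕ) // ∑ j, p.2 j = d}
  let b := (MvPolynomial.basisMonomials (Fin (n + 1)) K).tensorProduct
    (Finsupp.basisSingleOne (ι := RST lam n) (R := K))
  let g : {p : RST lam n × (Fin (n + 1) → ℕ) // ∑ j, p.2 j = d} → VPoly K lam n :=
    fun p => b (Finsupp.equivFunOnFinite.symm p.1.2, p.1.1)
  have hg : LinearIndependent K g := by
    apply b.linearIndependent.comp
      (fun p : {p : RST lam n × (Fin (n + 1) → ℕ) // ∑ j, p.2 j = d} =>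
        (Finsupp.equivFunOnFinite.symm p.1.2, p.1.1))
    intro p p' h
    simp only [Prod.mk.injEq, EmbeddingLike.apply_eq_iff_eq] at h
    exact Subtype.ext (Prod.ext h.2 h.1)
  have hrange : (Set.range fun p : {p : RST lam n × (Fin (n + 1) → ℕ) // ∑ j, p.2 j = d} =>
      vpoly q s p.1.1 p.1.2)
      = {f | ∃ (t : RST lam n) (v : Fin (n + 1) → ℕ), ∑ j, v j = d ∧ f = vpoly q s t v} := by
    ext f
    constructor
    · rintro ⟨p, rfl⟩
      exact ⟨_, _, p.2, rfl⟩
    · rintro ⟨t, v, h, rfl⟩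
      exact ⟨⟨(t, v), h⟩, rfl⟩
  have hle : Submodule.span K (Set.range g) ≤ Submodule.span K (Set.range
      fun p : {p : RST lam n × (Fin (n + 1) → ℕ) // ∑ j, p.2 j = d} =>
        vpoly q s p.1.1 p.1.2) := by
    rw [hrange, Submodule.span_le]
    rintro _ ⟨p, rfl⟩
    have h := monomial_tmul_mem_degSpan I p.1.1 d (Finsupp.equivFunOnFinite.symm p.1.2) p.2
    have e : g p = MvPolynomial.monomial (Finsupp.equivFunOnFinite.symm p.1.2) (1 : K) ⊗ₜ[K]
        Finsupp.single p.1.1 1 := by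
      simp [g, b, Module.Basis.tensorProduct_apply]
    rw [e]
    exact h
  rw [linearIndependent_iff_card_le_finrank_span, Set.finrank]
  have : FiniteDimensional K (Submodule.span K (Set.range
      fun p : {p : RST lam n × (Fin (n + 1) → ℕ) // ∑ j, p.2 j = d} =>
        vpoly q s p.1.1 p.1.2)) := FiniteDimensional.span_of_finite K (Set.finite_range _)
  calc _ = Module.finrank K (Submodule.span K (Set.range g)) := (finrank_span_eq_card hg).symm
    _ ≤ _ := Submodule.finrank_mono hle

end Independence

/-! ### The order on monomials -/

section Order

variable {K : Type*} [Field K] {lam : YoungDiagram} {n : ℕ} {q s : K}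

/-- The ratio `(a - b) / (s a - b)`, the factor of the coefficients along an arrow. -/
def ratio (s a b : K) : K := (a - b) / (s * a - b)

/-- Spectral values that are comparable for `≻` avoid the poles and zeros of the coefficients. -/
theorem Succ.facts (I : MonomialIndep q s) {a b : K} (h : Succ q s b a) :
    a ≠ 0 ∧ b ≠ 0 ∧ a ≠ b ∧ s * a ≠ b ∧ ¬ Succ q s a b := by
  obtain ⟨x, y, x', y', rfl, rfl, h⟩ := h
  have hs : ∀ u w : ℤ, s * (q ^ u * s ^ w) = q ^ u * s ^ (w + 1) := fun u w => by
    rw [zpow_add₀ I.s_ne, zpow_one]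
    ring
  refine ⟨mul_ne_zero (zpow_ne_zero _ I.q_ne) (zpow_ne_zero _ I.s_ne),
    mul_ne_zero (zpow_ne_zero _ I.q_ne) (zpow_ne_zero _ I.s_ne), ?_, ?_, ?_⟩
  · intro h'
    have := I.eq_of _ _ _ _ h'
    omega
  · intro h'
    rw [hs] at h'
    have := I.eq_of _ _ _ _ h'
    omega
  · rintro ⟨z, w, z', w', h1, h2, h3⟩
    have := I.eq_of _ _ _ _ h1
    have := I.eq_of _ _ _ _ h2
    omega

theorem Succ.ratio_ne_zero (I : MonomialIndep q s) {a b : K} (h : Succ q s b a) :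
    ratio s a b ≠ 0 := by
  obtain ⟨-, -, h1, h2, -⟩ := h.facts I
  exact div_ne_zero (sub_ne_zero.mpr h1) (sub_ne_zero.mpr h2)

theorem Succ.one_sub_cf_mul_ratio (I : MonomialIndep q s) {a b : K} (h : Succ q s b a) :
    (1 - cf s a b) * ratio s a b = 1 := by
  obtain ⟨h0, -, h1, h2, -⟩ := h.facts I
  have e1 := sub_ne_zero.mpr h1
  have e2 := sub_ne_zero.mpr h2
  have e3 : 1 - b / a ≠ 0 := by
    rw [one_sub_div h0]
    exact div_ne_zero e1 h0
  rw [cf, ratio, one_sub_div h0]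
  field_simp
  ring

theorem succ_vtx_iff (I : MonomialIndep q s) (t : RST lam n) (v : Fin (n + 1) → ℕ)
    (j l : Fin (n + 1)) :
    Succ q s ((vtx q s t v).spec j) ((vtx q s t v).spec l) ↔
      v l < v j ∨ v l = v j ∧ cc (t.pos (std v j)) + 2 ≤ cc (t.pos (std v l)) := by
  have hz : ∀ j, (vtx q s t v).spec j = q ^ (v j : ℤ) * s ^ cc (t.pos (std v j)) := fun j => by
    rw [zpow_natCast]
    rfl
  constructor
  · rintro ⟨a, b, a', b', h1, h2, h3⟩
    rw [hz] at h1 h2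
    have := I.eq_of _ _ _ _ h1
    have := I.eq_of _ _ _ _ h2
    omega
  · intro h
    exact ⟨_, _, _, _, hz j, hz l, by omega⟩

/-- There is an arrow `s_i` exactly where the entries `i` and `i + 1` of the spectral vector are
increasing for the order on monomials. -/
theorem succ_iff_hasArrow (I : MonomialIndep q s) (t : RST lam n) (v : Fin (n + 1) → ℕ)
    (i : Fin n) :
    Succ q s ((vtx q s t v).spec i.succ) ((vtx q s t v).spec i.castSucc) ↔
      (vtx q s t v).HasArrow i := by
  rw [succ_vtx_iff I, hasArrow_vtx_iff]
  refine or_congr Iff.rfl ?_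
  constructor
  · rintro ⟨h1, h2⟩
    obtain ⟨k, hk, hk'⟩ := exists_std_eq h1
    refine ⟨k, h1, hk, ?_⟩
    rw [hk, hk'] at h2
    have := t.isRST.neighbours k
    unfold cc at h2
    omega
  · rintro ⟨k, h1, hk, h2, h3⟩
    refine ⟨h1, ?_⟩
    rw [hk, std_succ_of_eq h1 hk]
    unfold cc
    omega

theorem act_spec {K : Type*} {x : Tuple4 K lam n} {i : Fin n} (h : x.HasArrow i) :
    (x.act i).spec = x.spec ∘ sw i := by
  rcases h with h | ⟨h1, h2, -⟩
  · rw [Tuple4.act, if_pos h.ne']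
  · rw [Tuple4.act, if_neg (not_not.mpr h1.symm), dif_pos h2]

open Classical in
/-- The product of the ratios over the inversions of a spectral vector; it gives the coefficients
of the symmetric polynomial, up to a scalar. -/
noncomputable def invProd (q s : K) (z : Fin (n + 1) → K) : K :=
  ∏ p : Fin (n + 1) × Fin (n + 1) with p.1 < p.2,
    if Succ q s (z p.1) (z p.2) then ratio s (z p.2) (z p.1) else 1

theorem invProd_ne_zero (I : MonomialIndep q s) (z : Fin (n + 1) → K) : invProd q s z ≠ 0 := by
  rw [invProd, Finset.prod_ne_zero_iff]
  intro p _
  split_ifs with h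
  · exact h.ratio_ne_zero I
  · exact one_ne_zero

theorem sw_lt_sw {i : Fin n} {a b : Fin (n + 1)} (h : a < b) (hne : (a, b) ≠ (i.castSucc, i.succ)) :
    sw i a < sw i b ∧ (sw i a, sw i b) ≠ (i.castSucc, i.succ) := by
  have hne' : ¬ (a = i.castSucc ∧ b = i.succ) := fun h' => hne (Prod.ext h'.1 h'.2)
  have hrev : ¬ (a = i.succ ∧ b = i.castSucc) := by
    rintro ⟨rfl, rfl⟩
    exact absurd h Fin.castSucc_lt_succ.asymm
  refine ⟨(sw_lt_sw_iff i hne' hrev).mpr h, fun h' => hrev ?_⟩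
  simp only [Prod.mk.injEq] at h'
  rw [sw, Equiv.swap_apply_eq_iff, Equiv.swap_apply_eq_iff, Equiv.swap_apply_left,
    Equiv.swap_apply_right] at h'
  exact h'

theorem invProd_comp_sw (I : MonomialIndep q s) {z : Fin (n + 1) → K} {i : Fin n}
    (h : Succ q s (z i.succ) (z i.castSucc)) :
    invProd q s (z ∘ sw i) = ratio s (z i.castSucc) (z i.succ) * invProd q s z := by
  classical
  have hmem : (i.castSucc, i.succ) ∈
      (Finset.univ.filter fun p : Fin (n + 1) × Fin (n + 1) => p.1 < p.2) := by
    simp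
  rw [invProd, invProd, ← Finset.mul_prod_erase _ _ hmem, ← Finset.mul_prod_erase _ _ hmem,
    if_neg (h.facts I).2.2.2.2, one_mul]
  congr 1
  · simp only [Function.comp, sw, Equiv.swap_apply_left, Equiv.swap_apply_right]
    rw [if_pos h]
  · refine Finset.prod_bij' (fun p _ => (sw i p.1, sw i p.2)) (fun p _ => (sw i p.1, sw i p.2))
      ?_ ?_ ?_ ?_ ?_
    · intro p hp
      simp only [Finset.mem_erase, Finset.mem_filter, Finset.mem_univ, true_and] at hp ⊢
      exact (sw_lt_sw hp.2 hp.1).symm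
    · intro p hp
      simp only [Finset.mem_erase, Finset.mem_filter, Finset.mem_univ, true_and] at hp ⊢
      exact (sw_lt_sw hp.2 hp.1).symm
    · intro p _
      simp [sw]
    · intro p _
      simp [sw]
    · intro p _
      rfl

end Order

/-! ### The components of the graph without affine arrows -/

section Components

variable {K : Type*} [Field K] {lam : YoungDiagram} {n : ℕ} {q s : K}
  {hlam : lam.card = n + 1} {T : Filling lam}

theorem mem_component_iff (I : MonomialIndep q s) {x : Tuple4 K lam n} :
    x ∈ component q s hlam T ↔ ∃ t v, x = vtx q s t v ∧ fill t v = T := by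
  constructor
  · rintro ⟨hx, y, -, rfl, h⟩
    obtain ⟨t, v, rfl⟩ := (isVertex_iff I hlam x).mp hx
    refine ⟨t, v, rfl, ?_⟩
    change fill (vtx q s t v).tab (vtx q s t v).ind = _
    generalize vtx q s t v = x at h
    induction h with
    | rel x y h =>
      obtain ⟨h1, -, i, -, rfl⟩ := h
      obtain ⟨t, v, rfl⟩ := (isVertex_iff I hlam x).mp h1
      obtain ⟨t', v', e, -, hf, -⟩ := vertex_cases I t v i
      rw [e]
      exact hf.symm
    | refl => rfl
    | symm x y _ ih => exact ih.symm
    | trans x y z _ _ ih1 ih2 => exact ih1.trans ih2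
  · rintro ⟨t, v, rfl, h⟩
    exact ⟨isVertex_vtx q s hlam t v, _, isVertex_vtx q s hlam t v, h, Relation.EqvGen.refl _⟩

theorem sum_eq_sum_fill (t : RST lam n) (v : Fin (n + 1) → ℕ) :
    ∑ j, v j = ∑ c, fill t v c := by
  rw [← Equiv.sum_comp t.pos]
  refine Eq.trans ?_ (Finset.sum_congr rfl fun k _ => (fill_pos t v k).symm)
  rw [← Equiv.sum_comp (std v) (decr v)]
  exact Finset.sum_congr rfl fun k _ => (decr_std v k).symm

/-- The vertex of the component given by a tableau and a composition. -/
theorem component_eq_vtx (I : MonomialIndep q s) (x : component q s hlam T) :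
    x.1 = vtx q s x.1.tab x.1.ind ∧ fill x.1.tab x.1.ind = T := by
  obtain ⟨t, v, h1, h2⟩ := (mem_component_iff I).mp x.2
  rw [h1]
  exact ⟨rfl, h2⟩

/-- All compositions in a component have the same degree, the sum of the entries of the filling. -/
theorem exists_component_embedding (I : MonomialIndep q s) (hlam : lam.card = n + 1)
    (T : Filling lam) :
    ∃ φ : component q s hlam T →
        {p : RST lam n × (Fin (n + 1) → ℕ) // ∑ j, p.2 j = ∑ c, T c},
      Function.Injective φ ∧
        ∀ x, macdonald q s hlam x.1 = vpoly q s (φ x).1.1 (φ x).1.2 := by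
  refine ⟨fun x => ⟨(x.1.tab, x.1.ind), ?_⟩, fun x y h => ?_, fun x => ?_⟩
  · rw [sum_eq_sum_fill x.1.tab, (component_eq_vtx I x).2]
  · simp only [Subtype.mk.injEq, Prod.mk.injEq] at h
    apply Subtype.ext
    rw [(component_eq_vtx I x).1, (component_eq_vtx I y).1, h.1, h.2]
  · rw [← macdonald_eq I hlam, ← (component_eq_vtx I x).1]

theorem finite_component (I : MonomialIndep q s) (hlam : lam.card = n + 1) (T : Filling lam) :
    Finite (component q s hlam T) := by
  obtain ⟨φ, h, -⟩ := exists_component_embedding I hlam T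
  have := finite_degree lam n (∑ c, T c)
  exact Finite.of_injective φ h

theorem linearIndependent_component (I : MonomialIndep q s) (hlam : lam.card = n + 1)
    (T : Filling lam) :
    LinearIndependent K (fun x : component q s hlam T => macdonald q s hlam x.1) := by
  obtain ⟨φ, h, hP⟩ := exists_component_embedding I hlam T
  have := (linearIndependent_vpoly I (∑ c, T c)).comp φ h
  convert this using 2 with x
  exact hP x

theorem act_mem_component (I : MonomialIndep q s) (x : component q s hlam T) (i : Fin n) :
    x.1.act i ∈ component q s hlam T := by
  obtain ⟨h1, h2⟩ := component_eq_vtx I x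
  obtain ⟨t', v', e, -, hf, -⟩ := vertex_cases I x.1.tab x.1.ind i
  rw [h1, e, mem_component_iff I]
  exact ⟨t', v', rfl, hf.trans h2⟩

/-- Induction along the arrows of a component, starting from its sorted vertex. -/
theorem component_induction (I : MonomialIndep q s) {p : component q s hlam T → Prop}
    (hroot : ∀ x : component q s hlam T,
      Monotone x.1.ind → StrictAnti (key T ∘ x.1.tab.pos) → p x)
    (hstep : ∀ (x : component q s hlam T) (i : Fin n), x.1.HasArrow i → p x →
      p ⟨x.1.act i, act_mem_component I x i⟩)
    (x : component q s hlam T) : p x := by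
  induction hm : potential x.1.tab x.1.ind using Nat.strong_induction_on generalizing x with
  | _ m ih =>
  obtain ⟨h1, h2⟩ := component_eq_vtx I x
  rcases exists_arrow_or_sorted q s x.1.tab x.1.ind with ⟨t', v', i, h3, h4, h5, -, h6⟩ | ⟨h3, h4⟩
  · have hy : vtx q s t' v' ∈ component q s hlam T :=
      (mem_component_iff I).mpr ⟨t', v', rfl, h5.trans h2⟩
    have := hstep ⟨_, hy⟩ i h3 (ih _ (hm ▸ h6) ⟨_, hy⟩ rfl)
    convert this
    rw [h4, ← h1]
  · rw [h2] at h4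
    exact hroot x h3 h4

theorem sorted_unique (I : MonomialIndep q s) {x y : component q s hlam T}
    (hx : Monotone x.1.ind) (hx' : StrictAnti (key T ∘ x.1.tab.pos))
    (hy : Monotone y.1.ind) (hy' : StrictAnti (key T ∘ y.1.tab.pos)) : x = y := by
  have ht : x.1.tab = y.1.tab := RST.pos_injective (equiv_eq_of_strictAnti _ hx' hy')
  have hdecr : ∀ v : Fin (n + 1) → ℕ, Monotone v → ∀ j, v j = decr v j.rev := by
    intro v hv j
    rw [decr, Tuple.sort_eq_refl_iff_monotone.mpr hv, Fin.rev_rev]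
    rfl
  have hv : x.1.ind = y.1.ind := by
    funext j
    rw [hdecr _ hx, hdecr _ hy, fill_eq_iff.mp (component_eq_vtx I x).2,
      fill_eq_iff.mp (component_eq_vtx I y).2, ht]
  apply Subtype.ext
  rw [(component_eq_vtx I x).1, (component_eq_vtx I y).1, ht, hv]

/-- The sorted vertex is the target of no arrow. -/
theorem not_hArrow_of_sorted (I : MonomialIndep q s) {x : component q s hlam T}
    (hx : Monotone x.1.ind) (hx' : StrictAnti (key T ∘ x.1.tab.pos)) (y : Tuple4 K lam n) :
    ¬ HArrow q s hlam y x.1 := by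
  rintro ⟨h1, -, i, h2, h3⟩
  obtain ⟨t, v, rfl⟩ := (isVertex_iff I hlam y).mp h1
  obtain ⟨e1, e2⟩ := component_eq_vtx I x
  rcases (hasArrow_vtx_iff t).mp h2 with h | ⟨k, h, hk, h4, h5⟩
  · rw [vtx_act_of_ne t h.ne, e1] at h3
    have := hx (Fin.castSucc_lt_succ (i := i)).le
    rw [(vtx_inj h3).2, comp_sw_castSucc, comp_sw_succ] at this
    omega
  · rw [vtx_act_of_eq h hk (t.isRST.exchange h4.ne h5.ne'), e1] at h3
    obtain ⟨e3, e4⟩ := vtx_inj h3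
    have e5 : x.1.tab.pos = (sw k).trans t.pos := by rw [e3, RST.pos_ofPos]
    have h6 := hx' (Fin.castSucc_lt_succ (i := k))
    simp only [Function.comp] at h6
    rw [fill_eq_iff] at e2
    rw [key_lt_iff, ← e2, ← e2, e4, e5, sw_trans_castSucc, sw_trans_succ] at h6
    have h7 : decr v k.castSucc = decr v k.succ := by
      rw [← hk, ← std_succ_of_eq h hk, decr_std, decr_std, h]
    omega

theorem isRootOf_iff (I : MonomialIndep q s) (x : component q s hlam T) :
    IsRootOf q s hlam T x.1 ↔ Monotone x.1.ind ∧ StrictAnti (key T ∘ x.1.tab.pos) := by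
  constructor
  · rintro ⟨-, h⟩
    obtain ⟨h1, h2⟩ := component_eq_vtx I x
    rcases exists_arrow_or_sorted q s x.1.tab x.1.ind with ⟨t', v', i, h3, h4, -⟩ | h3
    · exact absurd ⟨isVertex_vtx q s hlam t' v', x.2.1, i, h3, h1.trans h4.symm⟩ (h _)
    · rwa [h2] at h3
  · rintro ⟨h1, h2⟩
    exact ⟨x.2, not_hArrow_of_sorted I h1 h2⟩

theorem key_injective (F : Filling lam) : Function.Injective (key F) := by
  intro c d h
  have h1 : (F c, toLex (c.1.2, c.1.1)) = (F d, toLex (d.1.2, d.1.1)) := toLex.injective h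
  simp only [Prod.mk.injEq, EmbeddingLike.apply_eq_iff_eq] at h1
  exact Subtype.ext (Prod.ext h1.2.2 h1.2.1)

/-- The cells of a tableau can be numbered by decreasing key, and this gives a reverse standard
tableau. -/
theorem exists_sorted_tableau (hlam : lam.card = n + 1) (hT : IsTableau T) :
    ∃ t : RST lam n, StrictAnti (key T ∘ t.pos) := by
  let e : Fin (n + 1) ≃ Cell lam := (Fintype.equivFinOfCardEq (by
    rw [Fintype.card_coe]; exact hlam)).symm
  let f : Fin (n + 1) ≃ Cell lam := Fin.revPerm.trans ((Tuple.sort (key T ∘ e)).trans e)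
  have hf : StrictAnti (key T ∘ f) := by
    have h1 : StrictMono ((key T ∘ e) ∘ Tuple.sort (key T ∘ e)) :=
      (Tuple.monotone_sort _).strictMono_of_injective
        (((key_injective T).comp e.injective).comp (Equiv.injective _))
    intro a b hab
    exact h1 (Fin.rev_lt_rev.mpr hab)
  refine ⟨RST.ofPos f fun a b => ⟨fun h1 h2 => ?_, fun h1 h2 => ?_⟩, hf⟩
  · rw [← hf.lt_iff_gt]
    simp only [Function.comp]
    rw [key_lt_iff]
    have := (hT (f a) (f b)).1 h1 h2
    omega
  · rw [← hf.lt_iff_gt]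
    simp only [Function.comp]
    rw [key_lt_iff]
    have := (hT (f a) (f b)).2 h1 h2
    omega

theorem sorted_antitone {t : RST lam n} (ht : StrictAnti (key T ∘ t.pos)) :
    Antitone (T ∘ t.pos) := by
  intro a b hab
  rcases hab.eq_or_lt with rfl | hab
  · exact le_rfl
  have := ht hab
  simp only [Function.comp] at this ⊢
  rw [key_lt_iff] at this
  omega

theorem fill_antitone {t : RST lam n} (ht : Antitone (T ∘ t.pos)) :
    fill t (T ∘ t.pos) = T := by
  rw [fill_eq_iff]
  intro k
  have := decr_std (T ∘ t.pos) k
  rwa [std_of_antitone ht] at this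

theorem exists_root (I : MonomialIndep q s) (hlam : lam.card = n + 1) (hT : IsTableau T) :
    ∃ x : component q s hlam T, Monotone x.1.ind ∧ StrictAnti (key T ∘ x.1.tab.pos) := by
  obtain ⟨t, ht⟩ := exists_sorted_tableau hlam hT
  have ha := sorted_antitone ht
  have hf : fill t ((T ∘ t.pos) ∘ Fin.revPerm) = T := by
    conv_rhs => rw [← fill_antitone ha]
    unfold fill
    rw [decr_comp_perm]
  refine ⟨⟨vtx q s t ((T ∘ t.pos) ∘ Fin.revPerm), (mem_component_iff I).mpr ⟨_, _, rfl, hf⟩⟩,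
    fun a b hab => ha (Fin.rev_le_rev.mpr hab), ht⟩

end Components

/-! ### Symmetric elements of a component -/

section Symmetric

variable {K : Type*} [Field K] {lam : YoungDiagram} {n : ℕ} {q s : K}
  {hlam : lam.card = n + 1} {T : Filling lam}

/-- The move `s_i`, on the vertices of a component. -/
noncomputable def actC (I : MonomialIndep q s) (x : component q s hlam T) (i : Fin n) :
    component q s hlam T :=
  ⟨x.1.act i, act_mem_component I x i⟩

theorem component_cases (I : MonomialIndep q s) (x : component q s hlam T) (i : Fin n) :
    actC I (actC I x i) i = x ∧ ∃ A B : K,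
      bT s i (macdonald q s hlam x.1)
        = A • macdonald q s hlam x.1 + B • macdonald q s hlam (actC I x i).1 ∧
      ((x.1.HasArrow i ∧ ¬ (actC I x i).1.HasArrow i ∧ A = -xcf s x.1 i ∧ B = 1) ∨
      ((actC I x i).1.HasArrow i ∧ ¬ x.1.HasArrow i ∧ A = -xcf s x.1 i ∧
        B = (1 - xcf s x.1 i) * (s + xcf s x.1 i)) ∨
      (actC I x i = x ∧ ¬ x.1.HasArrow i ∧ A = s ∧ B = 0) ∨
      (actC I x i = x ∧ ¬ x.1.HasArrow i ∧ ¬ ColumnStrict T ∧ A = -1 ∧ B = 0)) := by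
  obtain ⟨h1, h2⟩ := component_eq_vtx I x
  obtain ⟨t', v', e1, e2, -, -, h⟩ := vertex_cases I x.1.tab x.1.ind i
  rw [← h1] at e1 e2 h
  have e3 : (actC I x i).1 = vtx q s t' v' := e1
  have hP : macdonald q s hlam x.1 = vpoly q s x.1.tab x.1.ind := by
    rw [← macdonald_eq I hlam, ← h1]
  have hP' : macdonald q s hlam (actC I x i).1 = vpoly q s t' v' := by
    rw [e3, macdonald_eq I hlam]
  refine ⟨Subtype.ext ?_, ?_⟩
  · rw [← e2, ← e3]
    rfl
  rw [hP, hP', e3]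
  rcases h with ⟨h3, h4, h⟩ | ⟨h3, h4, h⟩ | ⟨ht, hv, h4, h⟩ | ⟨ht, hv, h4, h5, h⟩
  · exact ⟨_, 1, by rw [h, one_smul], Or.inl ⟨h3, h4, rfl, rfl⟩⟩
  · exact ⟨_, _, h, Or.inr (Or.inl ⟨h3, h4, rfl, rfl⟩)⟩
  · refine ⟨s, 0, by rw [h, zero_smul, add_zero], Or.inr (Or.inr (Or.inl ⟨?_, h4, rfl, rfl⟩))⟩
    exact Subtype.ext (by rw [e3, ht, hv, ← h1])
  · refine ⟨-1, 0, by rw [h]; module,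
      Or.inr (Or.inr (Or.inr ⟨?_, h4, h2 ▸ h5, rfl, rfl⟩))⟩
    exact Subtype.ext (by rw [e3, ht, hv, ← h1])

theorem xcf_act {x : Tuple4 K lam n} {i : Fin n} (I : MonomialIndep q s)
    (h : Succ q s (x.spec i.succ) (x.spec i.castSucc)) (h' : x.HasArrow i) :
    xcf s (x.act i) i = 1 - s - xcf s x i := by
  obtain ⟨h0, h1, h2, -⟩ := h.facts I
  rw [xcf, xcf, act_spec h', comp_sw_castSucc, comp_sw_succ]
  linear_combination cf_add_cf (s := s) h0 h1 h2

theorem component_succ_iff (I : MonomialIndep q s) (x : component q s hlam T) (i : Fin n) :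
    Succ q s (x.1.spec i.succ) (x.1.spec i.castSucc) ↔ x.1.HasArrow i := by
  rw [(component_eq_vtx I x).1]
  exact succ_iff_hasArrow I _ _ i

/-- A family of coefficients that is multiplied along each arrow by the corresponding ratio. -/
def ArrowRec (I : MonomialIndep q s) (b : component q s hlam T → K) : Prop :=
  ∀ x i, x.1.HasArrow i →
    b (actC I x i) = ratio s (x.1.spec i.castSucc) (x.1.spec i.succ) * b x

theorem ArrowRec.eq_zero (I : MonomialIndep q s) {b : component q s hlam T → K}
    (hb : ArrowRec I b) {r : component q s hlam T} (hr : IsRootOf q s hlam T r.1)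
    (h0 : b r = 0) : b = 0 := by
  rw [isRootOf_iff I] at hr
  funext x
  refine component_induction I (p := fun x => b x = 0) (fun y h1 h2 => ?_)
    (fun y i h1 h2 => ?_) x
  · rw [sorted_unique I h1 h2 hr.1 hr.2, h0]
  · exact (hb y i h1).trans (by rw [h2, mul_zero])

theorem ArrowRec.eq_zero_of_apply (I : MonomialIndep q s) {b : component q s hlam T → K}
    (hb : ArrowRec I b) (hT : IsTableau T) {x : component q s hlam T} (h0 : b x = 0) : b = 0 := by
  obtain ⟨r, hr⟩ := exists_root I hlam hT
  refine hb.eq_zero I ((isRootOf_iff I r).mpr hr) ?_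
  revert h0
  refine component_induction I (p := fun x => b x = 0 → b r = 0) (fun y h1 h2 h0 => ?_)
    (fun y i h1 h2 h0 => h2 ?_) x
  · rw [← sorted_unique I h1 h2 hr.1 hr.2, h0]
  · have h3 := (hb y i h1).symm.trans h0
    exact (mul_eq_zero.mp h3).resolve_left
      (((component_succ_iff I y i).mpr h1).ratio_ne_zero I)

theorem MonomialIndep.s_add_one_ne_zero (I : MonomialIndep q s) : s + 1 ≠ 0 := fun h =>
  I.zpow_ne_one 2 (by norm_num) (by rw [zpow_ofNat]; linear_combination (s - 1) * h)

/-- An element of `MT`, given by its coefficients, is an eigenvector of a generator if and only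
if the coefficients satisfy the recursion along arrows and vanish at the falls where the generator
acts by `-1`. -/
theorem bT_sum_eq_iff (I : MonomialIndep q s) [Fintype (component q s hlam T)]
    (b : component q s hlam T → K) (i : Fin n) :
    bT s i (∑ x, b x • macdonald q s hlam x.1) = s • ∑ x, b x • macdonald q s hlam x.1 ↔
      ∀ x : component q s hlam T,
        (x.1.HasArrow i → b (actC I x i)
          = ratio s (x.1.spec i.castSucc) (x.1.spec i.succ) * b x) ∧
        (actC I x i = x → bT s i (macdonald q s hlam x.1) = -macdonald q s hlam x.1 →
          b x = 0) := by
  have hli := linearIndependent_component I hlam T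
  have hinv : ∀ x : component q s hlam T, actC I (actC I x i) i = x := fun x =>
    (component_cases I x i).1
  choose A B hT hAB using fun x : component q s hlam T => (component_cases I x i).2
  let e : component q s hlam T ≃ component q s hlam T :=
    ⟨fun x => actC I x i, fun x => actC I x i, hinv, hinv⟩
  have h1 : bT s i (∑ x, b x • macdonald q s hlam x.1) - s • ∑ x, b x • macdonald q s hlam x.1
      = ∑ x, (b x * A x + b (actC I x i) * B (actC I x i) - s * b x) •
          macdonald q s hlam x.1 := by
    have h2 : ∑ x, (b x * B x) • macdonald q s hlam (actC I x i).1
        = ∑ x, (b (actC I x i) * B (actC I x i)) • macdonald q s hlam x.1 := by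
      rw [← Equiv.sum_comp e]
      refine Finset.sum_congr rfl fun x _ => ?_
      change (b (actC I x i) * B (actC I x i)) • macdonald q s hlam (actC I (actC I x i) i).1 = _
      rw [hinv]
    have h3 : ∀ x, (b x * A x + b (actC I x i) * B (actC I x i) - s * b x) •
          macdonald q s hlam x.1 = ((b x * A x) • macdonald q s hlam x.1
            + (b (actC I x i) * B (actC I x i)) • macdonald q s hlam x.1)
            - (s * b x) • macdonald q s hlam x.1 := fun x => by module
    rw [Finset.sum_congr rfl fun x _ => h3 x, Finset.sum_sub_distrib, Finset.sum_add_distrib,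
      ← h2, map_sum, Finset.smul_sum, ← Finset.sum_add_distrib]
    congr 1
    · refine Finset.sum_congr rfl fun x _ => ?_
      rw [map_smul, hT, smul_add, smul_smul, smul_smul]
    · exact Finset.sum_congr rfl fun x _ => smul_smul _ _ _
  have h2 : bT s i (∑ x, b x • macdonald q s hlam x.1) = s • ∑ x, b x • macdonald q s hlam x.1 ↔
      ∀ x, b x * A x + b (actC I x i) * B (actC I x i) - s * b x = 0 := by
    rw [← sub_eq_zero, h1]
    exact ⟨Fintype.linearIndependent_iff.mp hli _,
      fun h => Finset.sum_eq_zero fun x _ => by rw [h, zero_smul]⟩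
  have hfall : ∀ x : component q s hlam T, actC I x i = x → ¬ x.1.HasArrow i := by
    intro x hx h
    rcases hAB x with ⟨-, h3, -⟩ | ⟨-, h3, -⟩ | ⟨-, h3, -⟩ | ⟨-, h3, -⟩
    · exact h3 (hx.symm ▸ h)
    all_goals exact h3 h
  -- the coefficients of the generator at the two ends of an arrow
  have harrow : ∀ x : component q s hlam T, x.1.HasArrow i → A x = -xcf s x.1 i ∧ B x = 1 ∧
      A (actC I x i) = -(1 - s - xcf s x.1 i) ∧
      B (actC I x i) = (s + xcf s x.1 i) * (1 - xcf s x.1 i) := by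
    intro x h
    have hc : xcf s (actC I x i).1 i = 1 - s - xcf s x.1 i :=
      xcf_act I ((component_succ_iff I x i).mpr h) h
    rcases hAB x with ⟨-, h3, hA, hB⟩ | ⟨-, h3, -⟩ | ⟨-, h3, -⟩ | ⟨-, h3, -⟩
    · refine ⟨hA, hB, ?_⟩
      rcases hAB (actC I x i) with ⟨h4, -⟩ | ⟨-, -, hA', hB'⟩ | ⟨h4, -⟩ | ⟨h4, -⟩
      · exact absurd h4 h3
      · rw [hA', hB', hc]
        exact ⟨rfl, by ring⟩
      · rw [hinv] at h4
        exact absurd (h4 ▸ h) h3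
      · rw [hinv] at h4
        exact absurd (h4 ▸ h) h3
    all_goals exact absurd h h3
  have hratio : ∀ x : component q s hlam T, x.1.HasArrow i →
      (1 - xcf s x.1 i) * ratio s (x.1.spec i.castSucc) (x.1.spec i.succ) = 1 := fun x h =>
    ((component_succ_iff I x i).mpr h).one_sub_cf_mul_ratio I
  rw [h2]
  constructor
  · refine fun h x => ⟨fun hx => ?_, fun hx hP => ?_⟩
    · obtain ⟨-, hB, hA', -⟩ := harrow x hx
      have h3 := h (actC I x i)
      rw [hinv, hB, hA'] at h3
      have h4 := hratio x hx
      linear_combination (-ratio s (x.1.spec i.castSucc) (x.1.spec i.succ)) * h3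
        - b (actC I x i) * h4
    · have h3 := h x
      rcases hAB x with ⟨h4, -⟩ | ⟨h4, -⟩ | ⟨-, -, hA, hB⟩ | ⟨-, -, -, hA, hB⟩
      · exact absurd h4 (hfall x hx)
      · exact absurd (hx ▸ h4) (hfall x hx)
      · have h5 := hT x
        rw [hP, hA, hB, zero_smul, add_zero] at h5
        have h6 : (s + 1) • macdonald q s hlam x.1 = 0 := by
          rw [add_smul, one_smul, ← h5, neg_add_cancel]
        exact absurd h6 (smul_ne_zero I.s_add_one_ne_zero (hli.ne_zero x))
      · rw [hx, hA, hB] at h3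
        refine (mul_eq_zero.mp ?_).resolve_left I.s_add_one_ne_zero
        linear_combination -h3
  · intro h x
    rcases hAB x with ⟨h4, -⟩ | ⟨h4, -⟩ | ⟨hx, -, hA, hB⟩ | ⟨hx, -, -, hA, hB⟩
    · obtain ⟨hA, -, -, hB⟩ := harrow x h4
      rw [hA, hB, (h x).1 h4]
      linear_combination ((s + xcf s x.1 i) * b x) * hratio x h4
    · obtain ⟨-, hB, hA, -⟩ := harrow _ h4
      have h5 := (h _).1 h4
      rw [hinv] at hA h5
      have h6 := hratio _ h4
      rw [hA, hB, h5]
      linear_combination (-b (actC I x i)) * h6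
    · rw [hx, hA, hB]
      ring
    · rw [hx, hB, (h x).2 hx (by rw [hT, hA, hB]; module)]
      ring

theorem mem_symMT_iff (I : MonomialIndep q s) [Fintype (component q s hlam T)]
    (f : VPoly K lam n) :
    f ∈ symMT q s hlam T ↔ ∃ b : component q s hlam T → K,
      f = ∑ x, b x • macdonald q s hlam x.1 ∧ ArrowRec I b ∧
      ∀ x i, actC I x i = x → bT s i (macdonald q s hlam x.1) = -macdonald q s hlam x.1 →
          b x = 0 := by
  have hker : f ∈ (⨅ i : Fin n, LinearMap.ker (bT s i - s • LinearMap.id :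
      VPoly K lam n →ₗ[K] VPoly K lam n)) ↔ ∀ i : Fin n, bT s i f = s • f := by
    simp only [Submodule.mem_iInf, LinearMap.mem_ker, LinearMap.sub_apply, LinearMap.smul_apply,
      LinearMap.id_apply, sub_eq_zero]
  rw [symMT, Submodule.mem_inf, hker, MT, Set.image_eq_range,
    Submodule.mem_span_range_iff_exists_fun]
  constructor
  · rintro ⟨⟨b, rfl⟩, h⟩
    exact ⟨b, rfl, fun x i => ((bT_sum_eq_iff I b i).mp (h i) x).1,
      fun x i => ((bT_sum_eq_iff I b i).mp (h i) x).2⟩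
  · rintro ⟨b, rfl, h1, h2⟩
    exact ⟨⟨b, rfl⟩, fun i => (bT_sum_eq_iff I b i).mpr fun x => ⟨h1 x i, h2 x i⟩⟩

theorem isSymCoeff_iff (I : MonomialIndep q s) (b : component q s hlam T → K) :
    IsSymCoeff q s hlam T b ↔
      (∀ x : component q s hlam T, IsRootOf q s hlam T x.1 → b x = 1) ∧ ArrowRec I b := by
  refine and_congr Iff.rfl ⟨fun h x i hx => ?_, fun h x y i hx hy => ?_⟩
  · exact h x (actC I x i) i ((component_succ_iff I x i).mpr hx) rfl
  · have : y = actC I x i := Subtype.ext hy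
    rw [this]
    exact h x i ((component_succ_iff I x i).mp hx)

theorem IsSymCoeff.eq_smul (I : MonomialIndep q s)
    {b b' : component q s hlam T → K} (hb : IsSymCoeff q s hlam T b) (hb' : ArrowRec I b')
    {r : component q s hlam T} (hr : IsRootOf q s hlam T r.1) : b' = b' r • b := by
  rw [isSymCoeff_iff I] at hb
  rw [← sub_eq_zero]
  refine ArrowRec.eq_zero I (fun x i hx => ?_) hr ?_
  · simp only [Pi.sub_apply, Pi.smul_apply, smul_eq_mul]
    rw [hb' x i hx, hb.2 x i hx]
    ring
  · simp only [Pi.sub_apply, Pi.smul_apply, smul_eq_mul]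
    rw [hb.1 r hr, mul_one, sub_self]

theorem existsUnique_isSymCoeff (I : MonomialIndep q s) (hlam : lam.card = n + 1)
    (hT : IsTableau T) : ∃! b : component q s hlam T → K, IsSymCoeff q s hlam T b := by
  obtain ⟨r, hr⟩ := exists_root I hlam hT
  have hr' := (isRootOf_iff I r).mpr hr
  have hb : IsSymCoeff q s hlam T fun x => invProd q s x.1.spec / invProd q s r.1.spec := by
    refine (isSymCoeff_iff I _).mpr ⟨fun x hx => ?_, fun x i hx => ?_⟩
    · obtain ⟨h1, h2⟩ := (isRootOf_iff I x).mp hx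
      rw [sorted_unique I h1 h2 hr.1 hr.2, div_self (invProd_ne_zero I _)]
    · change invProd q s (x.1.act i).spec / _ = _
      rw [act_spec hx, invProd_comp_sw I ((component_succ_iff I x i).mpr hx), mul_div_assoc]
  refine ⟨_, hb, fun b hb' => ?_⟩
  replace hb' := (isSymCoeff_iff I b).mp hb'
  rw [hb.eq_smul I hb'.2 hr', hb'.1 r hr', one_smul]

/-- For a tableau that is not column-strict, some vertex of the component has a fall where a
generator acts by `-1`: two neighbouring equal entries of a column carry consecutive numbers when
the cells are numbered by decreasing key. -/
theorem exists_column_fall (I : MonomialIndep q s) (hlam : lam.card = n + 1)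
    (hT : IsTableau T) (hcs : ¬ ColumnStrict T) :
    ∃ (x : component q s hlam T) (i : Fin n), actC I x i = x ∧
      bT s i (macdonald q s hlam x.1) = -macdonald q s hlam x.1 := by
  obtain ⟨t, ht⟩ := exists_sorted_tableau hlam hT
  have ha := sorted_antitone ht
  obtain ⟨c, d, hcol, hrow, hle⟩ : ∃ c d : Cell lam, c.1.2 = d.1.2 ∧ c.1.1 < d.1.1 ∧ T d ≤ T c := by
    unfold ColumnStrict at hcs
    push Not at hcs
    exact hcs
  have heq : T c = T d := le_antisymm ((hT c d).2 hcol hrow) hle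
  obtain ⟨a, rfl⟩ := t.pos.surjective c
  obtain ⟨b, rfl⟩ := t.pos.surjective d
  have hba : b < a := by
    rw [← ht.lt_iff_gt]
    simp only [Function.comp]
    rw [key_lt_iff]
    omega
  obtain ⟨k, rfl⟩ : ∃ k : Fin n, k.castSucc = b :=
    ⟨⟨b.1, by have := a.2; rw [Fin.lt_def] at hba; omega⟩, rfl⟩
  -- the number following that of the upper cell is carried by a cell of the same column
  have h1 : key T (t.pos a) ≤ key T (t.pos k.succ) :=
    ht.antitone (Fin.castSucc_lt_iff_succ_le.mp hba)
  have h2 : key T (t.pos k.succ) < key T (t.pos k.castSucc) := ht Fin.castSucc_lt_succ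
  rw [← not_lt, key_lt_iff] at h1
  rw [key_lt_iff] at h2
  have hv : (T ∘ t.pos) k.castSucc = (T ∘ t.pos) k.succ := by
    simp only [Function.comp]
    omega
  have hk : std (T ∘ t.pos) k.castSucc = k.castSucc := by rw [std_of_antitone ha]; rfl
  have hc : (t.pos k.castSucc).1.2 = (t.pos k.succ).1.2 := by omega
  refine ⟨⟨vtx q s t (T ∘ t.pos), (mem_component_iff I).mpr ⟨_, _, rfl, fill_antitone ha⟩⟩, k,
    Subtype.ext (vtx_act_of_fall hv hk (not_isRST_exchange t.isRST (Or.inr hc))), ?_⟩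
  rw [macdonald_eq I hlam, bT_vpoly_of_col I t hv hk hc]

theorem symMT_eq_bot (I : MonomialIndep q s) (hlam : lam.card = n + 1) (hT : IsTableau T)
    (hcs : ¬ ColumnStrict T) : symMT q s hlam T = ⊥ := by
  have := finite_component I hlam T
  have := Fintype.ofFinite (component q s hlam T)
  rw [Submodule.eq_bot_iff]
  intro f hf
  obtain ⟨b, rfl, h1, h2⟩ := (mem_symMT_iff I f).mp hf
  obtain ⟨x, i, h3, h4⟩ := exists_column_fall I hlam hT hcs
  rw [h1.eq_zero_of_apply I hT (h2 x i h3 h4)]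
  exact Finset.sum_eq_zero fun x _ => zero_smul _ _

theorem not_neg_of_columnStrict (I : MonomialIndep q s) (hcs : ColumnStrict T)
    (x : component q s hlam T) (i : Fin n) (hx : actC I x i = x) :
    bT s i (macdonald q s hlam x.1) ≠ -macdonald q s hlam x.1 := by
  intro hP
  obtain ⟨-, A, B, h, hAB⟩ := component_cases I x i
  rw [hx] at h hAB
  rcases hAB with ⟨h1, h2, -⟩ | ⟨h1, h2, -⟩ | ⟨-, -, hA, hB⟩ | ⟨-, -, h1, -⟩
  · exact h2 h1
  · exact h2 h1
  · rw [hP, hA, hB] at h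
    have h6 : (s + 1) • macdonald q s hlam x.1 = 0 := by
      rw [add_smul, one_smul]
      nth_rw 2 [← neg_neg (macdonald q s hlam x.1)]
      rw [h]
      module
    exact smul_ne_zero I.s_add_one_ne_zero
      ((linearIndependent_component I hlam T).ne_zero x) h6
  · exact h1 hcs

theorem symMacdonald_eq_sum [Fintype (component q s hlam T)] (b : component q s hlam T → K) :
    symMacdonald q s hlam T b = ∑ x, b x • macdonald q s hlam x.1 :=
  finsum_eq_sum_of_fintype _

theorem symMT_eq_span (I : MonomialIndep q s) (hT : IsTableau T) (hcs : ColumnStrict T)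
    {b : component q s hlam T → K} (hb : IsSymCoeff q s hlam T b) :
    symMT q s hlam T = Submodule.span K {symMacdonald q s hlam T b} := by
  have := finite_component I hlam T
  have := Fintype.ofFinite (component q s hlam T)
  obtain ⟨r, hr⟩ := exists_root I hlam hT
  have hr' := (isRootOf_iff I r).mpr hr
  rw [symMacdonald_eq_sum]
  apply le_antisymm
  · intro f hf
    obtain ⟨b', rfl, h1, -⟩ := (mem_symMT_iff I f).mp hf
    rw [Submodule.mem_span_singleton]
    refine ⟨b' r, ?_⟩
    rw [hb.eq_smul I h1 hr', Finset.smul_sum]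
    refine Finset.sum_congr rfl fun x _ => ?_
    rw [smul_smul, Pi.smul_apply, Pi.smul_apply, hb.1 r hr', smul_eq_mul, smul_eq_mul, mul_one]
  · rw [Submodule.span_singleton_le_iff_mem, mem_symMT_iff I]
    exact ⟨b, rfl, ((isSymCoeff_iff I b).mp hb).2, fun x i hx hP =>
      absurd hP (not_neg_of_columnStrict I hcs x i hx)⟩

theorem symMacdonald_ne_zero (I : MonomialIndep q s) (hT : IsTableau T)
    {b : component q s hlam T → K} (hb : IsSymCoeff q s hlam T b) :
    symMacdonald q s hlam T b ≠ 0 := by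
  have := finite_component I hlam T
  have := Fintype.ofFinite (component q s hlam T)
  obtain ⟨r, hr⟩ := exists_root I hlam hT
  rw [symMacdonald_eq_sum]
  intro h
  have h1 := Fintype.linearIndependent_iff.mp (linearIndependent_component I hlam T) b h r
  rw [hb.1 r ((isRootOf_iff I r).mpr hr)] at h1
  exact one_ne_zero h1

end Symmetric

end VVMac

theorem mainTheorem3 {K : Type*} [Field K] [CharZero K] (q s : K)
    (hqs : AlgebraicIndependent ℚ ![q, s]) (n : ℕ) (lam : YoungDiagram)
    (hlam : lam.card = n + 1) (T : VVMac.Filling lam) (hT : VVMac.IsTableau T) :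
    (VVMac.ColumnStrict T →
      Module.finrank K (VVMac.symMT q s hlam T) = 1 ∧
      (∃! b : VVMac.component q s hlam T → K, VVMac.IsSymCoeff q s hlam T b) ∧
      ∀ b : VVMac.component q s hlam T → K, VVMac.IsSymCoeff q s hlam T b →
        VVMac.symMT q s hlam T =
          Submodule.span K {VVMac.symMacdonald q s hlam T b}) ∧
    (¬ VVMac.ColumnStrict T → VVMac.symMT q s hlam T = ⊥) := by
  have I := VVMac.monomialIndep_of_algebraicIndependent hqs
  refine ⟨fun hcs => ⟨?_, VVMac.existsUnique_isSymCoeff I hlam hT, fun b hb =>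
    VVMac.symMT_eq_span I hT hcs hb⟩, fun hcs => VVMac.symMT_eq_bot I hlam hT hcs⟩
  obtain ⟨b, hb, -⟩ := VVMac.existsUnique_isSymCoeff I hlam hT
  rw [VVMac.symMT_eq_span I hT hcs hb]
  exact finrank_span_singleton (VVMac.symMacdonald_ne_zero I hT hb)
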